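/- **Setting.** A locally compact separable metric space $(M,\rho)$ is a *metric graph* if there are a countable set $V\subset M$ (vertices) and a partition $\{E_j\}_{j\in J}$ of $M\setminus V$ (edges) such that every $E_j$ is open in $M$ and isometric to an interval $(0,L_j)$, $0<L_j\le\infty$, and for every $v\in V$ the set $J(v)=\{j: v\in\partial E_j\}$ is non-empty and finite and $\{v\}\cup\bigcup_{j\in J(v)}E_j$ is a neighbourhood of $v$. A *simple open set* is a bounded connected open set $O\subset M$ containing at most one vertex and with $\partial O\cap V=\emptyset$; a *simple compact set* is a compact set that is the closure of a simple open set. For $n\in\mathbb N$ let $(\mathsf P^{(n)}_t)_{t\ge0}$ be a Feller transition function on $M^n$ (a semigroup of Markov kernels that maps $C_0(M^n)$ into itself and is strongly continuous there). Consider the conditions * (TF1) for distinct indices $i_1,\dots,i_k\in\{1,\dots,n\}$, $t\ge0$, $x\in M^n$ and Borel $B\subset M^k$: $\mathsf P^{(n)}_t(x,\pi_{i_1,\dots,i_k}^{-1}B)=\mathsf P^{(k)}_t(\pi_{i_1,\dots,i_k}x,B)$, where $\pi_{i_1,\dots,i_k}x=(x_{i_1},\dots,x_{i_k})$; * (TF2)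 $\mathsf P^{(2)}_t((x,x),\{(y,y):y\in M\})=1$ for all $x\in M$, $t\ge 0$; * (TF3) for every compact $K\subset M$ and $r>0$: $\lim_{t\downarrow0}t^{-1}\sup_{x\in K}\mathsf P^{(1)}_t(x,\{y:\rho(x,y)>r\})=0$; * (TF5) for every simple compact $K\subset M$ there are $\beta,p>0$ such that for all $(x,y)\in K^2$ and $\varepsilon>0$ with $\rho(x,y)\le\varepsilon$, $$\mathbb P^{(2)}_{(x,y)}[\sigma\wedge\tau>\beta\varepsilon^2]\le 1-p,$$ where $\mathbb P^{(2)}_{(x,y)}$ is the law on $C([0,\infty),M^2)$ of the Markov process $(X,Y)$ with transition function $\mathsf P^{(2)}$ started at $(x,y)$, $\sigma=\inf\{t:(X_t,Y_t)\notin K^2\}$ and $\tau=\inf\{t:X_t=Y_t\}$. Let $F$ be the space of measurable mappings $M\to M$ with the cylindrical $\sigma$-field. A *stochastic flow of measurable mappings associated to* $(\mathsf P^{(n)})$ is a family $\psi=(\psi_{s,t})_{s\le t}$ of random elements of $F$ on a probability space such that 1. $\mathbb E f(\psi_{s,t}(x_1),\dots,\psi_{s,t}(x_n))=\mathsf P^{(n)}_{t-s}f(x)$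 for all $s\le t$, $n$, $x\in M^n$, $f\in C_0(M^n)$; 2. there are measurable mappings $\mathcal J_t:F\times M\to M$, $t\ge 0$, with $\mathcal J_{t-s}(\psi_{s,t})(x)=\psi_{s,t}(x)$ a.s., $\psi_{s,u}(x)=\mathcal J_{u-t}(\psi_{t,u})(\psi_{s,t}(x))$ a.s. and $\psi_{s,s}(x)=x$ a.s., for all $s\le t\le u$ and $x\in M$; 3. $\psi_{t_1,t_2},\dots,\psi_{t_{n-1},t_n}$ are independent for $t_1\le\dots\le t_n$; 4. $\lim_{(u,v)\to(s,t)}\sup_{x}\mathbb E[(f(\psi_{u,v}(x))-f(\psi_{s,t}(x)))^2]=0$ (with $u\le v$) for $f\in C_0(M)$ and $s\le t$; 5. $\lim_{y\to x}\mathbb E[(f(\psi_{s,t}(y))-f(\psi_{s,t}(x)))^2]=0$ and $\lim_{y\to\infty}\mathbb E[f(\psi_{s,t}(y))^2]=0$ for $f\in C_0(M)$, $x\in M$ and $s\le t$. Let $X=\bigcup_{s\in\mathbb R}C([s,\infty):M)$; for $f\in C([s,\infty):M)$ put $i(f)=s$ and $e(f)(t)=f(s\vee t)$, $t\in\mathbb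 R$. Topologize $X$ by the embedding $f\mapsto(i(f),e(f))\in\mathbb R\times C(\mathbb R:M)$ (uniform convergence on compact sets). A sequence $(\varphi_n)$ in $X$, with $s_n=i(\varphi_n)$, is a *skeleton* if (a) $\varphi_m(s)=\varphi_n(s)$ with $s\ge s_m\vee s_n$ implies $\varphi_m=\varphi_n$ on $[s,\infty)$; (b) $\{(s_n,\varphi_n(s_n)):n\in\mathbb N\}$ is dense in $\mathbb R\times M$; (c) for every compact $L\subset\mathbb R\times M$ the set of restrictions $\{\varphi_n|_{[s,\infty)}: s_n\le s,\ (s,\varphi_n(s))\in L\}$ is relatively compact in $X$. It has the *instantaneous coalescence property* if for all $s<t$ the set $\{\varphi_n(t):s_n\le s\}$ is locally finite in $M$. **Theorem.** Let $M$ be a metric graph, let $(\mathsf P^{(n)})_{n}$ be a sequence of Feller transition functions on the spaces $M^n$ satisfying (TF1), (TF2), (TF3) and (TF5), and let $\psi$ be a stochastic flow of measurable mappings in $M$ associated to it. Let $((s_n,x_n))_{n\in\mathbb N}$ be a dense sequence in $\mathbb R\times M$ and, for each $n$, let $\Phi_n$ be a continuous modification of $(\psi_{s_n,t}(x_n))_{t\ge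 s_n}$ with $\Phi_n(s_n)=x_n$. Then almost surely $\Phi=(\Phi_n)_{n\in\mathbb N}$ is a skeleton that possesses the instantaneous coalescence property. -/

import Mathlib

open Set Filter Topology MeasureTheory ProbabilityTheory
open scoped NNReal ENNReal

noncomputable section

namespace CoalescingFlow

universe u v

/-! ### The space of continuous paths, skeletons, instantaneous coalescence -/

section Paths

variable (M : Type u) [TopologicalSpace M]

/-- The space `X = ⋃ₛ C([s, ∞) : M)` of continuous paths with a starting time. -/
def PathSpace : Type u := Σ s : ℝ, C(Set.Ici s, M)

variable {M}

namespace PathSpace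

/-- The starting time `i(f)` of a path. -/
def start (f : PathSpace M) : ℝ := f.1

/-- The continuous extension `e(f)(t) = f(s ∨ t)` of a path `f : [s, ∞) → M` to `ℝ`. -/
def ext (f : PathSpace M) : C(ℝ, M) where
  toFun t := f.2 (Set.projIci f.1 t)
  continuous_toFun := f.2.continuous.comp <|
    Continuous.subtype_mk (continuous_const.max continuous_id) _

/-- The restriction `f[s, ∞)` of (the extension of) `f` to `[s, ∞)`. -/
def restrictIci (f : PathSpace M) (s : ℝ) : PathSpace M :=
  ⟨s, f.ext.restrict (Set.Ici s)⟩

/-- The topology making `f ↦ (i(f), e(f))` an embedding into `ℝ × C(ℝ, M)`, where `C(ℝ, M)` has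
the topology of uniform convergence on compact sets. -/
instance : TopologicalSpace (PathSpace M) :=
  TopologicalSpace.induced (fun f => (f.start, f.ext)) inferInstance

end PathSpace

/-- Skeletons in `M`: coalescence, density of the starting points, relative compactness. -/
structure IsSkeleton (φ : ℕ → PathSpace M) : Prop where
  coalescence : ∀ (s : ℝ) (m n : ℕ), (φ m).start ≤ s → (φ n).start ≤ s →
    (φ m).ext s = (φ n).ext s → ∀ t, s ≤ t → (φ m).ext t = (φ n).ext t
  dense : DenseRange fun n => ((φ n).start, (φ n).ext (φ n).start)
  relCompact : ∀ L : Set (ℝ × M), IsCompact L →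
    IsCompact (closure {g : PathSpace M |
      ∃ (n : ℕ) (s : ℝ), (φ n).start ≤ s ∧ (s, (φ n).ext s) ∈ L ∧ g = (φ n).restrictIci s})

/-- A subset is locally finite if every point of the space has a neighbourhood containing only
finitely many points of it. -/
def LocallyFiniteSubset (S : Set M) : Prop :=
  ∀ x : M, ∃ U ∈ 𝓝 x, (S ∩ U).Finite

/-- The instantaneous coalescence property. -/
def HasICP (φ : ℕ → PathSpace M) : Prop :=
  ∀ s t : ℝ, s < t → LocallyFiniteSubset {y : M | ∃ n, (φ n).start ≤ s ∧ y = (φ n).ext t}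

end Paths

/-! ### Feller transition functions and the law of the associated continuous Markov process -/

section Feller

variable {E : Type u} [TopologicalSpace E] [MeasurableSpace E]

/-- A Feller transition function on `E`: a semigroup of Markov kernels acting on the functions
vanishing at infinity, strongly continuous there. -/
structure IsFellerTransition (P : ℝ≥0 → Kernel E E) : Prop where
  markov : ∀ t, IsMarkovKernel (P t)
  zero : P 0 = Kernel.id
  semigroup : ∀ s t, P (s + t) = P t ∘ₖ P s
  feller : ∀ (t : ℝ≥0) (f : ZeroAtInftyContinuousMap E ℝ),
    ∃ g : ZeroAtInftyContinuousMap E ℝ, ∀ x, g x = ∫ y, f y ∂(P t x)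
  strongly_continuous : ∀ f : ZeroAtInftyContinuousMap E ℝ,
    TendstoUniformly (fun (t : ℝ≥0) (x : E) => ∫ y, f y ∂(P t x)) (fun x => f x) (𝓝 0)

/-- The `σ`-field on `C([0, ∞) : E)` generated by the coordinate mappings. -/
instance : MeasurableSpace C(ℝ≥0, E) :=
  MeasurableSpace.comap (fun (w : C(ℝ≥0, E)) (t : ℝ≥0) => w t) MeasurableSpace.pi

/-- The `σ`-field generated by the coordinates up to time `s`. -/
@[reducible]
def canonicalPast (s : ℝ≥0) : MeasurableSpace C(ℝ≥0, E) :=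
  ⨆ r : Set.Iic s, MeasurableSpace.comap (fun w : C(ℝ≥0, E) => w r) inferInstance

/-- `Q` is the distribution on `C([0, ∞) : E)` under which the canonical process is a Markov
process with transition function `P` and starting point `z`; there is at most one such `Q`. -/
structure IsMarkovLaw (P : ℝ≥0 → Kernel E E) (z : E) (Q : Measure C(ℝ≥0, E)) : Prop where
  prob : IsProbabilityMeasure Q
  start : ∀ᵐ w ∂Q, w 0 = z
  markov : ∀ (s t : ℝ≥0) (A : Set C(ℝ≥0, E)) (B : Set E),
    MeasurableSet[canonicalPast s] A → MeasurableSet B →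
      Q (A ∩ {w | w (s + t) ∈ B}) = ∫⁻ w in A, P t (w s) B ∂Q

end Feller

/-! ### Consistent sequences of coalescing transition functions -/

section Transition

variable {M : Type u} [MetricSpace M] [MeasurableSpace M]

/-- Consistent sequences of coalescing Feller transition functions: `P n` is a Feller transition
function on `Mⁿ`, consistent under projections to coordinates, and the
two-point motion stays on the diagonal. -/
structure IsConsistentCoalescing
    (P : ∀ n : ℕ, ℝ≥0 → Kernel (Fin n → M) (Fin n → M)) : Prop where
  feller : ∀ n, IsFellerTransition (P n)
  consistent : ∀ (k n : ℕ) (i : Fin k ↪ Fin n) (t : ℝ≥0) (x : Fin n → M) (B : Set (Fin k → M)),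
    MeasurableSet B → P n t x {y | (fun j => y (i j)) ∈ B} = P k t (fun j => x (i j)) B
  coalescing : ∀ (x : M) (t : ℝ≥0), P 2 t ![x, x] {y | y 0 = y 1} = 1

/-- Condition of continuity of trajectories: `t⁻¹ sup_{x ∈ K} P¹ₜ(x, {y : ρ(x, y) > r}) → 0` as `t ↓ 0`. -/
def HasSmallJumps (P : ℝ≥0 → Kernel (Fin 1 → M) (Fin 1 → M)) : Prop :=
  ∀ (K : Set M) (r : ℝ), IsCompact K → 0 < r →
    Tendsto (fun t : ℝ≥0 => (t : ℝ≥0∞)⁻¹ * ⨆ x ∈ K, P t (fun _ => x) {y | r < dist x (y 0)})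
      (𝓝[>] 0) (𝓝 0)

/-- The exit time `inf {t : (X_t, Y_t) ∉ K²}`, with value `∞` if there is no such `t`. -/
def exitTime (K : Set M) (w : C(ℝ≥0, Fin 2 → M)) : ℝ≥0∞ :=
  ⨅ (t : ℝ≥0) (_ : ¬ (w t 0 ∈ K ∧ w t 1 ∈ K)), (t : ℝ≥0∞)

/-- The meeting time `inf {t : X_t = Y_t}`, with value `∞` if there is no such `t`. -/
def meetingTime (w : C(ℝ≥0, Fin 2 → M)) : ℝ≥0∞ :=
  ⨅ (t : ℝ≥0) (_ : w t 0 = w t 1), (t : ℝ≥0∞)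

end Transition

/-! ### Stochastic flows of measurable mappings -/

section Flow

variable {M : Type u} [MetricSpace M] [MeasurableSpace M]

/-- The space of measurable mappings `M → M`; its `σ`-field is the cylindrical one (inherited from
the product `σ`-field of `M → M`). -/
abbrev MeasurableMap (M : Type u) [MeasurableSpace M] : Type u := {f : M → M // Measurable f}

/-- `ψ` is a stochastic flow of measurable mappings in `M` associated to the sequence `P` of
transition functions. Only the `ψ s t` with `s ≤ t` are relevant. -/
structure IsStochasticFlow {Ω : Type v} [MeasurableSpace Ω] (μ : Measure Ω)
    (P : ∀ n : ℕ, ℝ≥0 → Kernel (Fin n → M) (Fin n → M))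
    (ψ : ℝ → ℝ → Ω → MeasurableMap M) : Prop where
  measurable : ∀ s t, s ≤ t → Measurable (ψ s t)
  /-- The `n`-point motions have transition functions `P n`. -/
  npoint : ∀ (s t : ℝ), s ≤ t → ∀ (n : ℕ) (x : Fin n → M)
    (f : ZeroAtInftyContinuousMap (Fin n → M) ℝ),
    ∫ ω, f (fun i => (ψ s t ω).1 (x i)) ∂μ = ∫ y, f y ∂(P n (t - s).toNNReal x)
  /-- The (weak) flow property. -/
  flow : ∃ J : ℝ≥0 → MeasurableMap M × M → M, (∀ t, Measurable (J t)) ∧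
    ∀ (s t r : ℝ), s ≤ t → t ≤ r → ∀ x : M,
      (∀ᵐ ω ∂μ, J (t - s).toNNReal (ψ s t ω, x) = (ψ s t ω).1 x) ∧
      (∀ᵐ ω ∂μ, (ψ s r ω).1 x = J (r - t).toNNReal (ψ t r ω, (ψ s t ω).1 x)) ∧
      (∀ᵐ ω ∂μ, (ψ s s ω).1 x = x)
  /-- Independence of increments. -/
  indep : ∀ (n : ℕ) (t : Fin (n + 1) → ℝ), Monotone t →
    iIndepFun (fun i : Fin n => ψ (t i.castSucc) (t i.succ)) μ
  /-- Continuity in time. -/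
  time_continuity : ∀ (f : ZeroAtInftyContinuousMap M ℝ) (s t : ℝ), s ≤ t →
    TendstoUniformly
      (fun (p : ℝ × ℝ) (x : M) => ∫ ω, (f ((ψ p.1 p.2 ω).1 x) - f ((ψ s t ω).1 x)) ^ 2 ∂μ)
      (fun _ => 0) (𝓝[{p : ℝ × ℝ | p.1 ≤ p.2}] (s, t))
  /-- Continuity in space. -/
  space_continuity : ∀ (f : ZeroAtInftyContinuousMap M ℝ) (x : M) (s t : ℝ), s ≤ t →
    Tendsto (fun y : M => ∫ ω, (f ((ψ s t ω).1 y) - f ((ψ s t ω).1 x)) ^ 2 ∂μ) (𝓝 x) (𝓝 0)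
  /-- Vanishing at infinity. -/
  vanishing : ∀ (f : ZeroAtInftyContinuousMap M ℝ) (s t : ℝ), s ≤ t →
    Tendsto (fun y : M => ∫ ω, (f ((ψ s t ω).1 y)) ^ 2 ∂μ) (cocompact M) (𝓝 0)

/-- `Φ` is a continuous modification of the trajectory `ψ_{s,·}(x)`, started exactly at `x` at
time `s`. -/
structure IsContinuousModification {Ω : Type v} [MeasurableSpace Ω] (μ : Measure Ω)
    (ψ : ℝ → ℝ → Ω → MeasurableMap M) (s : ℝ) (x : M) (Φ : Ω → PathSpace M) : Prop where
  start_eq : ∀ ω, (Φ ω).start = s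
  measurable : ∀ t, Measurable fun ω => (Φ ω).ext t
  start_value : ∀ ω, (Φ ω).ext s = x
  modification : ∀ t, s ≤ t → ∀ᵐ ω ∂μ, (Φ ω).ext t = (ψ s t ω).1 x

end Flow

/-! ### Metric graphs -/

section Graph

/-- A metric graph structure on the metric space `M`: a countable set `V` of vertices and a
partition of `M \ V` into open edges `E j`, each isometric to an interval `(0, L j)` with
`0 < L j ≤ ∞`, such that every vertex `v` lies in the boundary of at least one and at most
finitely many edges, which together with `v` form a neighbourhood of `v`. -/
structure MetricGraph (M : Type u) [MetricSpace M] where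
  V : Set M
  countable_V : V.Countable
  J : Type u
  E : J → Set M
  disjoint_E : ∀ i j, i ≠ j → Disjoint (E i) (E j)
  iUnion_E : ⋃ j, E j = Vᶜ
  isOpen_E : ∀ j, IsOpen (E j)
  L : J → ℝ≥0∞
  L_pos : ∀ j, 0 < L j
  e : ∀ j, {t : ℝ // 0 < t ∧ ENNReal.ofReal t < L j} ≃ᵢ E j
  adjacent_nonempty : ∀ v ∈ V, {j | v ∈ frontier (E j)}.Nonempty
  adjacent_finite : ∀ v ∈ V, {j | v ∈ frontier (E j)}.Finite
  star_mem_nhds : ∀ v ∈ V, {v} ∪ ⋃ j ∈ {j | v ∈ frontier (E j)}, E j ∈ 𝓝 v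

variable {M : Type u} [MetricSpace M]

/-- Simple open sets: bounded connected open sets containing at most one vertex and having no
vertex in the boundary. -/
structure MetricGraph.IsSimpleOpen (G : MetricGraph M) (O : Set M) : Prop where
  bounded : Bornology.IsBounded O
  connected : IsConnected O
  isOpen : IsOpen O
  vertex : (O ∩ G.V).Subsingleton
  frontier : frontier O ∩ G.V = ∅

/-- Simple compact sets: compact closures of simple open sets. (If bounded subsets of `M` are
relatively compact, compactness is automatic.) -/
def MetricGraph.IsSimpleCompact (G : MetricGraph M) (K : Set M) : Prop :=
  IsCompact K ∧ ∃ O, G.IsSimpleOpen O ∧ K = closure O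

/-- For every simple compact `K` there are `β, p > 0` such that, for `x, y ∈ K` and `ε > 0`
with `ρ(x, y) ≤ ε`, the two-point motion `(X, Y)` started from `(x, y)` satisfies
`P[σ ∧ τ > β ε²] ≤ 1 - p`, with `σ` the exit time from `K²` and `τ` the meeting time. -/
def MetricGraph.HasFastCoalescence [MeasurableSpace M] (G : MetricGraph M)
    (P : ℝ≥0 → Kernel (Fin 2 → M) (Fin 2 → M)) : Prop :=
  ∀ K : Set M, G.IsSimpleCompact K → ∃ β p : ℝ, 0 < β ∧ 0 < p ∧
    ∀ x ∈ K, ∀ y ∈ K, ∀ ε : ℝ, 0 < ε → dist x y ≤ ε →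
      ∀ Q : Measure C(ℝ≥0, Fin 2 → M), IsMarkovLaw P ![x, y] Q →
        Q.real {w | ENNReal.ofReal (β * ε ^ 2) < min (exitTime K w) (meetingTime w)} ≤ 1 - p

end Graph

end CoalescingFlow

end

set_option linter.unusedSectionVars false

/-! Both conclusions follow deterministically from countably many almost sure statements about the
paths `Φ n`, and these rest on three probabilistic facts.

Coalescence (`ae_coalescence`). Finite families of paths are Markov with transition functions `P n`
(`isMarkovFrom_paths`). If `f` vanishes on the diagonal, the Feller property and the absorption at
the diagonal make the expectation of `f` small, uniformly in bounded times, for starting points near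
the diagonal in a compact set. A first entrance estimate then shows that two paths which have come
arbitrarily close together cannot be apart later; no strong Markov property is needed.

Barriers (`ae_noCrossing`). By the small jump condition a path started near a point leaves a small
ball within time `h` with probability `o(h)`. Since `O(1/h)` paths serve a bounded time interval,
near every point there is, at each time, a path staying there for a time bounded below. A ball in a
metric graph is a star with finitely many legs. With a barrier in each leg, a path crossing a
spherical shell must meet the barrier of its leg, because a leg is one-dimensional, and coalesces
with it before the crossing is completed. So no path at all crosses the shell quickly.

Counting (`ae_finite_survivors`). A ball of a star splits into at most `C / ε` cells of diameter at
most `ε`. Among `n` distinct surviving positions, at least `(n - C / ε) / 2` disjoint pairs are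
therefore `ε`-close, and each pair loses a member with probability at least `p` in any time longer
than `β ε²`. Taking `ε` of order `1 / n`, the times needed to come down from any initial number form
a geometric series, so the expected number of survivors is bounded independently of the number of
paths. The fast coalescence hypothesis speaks of laws with deterministic starting points; it applies
conditionally on the past through a disintegration (`exists_kernel_isMarkovLaw`).

Absence of crossings turns finiteness of survivors into instantaneous coalescence. Shortly after
passing a compact set the paths follow finitely many continuous paths, which yields compact
containment; with equicontinuity from small cells, Arzelà–Ascoli gives relative compactness. -/

noncomputable section

namespace CoalescingFlow

universe u v


/-! ### Continuity properties of Feller semigroups. -/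

section FellerBasics

variable {E : Type u} [MetricSpace E] [LocallyCompactSpace E] [SecondCountableTopology E]
  [MeasurableSpace E] [BorelSpace E]

/-- A finite measure is determined by the integrals of functions vanishing at infinity. -/
theorem measure_ext_of_zeroAtInfty {μ ν : Measure E} [IsFiniteMeasure μ] [IsFiniteMeasure ν]
    (h : ∀ f : ZeroAtInftyContinuousMap E ℝ, ∫ x, f x ∂μ = ∫ x, f x ∂ν) : μ = ν := by
  refine Measure.ext_of_integral_eq_on_compactlySupported fun f => ?_
  exact h ⟨f.toContinuousMap, zero_at_infty f⟩

theorem zeroAtInfty_integrable (f : ZeroAtInftyContinuousMap E ℝ) (μ : Measure E)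
    [IsFiniteMeasure μ] : Integrable (fun x => f x) μ := by
  exact BoundedContinuousFunction.integrable μ f.toBCF

variable {P : ℝ≥0 → Kernel E E}

namespace IsFellerTransition

theorem integral_add (hP : IsFellerTransition P) (f : ZeroAtInftyContinuousMap E ℝ) (s t : ℝ≥0)
    (x : E) : ∫ y, f y ∂(P (s + t) x) = ∫ z, ∫ y, f y ∂(P t z) ∂(P s x) := by
  have := hP.markov
  rw [hP.semigroup, Kernel.integral_comp]
  exact zeroAtInfty_integrable f _

/-- The difference is `P t` applied to `P h f - f`, and `P t` is a contraction for the supremum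
norm. -/
theorem abs_integral_add_sub_le (hP : IsFellerTransition P) (f : ZeroAtInftyContinuousMap E ℝ)
    {ε : ℝ} {h : ℝ≥0} (hε : ∀ x, |∫ y, f y ∂(P h x) - f x| ≤ ε) (t : ℝ≥0) (x : E) :
    |∫ y, f y ∂(P (t + h) x) - ∫ y, f y ∂(P t x)| ≤ ε := by
  have := hP.markov
  obtain ⟨g, hg⟩ := hP.feller h f
  rw [hP.integral_add]
  simp only [← hg] at hε ⊢
  rw [← integral_sub (zeroAtInfty_integrable g _) (zeroAtInfty_integrable f _)]
  have := norm_integral_le_of_norm_le_const (μ := P t x) (f := fun y => g y - f y) (C := ε)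
    (Eventually.of_forall hε)
  simpa using this

/-- The action of a Feller semigroup on functions vanishing at infinity is jointly continuous. -/
theorem continuous_integral (hP : IsFellerTransition P) (f : ZeroAtInftyContinuousMap E ℝ) :
    Continuous fun p : ℝ≥0 × E => ∫ y, f y ∂(P p.1 p.2) := by
  rw [continuous_iff_continuousAt]
  rintro ⟨t₀, x₀⟩
  rw [Metric.continuousAt_iff']
  intro ε hε
  obtain ⟨g, hg⟩ := hP.feller t₀ f
  have h1 : ∀ᶠ h : ℝ≥0 in 𝓝 0, ∀ x, |∫ y, f y ∂(P h x) - f x| ≤ ε / 2 := by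
    have := Metric.tendstoUniformly_iff.1 (hP.strongly_continuous f) (ε / 2) (by positivity)
    filter_upwards [this] with h hh x
    have := (hh x).le
    rwa [dist_comm, Real.dist_eq] at this
  -- Strong continuity at `0` gives two-sided continuity at `t₀`, uniformly in the point: the later
  -- of the two times is written as the earlier one plus an increment.
  have h2 : ∀ᶠ t : ℝ≥0 in 𝓝 t₀, ∀ x, |∫ y, f y ∂(P t x) - ∫ y, f y ∂(P t₀ x)| ≤ ε / 2 := by
    have ha : Tendsto (fun t : ℝ≥0 => t - t₀) (𝓝 t₀) (𝓝 0) := by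
      have : Continuous fun t : ℝ≥0 => t - t₀ := by fun_prop
      simpa using this.tendsto t₀
    have hb : Tendsto (fun t : ℝ≥0 => t₀ - t) (𝓝 t₀) (𝓝 0) := by
      have : Continuous fun t : ℝ≥0 => t₀ - t := by fun_prop
      simpa using this.tendsto t₀
    filter_upwards [ha.eventually h1, hb.eventually h1] with t hta htb x
    rcases le_total t₀ t with h | h
    · have := hP.abs_integral_add_sub_le f hta t₀ x
      rwa [add_tsub_cancel_of_le h] at this
    · have := hP.abs_integral_add_sub_le f htb t x
      rw [add_tsub_cancel_of_le h] at this
      rwa [abs_sub_comm]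
  have h3 : ∀ᶠ x in 𝓝 x₀, |g x - g x₀| < ε / 2 := by
    have := Metric.continuousAt_iff'.1 (g.continuous.continuousAt (x := x₀)) (ε / 2) (by positivity)
    simpa [Real.dist_eq] using! this
  filter_upwards [(h2.prod_nhds h3)] with p hp
  rw [Real.dist_eq]
  have e1 := hp.1 p.2
  have e2 := hp.2
  rw [hg, hg] at e2
  have := abs_sub_le (∫ y, f y ∂(P p.1 p.2)) (∫ y, f y ∂(P t₀ p.2)) (∫ y, f y ∂(P t₀ x₀))
  linarith

end IsFellerTransition

end FellerBasics

/-! ### Markov processes and the first entrance estimate. -/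

section MarkovProcess

variable {Ω : Type v} [mΩ : MeasurableSpace Ω] {E : Type u} [MeasurableSpace E]

/-- `Z` is, from time `u` on, a Markov process for the filtration `F` with transition
function `P`. -/
structure IsMarkovFrom (μ : Measure Ω) (F : ℝ → MeasurableSpace Ω) (P : ℝ≥0 → Kernel E E)
    (u : ℝ) (Z : ℝ → Ω → E) : Prop where
  mono : Monotone F
  le : ∀ t, F t ≤ mΩ
  adapted : ∀ t, u ≤ t → Measurable[F t] (Z t)
  markov : ∀ t, u ≤ t → ∀ (h : ℝ≥0) (A : Set Ω) (B : Set E), MeasurableSet[F t] A →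
    MeasurableSet B → μ (A ∩ Z (t + h) ⁻¹' B) = ∫⁻ ω in A, P h (Z t ω) B ∂μ

namespace IsMarkovFrom

variable {μ : Measure Ω} {F : ℝ → MeasurableSpace Ω} {P : ℝ≥0 → Kernel E E}
  {u : ℝ} {Z : ℝ → Ω → E}

theorem measurable (hZ : IsMarkovFrom μ F P u Z) {t : ℝ} (ht : u ≤ t) : Measurable (Z t) :=
  (hZ.adapted t ht).mono (hZ.le t) le_rfl

theorem lintegral (hZ : IsMarkovFrom μ F P u Z) {t : ℝ} (ht : u ≤ t) (h : ℝ≥0) {A : Set Ω}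
    (hA : MeasurableSet[F t] A) {φ : E → ℝ≥0∞} (hφ : Measurable φ) :
    ∫⁻ ω in A, φ (Z (t + h) ω) ∂μ = ∫⁻ ω in A, ∫⁻ y, φ y ∂(P h (Z t ω)) ∂μ := by
  have hm := hZ.measurable ht
  have hm' : Measurable (Z (t + h)) := hZ.measurable (ht.trans (by simp))
  have hA' := hZ.le t A hA
  have key : (μ.restrict A).map (Z (t + h)) = ((μ.restrict A).map (Z t)).bind (P h) := by
    ext B hB
    rw [Measure.map_apply hm' hB, Measure.restrict_apply (hm' hB), inter_comm,
      hZ.markov t ht h A B hA hB, Measure.bind_apply hB (P h).measurable.aemeasurable,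
      lintegral_map ((P h).measurable_coe hB) hm]
  rw [← lintegral_map hφ hm', key, Measure.lintegral_bind (P h).measurable.aemeasurable
    hφ.aemeasurable, lintegral_map hφ.lintegral_kernel hm]

/-- Adding the times in increasing order splits the event by the first time `a` at which `D` is
visited. The part with first visit at `a` lies in `F a`, so the Markov property at `a` bounds the
integral over it. -/
theorem setLIntegral_biUnion_finset_le (hZ : IsMarkovFrom μ F P u Z) {T : ℝ} {D : Set E}
    (hD : MeasurableSet D) {φ : E → ℝ≥0∞} (hφ : Measurable φ) {c : ℝ≥0∞} (S : Finset ℝ)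
    (hS : ∀ q ∈ S, u ≤ q ∧ q ≤ T)
    (hc : ∀ q ∈ S, ∀ z ∈ D, ∫⁻ y, φ y ∂(P (T - q).toNNReal z) ≤ c) :
    ∫⁻ ω in ⋃ q ∈ S, Z q ⁻¹' D, φ (Z T ω) ∂μ ≤ c * μ (⋃ q ∈ S, Z q ⁻¹' D) := by
  induction S using Finset.induction_on_max with
  | empty => simp
  | insert a S ha ih =>
    have ih := ih (fun q hq => hS q (Finset.mem_insert_of_mem hq))
      (fun q hq => hc q (Finset.mem_insert_of_mem hq))
    have haT := hS a (Finset.mem_insert_self _ _)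
    set H := ⋃ q ∈ S, Z q ⁻¹' D with hH
    have hHm : MeasurableSet[F a] H := by
      refine MeasurableSet.biUnion S.countable_toSet fun q hq => ?_
      exact hZ.mono (ha q hq).le _
        (hZ.adapted q (hS q (Finset.mem_insert_of_mem hq)).1 hD)
    have hHm' := hZ.le a _ hHm
    have hG : MeasurableSet[F a] (Z a ⁻¹' D \ H) := (hZ.adapted a haT.1 hD).diff hHm
    have hG' := hZ.le a _ hG
    have hU : ⋃ q ∈ insert a S, Z q ⁻¹' D = H ∪ (Z a ⁻¹' D \ H) := by
      rw [Finset.set_biUnion_insert, union_sdiff_self, union_comm]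
    have hdisj : Disjoint H (Z a ⁻¹' D \ H) := disjoint_sdiff_self_right
    rw [hU, lintegral_union hG' hdisj, measure_union hdisj hG', mul_add]
    refine add_le_add ih ?_
    have hT : T = a + ((T - a).toNNReal : ℝ) := by
      rw [Real.coe_toNNReal _ (by linarith)]; ring
    calc ∫⁻ ω in Z a ⁻¹' D \ H, φ (Z T ω) ∂μ
        = ∫⁻ ω in Z a ⁻¹' D \ H, ∫⁻ y, φ y ∂(P (T - a).toNNReal (Z a ω)) ∂μ := by
          conv_lhs => rw [hT]
          exact hZ.lintegral haT.1 _ hG hφ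
      _ ≤ ∫⁻ ω in Z a ⁻¹' D \ H, c ∂μ := by
          refine setLIntegral_mono' hG' fun ω hω => ?_
          exact hc a (Finset.mem_insert_self _ _) _ hω.1
      _ = c * μ (Z a ⁻¹' D \ H) := by simp

/-- First entrance estimate: if started anywhere in `D` the expectation of `φ` at the terminal
time is at most `c`, then so it is on the event that `D` is visited. -/
theorem setLIntegral_biUnion_le (hZ : IsMarkovFrom μ F P u Z) {T : ℝ} {D : Set E}
    (hD : MeasurableSet D) {φ : E → ℝ≥0∞} (hφ : Measurable φ) {c : ℝ≥0∞} {Q : Set ℝ}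
    (hQ : Q.Countable) (hS : ∀ q ∈ Q, u ≤ q ∧ q ≤ T)
    (hc : ∀ q ∈ Q, ∀ z ∈ D, ∫⁻ y, φ y ∂(P (T - q).toNNReal z) ≤ c) :
    ∫⁻ ω in ⋃ q ∈ Q, Z q ⁻¹' D, φ (Z T ω) ∂μ ≤ c * μ (⋃ q ∈ Q, Z q ⁻¹' D) := by
  classical
  rcases Q.eq_empty_or_nonempty with rfl | hne
  · simp
  obtain ⟨e, he⟩ := hQ.exists_eq_range hne
  have heQ : ∀ n, e n ∈ Q := fun n => he ▸ mem_range_self n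
  have hU : ⋃ q ∈ Q, Z q ⁻¹' D = ⋃ n, Z (e n) ⁻¹' D := by
    rw [he, biUnion_range]
  have hmeas : ∀ n, MeasurableSet (Z (e n) ⁻¹' D) := fun n => hZ.measurable (hS _ (heQ n)).1 hD
  have hmU : MeasurableSet (⋃ n, Z (e n) ⁻¹' D) := MeasurableSet.iUnion hmeas
  -- As a function of the event, the left side is a measure, hence continuous along the increasing
  -- finite unions.
  rw [hU, ← withDensity_apply _ hmU, measure_iUnion_eq_iSup_accumulate]
  refine iSup_le fun n => ?_
  have hacc : accumulate (fun n => Z (e n) ⁻¹' D) n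
      = ⋃ q ∈ (Finset.range (n + 1)).image e, Z q ⁻¹' D := by
    ext ω
    simp [accumulate_def]
  have hfin := hZ.setLIntegral_biUnion_finset_le hD hφ (c := c) (T := T)
    ((Finset.range (n + 1)).image e)
    (fun q hq => by
      obtain ⟨k, -, rfl⟩ := Finset.mem_image.1 hq
      exact hS _ (heQ k))
    (fun q hq => by
      obtain ⟨k, -, rfl⟩ := Finset.mem_image.1 hq
      exact hc _ (heQ k))
  have hm : MeasurableSet (accumulate (fun n => Z (e n) ⁻¹' D) n) := by
    rw [accumulate_def]
    exact MeasurableSet.biUnion (to_countable _) fun k _ => hmeas k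
  rw [withDensity_apply _ hm]
  rw [← hacc] at hfin
  exact hfin.trans (by gcongr; exact accumulate_subset_iUnion n)

end IsMarkovFrom

end MarkovProcess


/-! ### Independence of past and future, and the Markov property of the paths. -/

namespace PathSpace

variable {M : Type u} [TopologicalSpace M]

theorem ext_of_le_start (f : PathSpace M) {r : ℝ} (hr : r ≤ f.start) :
    f.ext r = f.ext f.start := by
  have h1 : Set.projIci f.1 r = Set.projIci f.1 f.1 :=
    (Set.projIci_of_le hr).trans (Set.projIci_self f.1).symm
  exact congrArg f.2 h1

theorem restrictIci_ext (f : PathSpace M) (s t : ℝ) : (f.restrictIci s).ext t = f.ext (max s t) :=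
  rfl

end PathSpace

/-- A finite set of times before `t` can be enumerated increasingly, followed by `t` and `t'`. -/
theorem exists_monotone_enumeration (S : Finset ℝ) (t t' : ℝ) (htt' : t ≤ t')
    (hS : ∀ r ∈ S, r ≤ t) :
    ∃ (m : ℕ) (τ : ℕ → ℝ), Monotone τ ∧ τ m = t ∧ τ (m + 1) = t' ∧ ∀ r ∈ S, ∃ j ≤ m, τ j = r := by
  induction S using Finset.induction_on_max generalizing t t' with
  | empty =>
    refine ⟨0, fun j => if j = 0 then t else t', ?_, by simp, by simp, by simp⟩
    refine monotone_nat_of_le_succ fun j => ?_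
    by_cases hj : j = 0 <;> simp [hj, htt']
  | insert a S ha ih =>
    obtain ⟨m, τ, hτ, hm, hm', hr⟩ := ih a t (hS a (Finset.mem_insert_self _ _))
      (fun r hr => (ha r hr).le)
    refine ⟨m + 1, fun j => if j ≤ m + 1 then τ j else t', ?_, by simpa using hm', by simp, ?_⟩
    · refine monotone_nat_of_le_succ fun j => ?_
      rcases lt_trichotomy j (m + 1) with h | h | h
      · have h' : j + 1 ≤ m + 1 := h
        simp only [h.le, h', if_true]
        exact hτ (Nat.le_succ j)
      · subst h
        simp [hm', htt']
      · have h1 : ¬ j ≤ m + 1 := by omega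
        have h2 : ¬ j + 1 ≤ m + 1 := by omega
        simp [h1, h2]
    · intro r hrS
      rcases Finset.mem_insert.1 hrS with rfl | h
      · exact ⟨m, by omega, by simp [hm]⟩
      · obtain ⟨j, hj, rfl⟩ := hr r h
        exact ⟨j, by omega, by simp [show j ≤ m + 1 by omega]⟩

section FlowMarkov

variable {M : Type u} [MetricSpace M] [LocallyCompactSpace M] [SecondCountableTopology M]
  [MeasurableSpace M] [BorelSpace M]
  {P : ∀ n : ℕ, ℝ≥0 → Kernel (Fin n → M) (Fin n → M)}
  {Ω : Type v} [mΩ : MeasurableSpace Ω] {μ : Measure Ω} [IsProbabilityMeasure μ]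
  {ψ : ℝ → ℝ → Ω → MeasurableMap M} {s : ℕ → ℝ} {x : ℕ → M} {Φ : ℕ → Ω → PathSpace M}

theorem measurable_eval_measurableMap (y : M) : Measurable fun g : MeasurableMap M => g.1 y :=
  (measurable_pi_apply y).comp measurable_subtype_coe

namespace IsStochasticFlow

theorem measurable_apply (hψ : IsStochasticFlow μ P ψ) {a b : ℝ} (hab : a ≤ b) (y : M) :
    Measurable fun ω => (ψ a b ω).1 y :=
  (measurable_eval_measurableMap y).comp (hψ.measurable a b hab)

/-- The law of the `n`-point motion. -/
theorem map_eq (hψ : IsStochasticFlow μ P ψ) (hP : IsConsistentCoalescing P) {a b : ℝ}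
    (hab : a ≤ b) {n : ℕ} (y : Fin n → M) :
    μ.map (fun ω i => (ψ a b ω).1 (y i)) = P n (b - a).toNNReal y := by
  have := (hP.feller n).markov (b - a).toNNReal
  have hm : Measurable fun ω i => (ψ a b ω).1 (y i) :=
    measurable_pi_lambda _ fun i => hψ.measurable_apply hab (y i)
  have : IsProbabilityMeasure (μ.map (fun ω i => (ψ a b ω).1 (y i))) :=
    Measure.isProbabilityMeasure_map hm.aemeasurable
  refine measure_ext_of_zeroAtInfty fun f => ?_
  rw [integral_map (f := fun y => f y) hm.aemeasurable
    f.continuous.measurable.aestronglyMeasurable]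
  exact hψ.npoint a b hab n y f

/-- A trajectory sampled on a grid is almost surely a measurable function of the increments of the
flow along the grid. -/
theorem exists_eq_increments (hψ : IsStochasticFlow μ P ψ) {τ : ℕ → ℝ} (hτ : Monotone τ) (m : ℕ)
    {a b : ℕ} (hab : a ≤ b) (hb : b ≤ m) (y : M) :
    ∃ g : (Fin m → MeasurableMap M) → M, Measurable g ∧
      ∀ᵐ ω ∂μ, (ψ (τ a) (τ b) ω).1 y = g fun k => ψ (τ k) (τ (k + 1)) ω := by
  obtain ⟨J, hJm, hJ⟩ := hψ.flow
  induction b, hab using Nat.le_induction with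
  | base =>
    refine ⟨fun _ => y, measurable_const, ?_⟩
    exact (hJ (τ a) (τ a) (τ a) le_rfl le_rfl y).2.2
  | succ b hab ih =>
    obtain ⟨g, hg, hgω⟩ := ih (by omega)
    refine ⟨fun w => J (τ (b + 1) - τ b).toNNReal (w ⟨b, by omega⟩, g w),
      (hJm _).comp ((measurable_pi_apply _).prodMk hg), ?_⟩
    filter_upwards [hgω, (hJ (τ a) (τ b) (τ (b + 1)) (hτ hab) (hτ (Nat.le_succ b)) y).2.1]
      with ω h1 h2
    rw [h2, h1]

end IsStochasticFlow

/-- The filtration generated by the paths `Φ n`. -/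
@[reducible]
def pathFiltration (Φ : ℕ → Ω → PathSpace M) (t : ℝ) : MeasurableSpace Ω :=
  ⨆ p : ℕ × Set.Iic t, MeasurableSpace.comap (fun ω => (Φ p.1 ω).ext p.2) inferInstance

theorem pathFiltration_mono (Φ : ℕ → Ω → PathSpace M) : Monotone (pathFiltration Φ) :=
  fun _ b hab => iSup_le fun p => le_iSup (fun p : ℕ × Set.Iic b =>
    MeasurableSpace.comap (fun ω => (Φ p.1 ω).ext p.2) inferInstance) ⟨p.1, p.2, p.2.2.trans hab⟩

theorem pathFiltration_le (hΦ : ∀ n, IsContinuousModification μ ψ (s n) (x n) (Φ n)) (t : ℝ) :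
    pathFiltration Φ t ≤ mΩ :=
  iSup_le fun p => ((hΦ p.1).measurable p.2).comap_le

theorem measurable_pathFiltration (Φ : ℕ → Ω → PathSpace M) (n : ℕ) {r t : ℝ} (hr : r ≤ t) :
    Measurable[pathFiltration Φ t] fun ω => (Φ n ω).ext r :=
  Measurable.of_comap_le (le_iSup (fun p : ℕ × Set.Iic t =>
    MeasurableSpace.comap (fun ω => (Φ p.1 ω).ext p.2) inferInstance) (n, ⟨r, hr⟩))

theorem IsContinuousModification.ext_of_le {n : ℕ}
    (hΦ : IsContinuousModification μ ψ (s n) (x n) (Φ n)) {r : ℝ} (hr : r ≤ s n) (ω : Ω) :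
    (Φ n ω).ext r = x n := by
  rw [PathSpace.ext_of_le_start _ (by rwa [hΦ.start_eq]), hΦ.start_eq, hΦ.start_value]

/-- On a grid containing all starting and observation times and ending with `t`, `t'`, the observed
values are functions of the increments before `t`, while `ψ t t'` is the last increment. -/
theorem indepFun_paths_increment (hψ : IsStochasticFlow μ P ψ)
    (hΦ : ∀ n, IsContinuousModification μ ψ (s n) (x n) (Φ n)) {t t' : ℝ} (htt' : t ≤ t')
    (S : Finset (ℕ × Set.Iic t)) :
    IndepFun (fun ω (p : S) => (Φ p.1.1 ω).ext p.1.2) (ψ t t') μ := by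
  classical
  -- Starting times are cut off at the observation time so that the grid stays before `t`; a path
  -- observed before it starts has the constant value `x n`.
  obtain ⟨m, τ, hτ, hm, hm', hr⟩ := exists_monotone_enumeration
    (S.image (fun p => min (s p.1) p.2) ∪ S.image (fun p => (p.2 : ℝ))) t t' htt' (by
      intro r hr
      rcases Finset.mem_union.1 hr with h | h <;> obtain ⟨p, -, rfl⟩ := Finset.mem_image.1 h
      · exact (min_le_right _ _).trans p.2.2
      · exact p.2.2)
  have hg : ∀ p : S, ∃ g : (Fin m → MeasurableMap M) → M, Measurable g ∧
      ∀ᵐ ω ∂μ, (Φ p.1.1 ω).ext p.1.2 = g fun k => ψ (τ k) (τ (k + 1)) ω := by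
    rintro ⟨p, hp⟩
    rcases le_total (p.2 : ℝ) (s p.1) with h | h
    · exact ⟨fun _ => x p.1, measurable_const, Eventually.of_forall fun ω => (hΦ p.1).ext_of_le h ω⟩
    · obtain ⟨a, ha, hae⟩ := hr (s p.1) (Finset.mem_union_left _ (Finset.mem_image.2
        ⟨p, hp, min_eq_left h⟩))
      obtain ⟨b, hb, hbe⟩ := hr p.2 (Finset.mem_union_right _ (Finset.mem_image.2 ⟨p, hp, rfl⟩))
      have key : ∃ a' ≤ b, τ a' = s p.1 := by
        rcases le_total a b with hab | hab
        · exact ⟨a, hab, hae⟩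
        -- The enumeration may repeat values, so the index of the starting time can exceed that of
        -- the observation time; the two times then coincide.
        · refine ⟨b, le_rfl, ?_⟩
          have := hτ hab
          rw [hae, hbe] at this
          rw [hbe]; exact le_antisymm this h
      obtain ⟨a', ha', hae'⟩ := key
      obtain ⟨g, hgm, hg⟩ := hψ.exists_eq_increments hτ m ha' hb (x p.1)
      refine ⟨g, hgm, ?_⟩
      filter_upwards [hg, (hΦ p.1).modification p.2 h] with ω h1 h2
      rw [← h1, h2, hae', hbe]
  choose g hgm hg using hg
  have hind := hψ.indep (m + 1) (fun k => τ k) (fun a b h => hτ h)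
  have hmeas : ∀ i : Fin (m + 1), Measurable (ψ (τ i.castSucc) (τ i.succ)) := fun i =>
    hψ.measurable _ _ (hτ (by simp))
  have h2 := hind.indepFun_finset (Finset.univ.image (Fin.castSucc : Fin m → Fin (m + 1)))
    {Fin.last m} (by
      rw [Finset.disjoint_singleton_right]
      simp) hmeas
  have hlast : Measurable fun w : ({Fin.last m} : Finset (Fin (m + 1))) → MeasurableMap M =>
      w ⟨Fin.last m, Finset.mem_singleton_self _⟩ :=
    measurable_pi_apply (⟨Fin.last m, Finset.mem_singleton_self _⟩ : ({Fin.last m} : Finset _))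
  have h3 := h2.comp
    (φ := fun w (p : S) => g p fun k => w ⟨k.castSucc, Finset.mem_image_of_mem _ (Finset.mem_univ k)⟩)
    (ψ := fun w => w ⟨Fin.last m, Finset.mem_singleton_self _⟩)
    (measurable_pi_lambda _ fun p => (hgm p).comp
      (measurable_pi_lambda _ fun k => measurable_pi_apply _))
    hlast
  refine h3.congr ?_ ?_
  · have : ∀ᵐ ω ∂μ, ∀ p : S, (Φ p.1.1 ω).ext p.1.2 = g p fun k => ψ (τ k) (τ (k + 1)) ω :=
      ae_all_iff.2 hg
    filter_upwards [this] with ω hω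
    funext p
    exact (hω p).symm
  · refine Eventually.of_forall fun ω => ?_
    simp [hm, hm']

/-- The past is the directed supremum of the `σ`-fields generated by finitely many observations. -/
theorem indep_pathFiltration_increment (hψ : IsStochasticFlow μ P ψ)
    (hΦ : ∀ n, IsContinuousModification μ ψ (s n) (x n) (Φ n)) {t t' : ℝ} (htt' : t ≤ t') :
    Indep (pathFiltration Φ t) (MeasurableSpace.comap (ψ t t') inferInstance) μ := by
  classical
  have key : pathFiltration Φ t = ⨆ S : Finset (ℕ × Set.Iic t), MeasurableSpace.comap
      (fun ω (p : S) => (Φ p.1.1 ω).ext p.1.2) inferInstance := by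
    apply le_antisymm
    · refine iSup_le fun p => ?_
      refine le_iSup_of_le {p} ?_
      rintro _ ⟨B, hB, rfl⟩
      exact ⟨_, measurable_pi_apply (⟨p, Finset.mem_singleton_self p⟩ : ({p} : Finset _)) hB, rfl⟩
    · refine iSup_le fun S => Measurable.comap_le ?_
      exact @measurable_pi_lambda _ _ _ (pathFiltration Φ t) _ _ fun p =>
        measurable_pathFiltration Φ _ p.1.2.2
  rw [key]
  refine indep_iSup_of_directed_le (fun S => ?_) (fun S => ?_)
    (hψ.measurable t t' htt').comap_le ?_
  · exact (IndepFun_iff_Indep _ _ _).1 (indepFun_paths_increment hψ hΦ htt' S)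
  · exact Measurable.comap_le (measurable_pi_lambda _ fun p => (hΦ _).measurable _)
  · refine Monotone.directed_le fun S S' hSS' => ?_
    refine Measurable.comap_le (@measurable_pi_lambda _ _ _ (_) _ _ fun p => ?_)
    rintro B hB
    exact ⟨_, measurable_pi_apply (⟨p.1, hSS' p.2⟩ : S') hB, rfl⟩

/-- The `n`-point motions built from the paths `Φ` are Markov processes. -/
theorem isMarkovFrom_paths (hP : IsConsistentCoalescing P) (hψ : IsStochasticFlow μ P ψ)
    (hΦ : ∀ n, IsContinuousModification μ ψ (s n) (x n) (Φ n)) {n : ℕ} (i : Fin n → ℕ) {u : ℝ}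
    (hu : ∀ j, s (i j) ≤ u) :
    IsMarkovFrom μ (pathFiltration Φ) (P n) u fun t ω j => (Φ (i j) ω).ext t where
  mono := pathFiltration_mono Φ
  le := pathFiltration_le hΦ
  adapted t _ := @measurable_pi_lambda _ _ _ (_) _ _ fun j =>
    measurable_pathFiltration Φ (i j) le_rfl
  markov := by
    intro t ht h A B hA hB
    classical
    obtain ⟨J, hJm, hJ⟩ := hψ.flow
    set t' : ℝ := t + h with ht'
    have htt' : t ≤ t' := by simp [ht']
    have hh : (t' - t).toNNReal = h := by simp [ht']
    set Y : Ω → Fin n → M := fun ω j => (Φ (i j) ω).ext t with hY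
    have hYm : Measurable[pathFiltration Φ t] Y := @measurable_pi_lambda _ _ _ (_) _ _ fun j =>
      measurable_pathFiltration Φ (i j) le_rfl
    -- `V` records all that is needed from the past: the occurrence of `A` and the current
    -- positions. It is independent of the increment.
    set V : Ω → Prop × (Fin n → M) := fun ω => (ω ∈ A, Y ω) with hV
    have hAm : Measurable[pathFiltration Φ t] fun ω => ω ∈ A :=
      (@measurableSet_setOfPred _ (pathFiltration Φ t) (fun ω => ω ∈ A)).1 hA
    have hVm : Measurable[pathFiltration Φ t] V := hAm.prodMk hYm
    have hVm' : Measurable V := hVm.mono (pathFiltration_le hΦ t) le_rfl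
    have hGm := hψ.measurable t t' htt'
    have hind : IndepFun V (ψ t t') μ := by
      rw [IndepFun_iff_Indep]
      exact indep_of_indep_of_le_left (indep_pathFiltration_increment hψ hΦ htt') hVm.comap_le
    rw [indepFun_iff_map_prod_eq_prod_map_map hVm'.aemeasurable hGm.aemeasurable] at hind
    -- Joint measurability in the map and the point is provided by `J h`, which replaces evaluation;
    -- the two agree almost surely only at a fixed point.
    set C : Set ((Prop × (Fin n → M)) × MeasurableMap M) :=
      {q | q.1.1 ∧ (fun j => J h (q.2, q.1.2 j)) ∈ B} with hC
    have hJC : Measurable fun q : (Prop × (Fin n → M)) × MeasurableMap M =>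
        fun j => J h (q.2, q.1.2 j) := by
      refine measurable_pi_lambda _ fun j => (hJm h).comp ?_
      exact measurable_snd.prodMk ((measurable_pi_apply j).comp (measurable_snd.comp measurable_fst))
    have hCm : MeasurableSet C :=
      (measurableSet_setOfPred.2 (measurable_fst.comp measurable_fst)).inter (hJC hB)
    have hsec : ∀ y : Fin n → M, μ.map (ψ t t') {g | (fun j => J h (g, y j)) ∈ B} = P n h y B := by
      intro y
      have hm : MeasurableSet {g : MeasurableMap M | (fun j => J h (g, y j)) ∈ B} := by
        refine (measurable_pi_lambda _ fun j => (hJm h).comp ?_) hB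
        exact measurable_id.prodMk measurable_const
      have hm2 : Measurable fun ω j => (ψ t t' ω).1 (y j) :=
        measurable_pi_lambda _ fun j => hψ.measurable_apply htt' (y j)
      rw [Measure.map_apply hGm hm, ← hh, ← hψ.map_eq hP htt' y, Measure.map_apply hm2 hB]
      refine measure_congr ?_
      have : ∀ᵐ ω ∂μ, ∀ j, J (t' - t).toNNReal (ψ t t' ω, y j) = (ψ t t' ω).1 (y j) :=
        ae_all_iff.2 fun j => (hJ t t' t' htt' le_rfl (y j)).1
      filter_upwards [this] with ω hω
      apply propext
      change (fun j => J (t' - t).toNNReal (ψ t t' ω, y j)) ∈ B ↔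
        (fun j => (ψ t t' ω).1 (y j)) ∈ B
      simp only [hω]
    have hleft : μ (A ∩ (fun ω j => (Φ (i j) ω).ext t') ⁻¹' B)
        = μ ((fun ω => (V ω, ψ t t' ω)) ⁻¹' C) := by
      refine measure_congr ?_
      have : ∀ᵐ ω ∂μ, ∀ j, (Φ (i j) ω).ext t' = J h (ψ t t' ω, Y ω j) := by
        refine ae_all_iff.2 fun j => ?_
        have hj := (hu j).trans ht
        filter_upwards [(hΦ (i j)).modification t hj, (hΦ (i j)).modification t' (hj.trans htt'),
          (hJ (s (i j)) t t' hj htt' (x (i j))).2.1] with ω h1 h2 h3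
        rw [h2, h3, hh, ← h1]
      filter_upwards [this] with ω hω
      apply propext
      change (ω ∈ A ∧ (fun j => (Φ (i j) ω).ext t') ∈ B) ↔
        (ω ∈ A ∧ (fun j => J h (ψ t t' ω, Y ω j)) ∈ B)
      simp only [hω]
    -- Fubini for the product law: the section over `V ω` has measure `P n h (Y ω) B` on `A` and is
    -- empty off `A`.
    rw [hleft, ← Measure.map_apply (hVm'.prodMk hGm) hCm, hind, Measure.prod_apply hCm,
      lintegral_map (measurable_measure_prodMk_left hCm) hVm',
      ← lintegral_indicator (pathFiltration_le hΦ t A hA)]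
    refine lintegral_congr fun ω => ?_
    by_cases hω : ω ∈ A
    · rw [indicator_of_mem hω, ← hsec]
      congr 1
      ext g
      simp [hC, hV, hY, hω]
    · rw [indicator_of_notMem hω]
      have : Prod.mk (V ω) ⁻¹' C = ∅ := by
        ext g
        simp [hC, hV, hω]
      rw [this, measure_empty]

end FlowMarkov


/-! ### Paths stay together after meeting. -/

section Coalescence

variable {M : Type u} [MetricSpace M] [LocallyCompactSpace M] [SecondCountableTopology M]
  [MeasurableSpace M] [BorelSpace M]
  {P : ∀ n : ℕ, ℝ≥0 → Kernel (Fin n → M) (Fin n → M)}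
  {Ω : Type v} [mΩ : MeasurableSpace Ω] {μ : Measure Ω} [IsProbabilityMeasure μ]

/-- Started on the diagonal, the two-point motion remains there almost surely. -/
theorem integral_eq_zero_of_diagonal (hP : IsConsistentCoalescing P)
    {f : ZeroAtInftyContinuousMap (Fin 2 → M) ℝ} (hf : ∀ z : Fin 2 → M, z 0 = z 1 → f z = 0)
    (h : ℝ≥0) {z : Fin 2 → M} (hz : z 0 = z 1) : ∫ y, f y ∂(P 2 h z) = 0 := by
  have := (hP.feller 2).markov h
  have hz' : z = ![z 0, z 0] := by
    ext i
    fin_cases i <;> simp [hz]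
  have h1 := hP.coalescing (z 0) h
  rw [← hz'] at h1
  have h2 : ∀ᵐ y ∂(P 2 h z), y 0 = y 1 := by
    rw [← mem_ae_iff_prob_eq_one₀] at h1
    · exact h1
    · exact (measurableSet_eq_fun (measurable_pi_apply 0) (measurable_pi_apply 1)).nullMeasurableSet
  refine integral_eq_zero_of_ae ?_
  filter_upwards [h2] with y hy using hf y hy

/-- The Feller semigroup of the two-point motion, applied to a function vanishing on the diagonal,
is small near the diagonal, uniformly on compact sets of times and points. -/
theorem exists_integral_le_of_near_diagonal (hP : IsConsistentCoalescing P)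
    {f : ZeroAtInftyContinuousMap (Fin 2 → M) ℝ} (hf : ∀ z : Fin 2 → M, z 0 = z 1 → f z = 0)
    {C : Set (Fin 2 → M)} (hC : IsCompact C) (T : ℝ≥0) {ε : ℝ} (hε : 0 < ε) :
    ∃ δ > 0, ∀ h ≤ T, ∀ z ∈ C, dist (z 0) (z 1) ≤ δ → ∫ y, f y ∂(P 2 h z) ≤ ε := by
  set g : ℝ≥0 × (Fin 2 → M) → ℝ := fun p => ∫ y, f y ∂(P 2 p.1 p.2) with hg
  have hgc : Continuous g := (hP.feller 2).continuous_integral f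
  -- On the compact set of times and points where the integral is at least `ε`, the distance of the
  -- components has a positive minimum; half of it serves as `δ`.
  set B : Set (ℝ≥0 × (Fin 2 → M)) := (Icc 0 T ×ˢ C) ∩ {p | ε ≤ g p} with hB
  have hBc : IsCompact B :=
    (isCompact_Icc.prod hC).inter_right (isClosed_le continuous_const hgc)
  have hd : Continuous fun p : ℝ≥0 × (Fin 2 → M) => dist (p.2 0) (p.2 1) := by fun_prop
  rcases B.eq_empty_or_nonempty with hBe | hBn
  · refine ⟨1, one_pos, fun h hh z hz _ => ?_⟩
    by_contra! hlt
    have : (h, z) ∈ B := ⟨⟨⟨bot_le, hh⟩, hz⟩, hlt.le⟩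
    rw [hBe] at this
    exact this
  · obtain ⟨p, hp, hmin⟩ := hBc.exists_isMinOn hBn hd.continuousOn
    have hpos : 0 < dist (p.2 0) (p.2 1) := by
      rw [dist_pos]
      intro heq
      have h1 : g p = 0 := integral_eq_zero_of_diagonal hP hf p.1 heq
      have h2 : ε ≤ g p := hp.2
      linarith
    refine ⟨dist (p.2 0) (p.2 1) / 2, by positivity, fun h hh z hz hzd => ?_⟩
    by_contra! hlt
    have : (h, z) ∈ B := ⟨⟨⟨bot_le, hh⟩, hz⟩, hlt.le⟩
    have := hmin this
    simp only [mem_ofPred_eq] at this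
    linarith

/-- The set of trajectories that, at rational times of `[u, T]`, come arbitrarily close to the
diagonal inside `C`. -/
def nearMeeting (Z : ℝ → Ω → Fin 2 → M) (u T : ℝ) (C : Set (Fin 2 → M)) : Set Ω :=
  ⋂ k : ℕ, ⋃ q ∈ {q : ℝ | q ∈ range ((↑) : ℚ → ℝ) ∧ u ≤ q ∧ q ≤ T},
    Z q ⁻¹' (C ∩ {z | dist (z 0) (z 1) ≤ 1 / ((k : ℝ) + 1)})

/-- By the first entrance estimate for a thin neighbourhood of the diagonal, the expectation of `f
(Z T)` on the event is at most every `ε > 0`. The event contains the meetings inside the interior of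
`C` before time `T`, without reference to a random meeting time. -/
theorem ae_eq_zero_of_mem_nearMeeting (hP : IsConsistentCoalescing P) {F : ℝ → MeasurableSpace Ω}
    {u T : ℝ} (huT : u ≤ T) {Z : ℝ → Ω → Fin 2 → M} (hZ : IsMarkovFrom μ F (P 2) u Z)
    {f : ZeroAtInftyContinuousMap (Fin 2 → M) ℝ} (hf : ∀ z : Fin 2 → M, z 0 = z 1 → f z = 0)
    (hf0 : ∀ z, 0 ≤ f z) {C : Set (Fin 2 → M)} (hC : IsCompact C) :
    ∀ᵐ ω ∂μ, ω ∈ nearMeeting Z u T C → f (Z T ω) = 0 := by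
  have hQ : {q : ℝ | q ∈ range ((↑) : ℚ → ℝ) ∧ u ≤ q ∧ q ≤ T}.Countable :=
    (countable_range _).mono fun q hq => hq.1
  have hdc : Continuous fun z : Fin 2 → M => dist (z 0) (z 1) := by fun_prop
  have hDm : ∀ k : ℕ, MeasurableSet (C ∩ {z : Fin 2 → M | dist (z 0) (z 1) ≤ 1 / ((k : ℝ) + 1)}) :=
    fun k => hC.measurableSet.inter (isClosed_le hdc continuous_const).measurableSet
  have hφ : Measurable fun z => ENNReal.ofReal (f z) := f.continuous.measurable.ennreal_ofReal
  have hHm : MeasurableSet (nearMeeting Z u T C) := by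
    refine MeasurableSet.iInter fun k => MeasurableSet.biUnion hQ fun q hq => ?_
    exact hZ.measurable hq.2.1 (hDm k)
  have hint : ∫⁻ ω in nearMeeting Z u T C, ENNReal.ofReal (f (Z T ω)) ∂μ = 0 := by
    refine le_antisymm (ENNReal.le_of_forall_pos_le_add fun ε hε _ => ?_) bot_le
    obtain ⟨δ, hδ, hδf⟩ := exists_integral_le_of_near_diagonal hP hf hC (T - u).toNNReal
      (ε := ε) (by exact_mod_cast hε)
    obtain ⟨k, hk⟩ := exists_nat_one_div_lt hδ
    have := hZ.setLIntegral_biUnion_le (hDm k) hφ (c := ε) hQ (fun q hq => hq.2) (by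
      intro q hq z hz
      have := (hP.feller 2).markov (T - q).toNNReal
      rw [← ofReal_integral_eq_lintegral_ofReal (zeroAtInfty_integrable f _)
        (Eventually.of_forall hf0), ← ENNReal.ofReal_coe_nnreal]
      refine ENNReal.ofReal_le_ofReal (hδf _ ?_ z hz.1 (le_trans hz.2 hk.le))
      exact Real.toNNReal_le_toNNReal (by linarith [hq.2.1]))
    calc _ ≤ _ := lintegral_mono_set (iInter_subset _ k)
      _ ≤ _ := this
      _ ≤ 0 + ε := by
        rw [zero_add]
        calc _ ≤ (ε : ℝ≥0∞) * 1 := by gcongr; exact prob_le_one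
          _ = ε := mul_one _
  have hφZ : Measurable fun ω => ENNReal.ofReal (f (Z T ω)) := hφ.comp (hZ.measurable huT)
  rw [setLIntegral_eq_zero_iff' hHm hφZ.aemeasurable] at hint
  filter_upwards [hint] with ω hω hmem
  have := ENNReal.ofReal_eq_zero.1 (hω hmem)
  exact le_antisymm this (hf0 _)

/-- The distance of the components is cut off by a compactly supported function equal to `1` on `C`.
-/
theorem exists_zeroAtInfty_vanishing_on_diagonal {C : Set (Fin 2 → M)} (hC : IsCompact C) :
    ∃ f : ZeroAtInftyContinuousMap (Fin 2 → M) ℝ, (∀ z : Fin 2 → M, z 0 = z 1 → f z = 0) ∧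
      (∀ z, 0 ≤ f z) ∧ ∀ z ∈ C, f z = 0 → z 0 = z 1 := by
  obtain ⟨g, hg1, -, hgc, hg01⟩ := exists_continuous_one_zero_of_isCompact hC isClosed_empty
    (disjoint_empty C)
  have hcs : HasCompactSupport fun z : Fin 2 → M => g z * dist (z 0) (z 1) := hgc.mul_right
  refine ⟨⟨⟨fun z => g z * dist (z 0) (z 1), by fun_prop⟩, hcs.is_zero_at_infty⟩, ?_, ?_, ?_⟩
  · intro z hz
    simp [hz]
  · intro z
    exact mul_nonneg (hg01 z).1 dist_nonneg
  · intro z hz h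
    have h' : g z * dist (z 0) (z 1) = 0 := h
    rw [hg1 hz] at h'
    simpa using h'

/-- Once the two components of the two-point motion have met, they stay together. -/
theorem ae_eq_of_meeting (hP : IsConsistentCoalescing P) {F : ℝ → MeasurableSpace Ω}
    {u T : ℝ} (huT : u ≤ T) {Z : ℝ → Ω → Fin 2 → M} (hZ : IsMarkovFrom μ F (P 2) u Z)
    (hZc : ∀ ω, Continuous fun t => Z t ω) :
    ∀ᵐ ω ∂μ, ∀ t, u ≤ t → t < T → Z t ω 0 = Z t ω 1 → Z T ω 0 = Z T ω 1 := by
  let K : CompactExhaustion (Fin 2 → M) := default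
  choose f hf hf0 hfK using fun N => exists_zeroAtInfty_vanishing_on_diagonal (K.isCompact N)
  have key : ∀ᵐ ω ∂μ, ∀ N N', ω ∈ nearMeeting Z u T (K N) → f N' (Z T ω) = 0 :=
    ae_all_iff.2 fun N => ae_all_iff.2 fun N' =>
      ae_eq_zero_of_mem_nearMeeting hP huT hZ (hf N') (hf0 N') (K.isCompact N)
  filter_upwards [key] with ω hω t hut htT heq
  obtain ⟨N, hN⟩ := K.exists_mem_nhds (Z t ω)
  obtain ⟨N', hN'⟩ := K.exists_mem (Z T ω)
  refine hfK N' _ hN' (hω N N' (mem_iInter.2 fun k => ?_))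
  have hc : ContinuousAt (fun r => Z r ω) t := (hZc ω).continuousAt
  have hd : Continuous fun r => dist (Z r ω 0) (Z r ω 1) := by
    have := hZc ω
    have h0 := (continuous_apply (0 : Fin 2)).comp this
    have h1 := (continuous_apply (1 : Fin 2)).comp this
    exact h0.dist h1
  have h1 : ∀ᶠ r in 𝓝 t, Z r ω ∈ K N := hc hN
  have h2 : ∀ᶠ r in 𝓝 t, dist (Z r ω 0) (Z r ω 1) < 1 / ((k : ℝ) + 1) := by
    refine hd.continuousAt.eventually (gt_mem_nhds ?_)
    simp only [heq, dist_self]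
    positivity
  obtain ⟨ε, hε, hball⟩ := Metric.eventually_nhds_iff.1 (h1.and h2)
  -- By continuity, rational times shortly after a meeting still have the pair in `K N` and nearly
  -- on the diagonal.
  obtain ⟨q, hq1, hq2⟩ := exists_rat_btwn (show t < min T (t + ε) from lt_min htT (by linarith))
  have := hball (y := (q : ℝ)) (by
    rw [Real.dist_eq, abs_lt]
    constructor <;> linarith [hq2.trans_le (min_le_right _ _)])
  exact mem_biUnion (x := (q : ℝ)) ⟨mem_range_self q, by linarith,
    (hq2.trans_le (min_le_left _ _)).le⟩ ⟨this.1, this.2.le⟩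

variable {ψ : ℝ → ℝ → Ω → MeasurableMap M} {s : ℕ → ℝ} {x : ℕ → M} {Φ : ℕ → Ω → PathSpace M}

/-- Almost surely, any two of the paths coincide after they have met. -/
theorem ae_coalescence (hP : IsConsistentCoalescing P) (hψ : IsStochasticFlow μ P ψ)
    (hΦ : ∀ n, IsContinuousModification μ ψ (s n) (x n) (Φ n)) :
    ∀ᵐ ω ∂μ, ∀ (t : ℝ) (m n : ℕ), s m ≤ t → s n ≤ t → (Φ m ω).ext t = (Φ n ω).ext t →
      ∀ t', t ≤ t' → (Φ m ω).ext t' = (Φ n ω).ext t' := by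
  have key : ∀ᵐ ω ∂μ, ∀ (m n : ℕ) (q : ℚ), max (s m) (s n) ≤ q → ∀ t, max (s m) (s n) ≤ t →
      t < q → (Φ m ω).ext t = (Φ n ω).ext t → (Φ m ω).ext q = (Φ n ω).ext q := by
    refine ae_all_iff.2 fun m => ae_all_iff.2 fun n => ae_all_iff.2 fun q => ?_
    by_cases hq : max (s m) (s n) ≤ q
    · have hZ := isMarkovFrom_paths hP hψ hΦ ![m, n] (u := max (s m) (s n)) (by
        intro j
        fin_cases j <;> simp)
      filter_upwards [ae_eq_of_meeting hP hq hZ (fun ω => continuous_pi fun j =>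
        (Φ (![m, n] j) ω).ext.continuous)] with ω hω _ t ht htq heq
      exact hω t ht htq heq
    · exact Eventually.of_forall fun ω h => absurd h hq
  filter_upwards [key] with ω hω t m n hm hn heq t' htt'
  rcases htt'.eq_or_lt with rfl | hlt
  · exact heq
  -- The target time was restricted to countably many values; equality at rational times just after
  -- `t'` passes to `t'` by continuity.
  have hcl : IsClosed {r : ℝ | (Φ m ω).ext r = (Φ n ω).ext r} :=
    isClosed_eq (Φ m ω).ext.continuous (Φ n ω).ext.continuous
  refine hcl.closure_subset (mem_closure_iff_nhds.2 fun U hU => ?_)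
  obtain ⟨ε, hε, hball⟩ := Metric.mem_nhds_iff.1 hU
  obtain ⟨q, hq1, hq2⟩ := exists_rat_btwn (show t' < t' + ε by linarith)
  refine ⟨q, hball ?_, hω m n q (max_le ?_ ?_) t (max_le hm hn) ?_ heq⟩
  · rw [Metric.mem_ball, Real.dist_eq, abs_lt]
    constructor <;> linarith
  all_goals linarith

end Coalescence


/-! ### Exit estimates and existence of barriers. -/

section Barrier

variable {M : Type u} [MetricSpace M] [LocallyCompactSpace M] [SecondCountableTopology M]
  [MeasurableSpace M] [BorelSpace M]
  {P : ∀ n : ℕ, ℝ≥0 → Kernel (Fin n → M) (Fin n → M)}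
  {Ω : Type v} [mΩ : MeasurableSpace Ω] {μ : Measure Ω} [IsProbabilityMeasure μ]

/-- Small jumps, in the form in which they are used: for short times, displacements by more than
`r` have probability at most `ε t`, uniformly on compact sets. -/
theorem HasSmallJumps.exists_le {P₁ : ℝ≥0 → Kernel (Fin 1 → M) (Fin 1 → M)}
    (h : HasSmallJumps P₁) (h0 : P₁ 0 = Kernel.id) {K : Set M} (hK : IsCompact K) {r : ℝ}
    (hr : 0 < r) {ε : ℝ} (hε : 0 < ε) :
    ∃ h₀ > 0, ∀ t : ℝ≥0, (t : ℝ) < h₀ → ∀ z : Fin 1 → M, z 0 ∈ K →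
      P₁ t z {y | r < dist (z 0) (y 0)} ≤ ENNReal.ofReal (ε * t) := by
  have h1 := h K r hK hr
  have h2 : ∀ᶠ t : ℝ≥0 in 𝓝[>] 0,
      (t : ℝ≥0∞)⁻¹ * ⨆ x ∈ K, P₁ t (fun _ => x) {y | r < dist x (y 0)} < ENNReal.ofReal ε :=
    h1.eventually (gt_mem_nhds (by simpa using hε))
  rw [eventually_nhdsWithin_iff, Metric.eventually_nhds_iff] at h2
  obtain ⟨h₀, hh₀, hball⟩ := h2
  refine ⟨h₀, hh₀, fun t ht z hz => ?_⟩
  have hz' : z = fun _ => z 0 := by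
    ext i
    rw [Subsingleton.elim i 0]
  have hmeas : MeasurableSet {y : Fin 1 → M | r < dist (z 0) (y 0)} :=
    (isOpen_lt continuous_const (by fun_prop)).measurableSet
  rcases eq_or_ne t 0 with rfl | ht0
  · rw [h0, Kernel.id_apply, Measure.dirac_apply' _ hmeas]
    simp [hr.le]
  · have hlt := hball (y := t) (by simpa [NNReal.dist_eq] using ht) (pos_iff_ne_zero.2 ht0)
    have hle : P₁ t z {y | r < dist (z 0) (y 0)}
        ≤ ⨆ x ∈ K, P₁ t (fun _ => x) {y | r < dist x (y 0)} := by
      conv_lhs => rw [hz']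
      exact le_iSup₂ (f := fun x (_ : x ∈ K) => P₁ t (fun _ => x) {y | r < dist x (y 0)}) (z 0) hz
    have ht0' : (t : ℝ≥0∞) ≠ 0 := by simpa using ht0
    calc P₁ t z {y | r < dist (z 0) (y 0)}
        ≤ ⨆ x ∈ K, P₁ t (fun _ => x) {y | r < dist x (y 0)} := hle
      _ = t * ((t : ℝ≥0∞)⁻¹ * ⨆ x ∈ K, P₁ t (fun _ => x) {y | r < dist x (y 0)}) := by
          rw [← mul_assoc, ENNReal.mul_inv_cancel ht0' ENNReal.coe_ne_top, one_mul]
      _ ≤ t * ENNReal.ofReal ε := by gcongr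
      _ = ENNReal.ofReal (ε * t) := by
          rw [ENNReal.ofReal_mul hε.le, ENNReal.ofReal_coe_nnreal, mul_comm]

variable {ψ : ℝ → ℝ → Ω → MeasurableMap M} {s : ℕ → ℝ} {x : ℕ → M} {Φ : ℕ → Ω → PathSpace M}

theorem map_ext_eq (hP : IsConsistentCoalescing P) (hψ : IsStochasticFlow μ P ψ)
    (hΦ : ∀ n, IsContinuousModification μ ψ (s n) (x n) (Φ n)) (n : ℕ) {t : ℝ} (ht : s n ≤ t) :
    μ.map (fun ω (_ : Fin 1) => (Φ n ω).ext t) = P 1 (t - s n).toNNReal fun _ => x n := by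
  rw [← hψ.map_eq hP ht]
  refine Measure.map_congr ?_
  filter_upwards [(hΦ n).modification t ht] with ω hω
  funext _
  exact hω

/-- Maximal inequality: a path started near the centre of a compact ball rarely leaves the ball
within a short time. -/
theorem exists_measure_exit_le (hP : IsConsistentCoalescing P) (hcont : HasSmallJumps (P 1))
    (hψ : IsStochasticFlow μ P ψ)
    (hΦ : ∀ n, IsContinuousModification μ ψ (s n) (x n) (Φ n)) {b : M} {a : ℝ} (ha : 0 < a)
    (hK : IsCompact (Metric.closedBall b (4 * a))) {ε : ℝ} (hε : 0 < ε) :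
    ∃ h₀ > 0, ∀ h : ℝ, 0 < h → h < h₀ → ∀ n, dist b (x n) < a →
      μ {ω | ∃ t ∈ Icc (s n) (s n + h), 4 * a ≤ dist b ((Φ n ω).ext t)}
        ≤ ENNReal.ofReal (2 * ε * h) := by
  obtain ⟨h₁, hh₁, hjump⟩ := hcont.exists_le (hP.feller 1).zero hK (half_pos ha) hε
  refine ⟨min h₁ (1 / (2 * ε)), lt_min hh₁ (by positivity), fun h hh0 hh n hn => ?_⟩
  have hhh₁ : h < h₁ := hh.trans_le (min_le_left _ _)
  have hεh : ε * h ≤ 1 / 2 := by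
    have := (hh.trans_le (min_le_right _ _)).le
    rw [le_div_iff₀ (by positivity)] at this
    linarith
  set Z : ℝ → Ω → Fin 1 → M := fun t ω j => (Φ ((fun _ => n) j) ω).ext t with hZdef
  have hZ : IsMarkovFrom μ (pathFiltration Φ) (P 1) (s n) Z :=
    isMarkovFrom_paths hP hψ hΦ (fun _ => n) (fun _ => le_rfl)
  set T := s n + h with hT
  -- To get from radius at most `a` out to `4 * a`, the path passes through this shell. From the
  -- shell into `B`, or from the start to outside `B`, the displacement exceeds `a / 2`; both are
  -- rare within time `h`.
  set D : Set (Fin 1 → M) := {z | 3 * a ≤ dist b (z 0) ∧ dist b (z 0) ≤ 4 * a} with hD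
  have hdc : Continuous fun z : Fin 1 → M => dist b (z 0) := by fun_prop
  have hDm : MeasurableSet D :=
    ((isClosed_le continuous_const hdc).inter (isClosed_le hdc continuous_const)).measurableSet
  set B : Set (Fin 1 → M) := {y | dist b (y 0) ≤ 2 * a} with hB
  have hBm : MeasurableSet B := (isClosed_le hdc continuous_const).measurableSet
  set Q : Set ℝ := {q : ℝ | q ∈ range ((↑) : ℚ → ℝ) ∧ s n ≤ q ∧ q ≤ T} with hQdef
  have hQ : Q.Countable := (countable_range _).mono fun q hq => hq.1
  set H : Set Ω := ⋃ q ∈ Q, Z q ⁻¹' D with hH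
  have hHm : MeasurableSet H := MeasurableSet.biUnion hQ fun q hq => hZ.measurable hq.2.1 hDm
  have hZT : Measurable (Z T) := hZ.measurable (by simp [hT, hh0.le])
  have hsub : {ω | ∃ t ∈ Icc (s n) (s n + h), 4 * a ≤ dist b ((Φ n ω).ext t)} ⊆ H := by
    rintro ω ⟨t, ⟨ht1, ht2⟩, ht⟩
    have hc : Continuous fun r => dist b ((Φ n ω).ext r) :=
      continuous_const.dist (Φ n ω).ext.continuous
    have hstart : dist b ((Φ n ω).ext (s n)) < a := by
      rwa [(hΦ n).start_value]
    -- The radius `7 / 2 * a` is interior to the shell, so a rational time near `r` also sees the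
    -- path in `D`.
    obtain ⟨r, hr, hr'⟩ := intermediate_value_Ioo ht1 hc.continuousOn
      (show 7 / 2 * a ∈ Ioo (dist b ((Φ n ω).ext (s n))) (dist b ((Φ n ω).ext t)) from
        ⟨by linarith, by linarith⟩)
    have hev : ∀ᶠ r' in 𝓝 r, dist b ((Φ n ω).ext r') ∈ Ioo (3 * a) (4 * a) := by
      refine hc.continuousAt.eventually (Ioo_mem_nhds ?_ ?_) <;> simp only [hr'] <;> linarith
    obtain ⟨c, hc, hcI⟩ := exists_Ico_subset_of_mem_nhds (hev.and (Ioo_mem_nhds hr.1 hr.2))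
      ⟨r + 1, by linarith⟩
    obtain ⟨q, hq1, hq2⟩ := exists_rat_btwn hc
    have hq := hcI ⟨hq1.le, hq2⟩
    exact mem_biUnion (x := (q : ℝ)) ⟨mem_range_self q, hq.2.1.le, hq.2.2.le.trans ht2⟩
      ⟨hq.1.1.le, hq.1.2.le⟩
  refine (measure_mono hsub).trans ?_
  have h1 := hZ.setLIntegral_biUnion_le hDm (φ := B.indicator 1) (measurable_one.indicator hBm)
    (c := 1 / 2) (T := T) hQ (fun q hq => hq.2) (by
      intro q hq z hz
      rw [lintegral_indicator_one hBm]
      have hle : P 1 (T - q).toNNReal z B ≤ P 1 (T - q).toNNReal z {y | a / 2 < dist (z 0) (y 0)} := by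
        refine measure_mono fun y hy => ?_
        have := dist_triangle_right b (z 0) (y 0)
        have h2 : dist b (y 0) ≤ 2 * a := hy
        have h3 := hz.1
        have h4 := dist_triangle b (y 0) (z 0)
        rw [dist_comm (y 0)] at h4
        change a / 2 < dist (z 0) (y 0)
        linarith
      have hTq : ((T - q).toNNReal : ℝ) ≤ h := by
        rw [Real.coe_toNNReal _ (by linarith [hq.2.2])]
        linarith [hq.2.1]
      refine hle.trans ((hjump _ (hTq.trans_lt hhh₁) z ?_).trans ?_)
      · rw [Metric.mem_closedBall, dist_comm]
        exact hz.2
      · calc ENNReal.ofReal (ε * ((T - q).toNNReal : ℝ)) ≤ ENNReal.ofReal (1 / 2) :=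
              ENNReal.ofReal_le_ofReal (le_trans (by gcongr) hεh)
          _ = 1 / 2 := by rw [ENNReal.ofReal_div_of_pos two_pos]; simp)
  have h2 : ∫⁻ ω in H, B.indicator 1 (Z T ω) ∂μ = μ (H ∩ Z T ⁻¹' B) := by
    have : (fun ω => B.indicator (1 : (Fin 1 → M) → ℝ≥0∞) (Z T ω))
        = (Z T ⁻¹' B).indicator 1 := by
      ext ω
      simp [indicator, mem_preimage]
    rw [this, lintegral_indicator_one (hZT hBm), Measure.restrict_apply (hZT hBm), inter_comm]
  rw [h2] at h1
  have h3 : μ (Z T ⁻¹' Bᶜ) ≤ ENNReal.ofReal (ε * h) := by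
    have hmap := map_ext_eq hP hψ hΦ n (t := T) (by simp [hT, hh0.le])
    rw [← Measure.map_apply hZT hBm.compl]
    change μ.map (fun ω (_ : Fin 1) => (Φ n ω).ext T) Bᶜ ≤ _
    have hTs : (T - s n).toNNReal = h.toNNReal := by simp [hT]
    rw [hmap, hTs]
    have hx : x n ∈ Metric.closedBall b (4 * a) := by
      rw [Metric.mem_closedBall, dist_comm]
      linarith
    have := hjump h.toNNReal (by rwa [Real.coe_toNNReal _ hh0.le]) (fun _ => x n) hx
    rw [Real.coe_toNNReal _ hh0.le] at this
    refine (measure_mono fun y hy => ?_).trans this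
    have h2 : ¬ dist b (y 0) ≤ 2 * a := hy
    have h4 := dist_triangle b (x n) (y 0)
    change a / 2 < dist (x n) (y 0)
    linarith
  -- Given a visit to `D`, the path ends in `B` with probability at most `1 / 2`; ending outside `B`
  -- has probability at most `ε * h`. Absorbing the first term produces the factor `2`.
  have h4 : μ H ≤ 1 / 2 * μ H + ENNReal.ofReal (ε * h) := by
    calc μ H ≤ μ (H ∩ Z T ⁻¹' B) + μ (H \ Z T ⁻¹' B) := measure_le_inter_add_sdiff _ _ _
      _ ≤ 1 / 2 * μ H + ENNReal.ofReal (ε * h) :=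
        add_le_add h1 ((measure_mono fun ω hω => hω.2).trans h3)
  have h5 : μ.real H ≤ 1 / 2 * μ.real H + ε * h := by
    have hf1 : 1 / 2 * μ H ≠ ∞ := ENNReal.mul_ne_top (by simp) (measure_ne_top _ _)
    have := ENNReal.toReal_mono (ENNReal.add_ne_top.2 ⟨hf1, ENNReal.ofReal_ne_top⟩) h4
    rw [ENNReal.toReal_add hf1 ENNReal.ofReal_ne_top, ENNReal.toReal_mul,
      ENNReal.toReal_ofReal (by positivity)] at this
    simpa [Measure.real] using this
  rw [← ofReal_measureReal (measure_ne_top _ _)]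
  exact ENNReal.ofReal_le_ofReal (by linarith)

/-- Near every point `b` there are at all times paths of the family that stay close to `b` for a
time bounded below. -/
theorem ae_exists_barrier (hP : IsConsistentCoalescing P) (hcont : HasSmallJumps (P 1))
    (hψ : IsStochasticFlow μ P ψ) (hD : DenseRange fun n => (s n, x n))
    (hΦ : ∀ n, IsContinuousModification μ ψ (s n) (x n) (Φ n)) {b : M} {U : Set M} (hU : U ∈ 𝓝 b)
    {T : ℝ} (hT : 0 < T) :
    ∀ᵐ ω ∂μ, ∃ δ > 0, ∀ t ∈ Icc (-T) T, ∃ n, s n ≤ t ∧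
      ∀ t' ∈ Icc t (t + δ), (Φ n ω).ext t' ∈ U := by
  obtain ⟨K, hK, hKU, hKc⟩ := local_compact_nhds hU
  obtain ⟨r, hr, hrK⟩ := Metric.nhds_basis_closedBall.mem_iff.1 hK
  set a := r / 4 with ha
  have har : 4 * a = r := by rw [ha]; ring
  have ha0 : 0 < a := by positivity
  have hKa : IsCompact (Metric.closedBall b (4 * a)) := by
    rw [har]
    exact hKc.of_isClosed_subset Metric.isClosed_closedBall hrK
  rw [ae_iff]
  refine le_antisymm (ENNReal.le_of_forall_pos_le_add fun ε' hε' _ => ?_) bot_le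
  -- At most `2 * T / δ + 2` grid paths, each failing with probability at most `2 * ε * (3 * δ)`,
  -- fail in total with probability at most `12 * ε * (T + δ)`, where `δ ≤ 1`.
  set ε : ℝ := ε' / (12 * (T + 1)) with hεdef
  have hε' : (0 : ℝ) < ε' := hε'
  have hε : 0 < ε := by positivity
  obtain ⟨h₀, hh₀, hexit⟩ := exists_measure_exit_le hP hcont hψ hΦ ha0 hKa hε
  set δ : ℝ := min (h₀ / 4) 1 with hδdef
  have hδ : 0 < δ := lt_min (by positivity) one_pos
  have hδ1 : δ ≤ 1 := min_le_right _ _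
  have hδh : 3 * δ < h₀ := by
    have : δ ≤ h₀ / 4 := min_le_left _ _
    linarith
  -- The `k`-th path starts in `(kδ - δ, kδ)` and serves `t ∈ [kδ, kδ + δ)`. A lifetime of `3 * δ`
  -- covers `[t, t + δ]` for all such `t`.
  have hn : ∀ k : ℤ, ∃ n, s n ∈ Ioo (k * δ - δ) (k * δ) ∧ dist b (x n) < a := by
    intro k
    obtain ⟨n, hn⟩ := hD.exists_mem_open (isOpen_Ioo.prod Metric.isOpen_ball :
      IsOpen (Ioo (k * δ - δ) (k * δ) ×ˢ Metric.ball b a))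
      ⟨(k * δ - δ / 2, b), ⟨by constructor <;> linarith, Metric.mem_ball_self ha0⟩⟩
    exact ⟨n, hn.1, by rw [dist_comm]; exact hn.2⟩
  choose N hNs hNx using hn
  set I : Finset ℤ := Finset.Icc ⌊-T / δ⌋ ⌊T / δ⌋ with hI
  set fail : ℤ → Set Ω := fun k =>
    {ω | ∃ t ∈ Icc (s (N k)) (s (N k) + 3 * δ), 4 * a ≤ dist b ((Φ (N k) ω).ext t)} with hfail
  have hsub : {ω | ¬ ∃ δ > 0, ∀ t ∈ Icc (-T) T, ∃ n, s n ≤ t ∧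
      ∀ t' ∈ Icc t (t + δ), (Φ n ω).ext t' ∈ U} ⊆ ⋃ k ∈ I, fail k := by
    intro ω hω
    by_contra hcon
    simp only [mem_iUnion, not_exists] at hcon
    refine hω ⟨δ, hδ, fun t ht => ?_⟩
    have hk : ⌊t / δ⌋ ∈ I := by
      rw [hI, Finset.mem_Icc]
      exact ⟨Int.floor_le_floor (by gcongr; exact ht.1), Int.floor_le_floor (by gcongr; exact ht.2)⟩
    have h1 : (⌊t / δ⌋ : ℝ) * δ ≤ t := by
      rw [← le_div_iff₀ hδ]; exact Int.floor_le _
    have h2 : t < (⌊t / δ⌋ : ℝ) * δ + δ := by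
      have := Int.lt_floor_add_one (t / δ)
      rw [div_lt_iff₀ hδ] at this
      linarith
    have hs := hNs ⌊t / δ⌋
    refine ⟨N ⌊t / δ⌋, by linarith [hs.2], fun t' ht' => hKU (hrK ?_)⟩
    by_contra hout
    refine hcon _ hk ⟨t', ⟨by linarith [hs.2, ht'.1], by linarith [hs.1, ht'.2]⟩, ?_⟩
    rw [Metric.mem_closedBall, dist_comm] at hout
    rw [har]
    exact (not_le.1 hout).le
  have hcard : (I.card : ℝ) ≤ 2 * T / δ + 2 := by
    have h1 : ⌊-T / δ⌋ ≤ ⌊T / δ⌋ + 1 := by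
      have : ⌊-T / δ⌋ ≤ ⌊T / δ⌋ := Int.floor_le_floor (by gcongr; linarith)
      omega
    have h2 : (I.card : ℤ) = ⌊T / δ⌋ + 1 - ⌊-T / δ⌋ := by
      rw [hI, Int.card_Icc, Int.toNat_of_nonneg (by omega)]
    have h3 : (I.card : ℝ) = (⌊T / δ⌋ : ℝ) + 1 - (⌊-T / δ⌋ : ℝ) := by exact_mod_cast h2
    have h4 := Int.floor_le (T / δ)
    have h5 := (Int.sub_one_lt_floor (-T / δ)).le
    have h6 : -T / δ = -(T / δ) := by ring
    have h7 : 2 * T / δ = 2 * (T / δ) := by ring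
    rw [h3, h7]
    rw [h6] at h5
    rw [h6]
    linarith
  calc _ ≤ μ (⋃ k ∈ I, fail k) := measure_mono hsub
    _ ≤ ∑ k ∈ I, μ (fail k) := measure_biUnion_finset_le _ _
    _ ≤ ∑ k ∈ I, ENNReal.ofReal (2 * ε * (3 * δ)) :=
      Finset.sum_le_sum fun k _ => hexit (3 * δ) (by positivity) hδh _ (hNx k)
    _ = ENNReal.ofReal (I.card * (2 * ε * (3 * δ))) := by
      rw [Finset.sum_const, nsmul_eq_mul, ENNReal.ofReal_mul (p := (I.card : ℝ)) (by positivity),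
        ENNReal.ofReal_natCast]
    _ ≤ ENNReal.ofReal ε' := by
      refine ENNReal.ofReal_le_ofReal ?_
      calc (I.card : ℝ) * (2 * ε * (3 * δ)) ≤ (2 * T / δ + 2) * (2 * ε * (3 * δ)) := by gcongr
        _ = 12 * ε * (T + δ) := by field_simp; ring
        _ ≤ 12 * ε * (T + 1) := by gcongr
        _ = ε' := by rw [hεdef]; field_simp
    _ = 0 + ε' := by rw [zero_add, ENNReal.ofReal_coe_nnreal]

end Barrier


/-! ### Stars: crossings, connectedness and cells. -/

section Star

variable {M : Type u} [MetricSpace M]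

/-- A star with centre `c` and radius `η`: disjoint open legs that cover the punctured ball, on
each of which the distance to `c` is an isometric coordinate. -/
structure IsStar (c : M) (η : ℝ) {ι : Type u} (A : ι → Set M) : Prop where
  pos : 0 < η
  isOpen : ∀ i, IsOpen (A i)
  disjoint : ∀ i j, i ≠ j → Disjoint (A i) (A j)
  cover : Metric.ball c η \ {c} ⊆ ⋃ i, A i
  dist_eq : ∀ i, ∀ y ∈ A i, ∀ y' ∈ A i, dist y y' = |dist c y - dist c y'|
  exists_dist : ∀ i r, 0 < r → r < η → ∃ y ∈ A i, dist c y = r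
  compact : IsCompact (Metric.closedBall c η)

/-- A continuous function that rises from `r₁` to `r₂` has a last passage through `r₁` followed by
a first passage through `r₂`. -/
theorem exists_crossing_interval {h : ℝ → ℝ} (hh : Continuous h) {t₁ t₂ r₁ r₂ : ℝ} (hr : r₁ < r₂)
    (ht : t₁ ≤ t₂) (h₁ : h t₁ ≤ r₁) (h₂ : r₂ ≤ h t₂) :
    ∃ c₁ c₂, t₁ ≤ c₁ ∧ c₁ < c₂ ∧ c₂ ≤ t₂ ∧ h c₁ ≤ r₁ ∧ r₂ ≤ h c₂ ∧
      ∀ t ∈ Ioo c₁ c₂, r₁ < h t ∧ h t < r₂ := by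
  obtain ⟨c₁, ⟨hc₁I, hc₁⟩, hmax⟩ := (isCompact_Icc.inter_right
    (isClosed_le hh continuous_const) : IsCompact (Icc t₁ t₂ ∩ {t | h t ≤ r₁})).exists_isGreatest
    ⟨t₁, ⟨le_rfl, ht⟩, h₁⟩
  obtain ⟨c₂, ⟨hc₂I, hc₂⟩, hmin⟩ := (isCompact_Icc.inter_right
    (isClosed_le continuous_const hh) : IsCompact (Icc c₁ t₂ ∩ {t | r₂ ≤ h t})).exists_isLeast
    ⟨t₂, ⟨hc₁I.2, le_rfl⟩, h₂⟩
  have hc₁' : h c₁ ≤ r₁ := hc₁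
  have hc₂' : r₂ ≤ h c₂ := hc₂
  have hlt : c₁ < c₂ := by
    refine lt_of_le_of_ne hc₂I.1 ?_
    rintro rfl
    linarith
  refine ⟨c₁, c₂, hc₁I.1, hlt, hc₂I.2, hc₁', hc₂', fun t htI => ⟨?_, ?_⟩⟩
  · by_contra! hle
    have := hmax ⟨⟨hc₁I.1.trans htI.1.le, htI.2.le.trans hc₂I.2⟩, hle⟩
    exact absurd htI.1 (not_lt.2 this)
  · by_contra! hle
    have := hmin ⟨⟨htI.1.le, htI.2.le.trans hc₂I.2⟩, hle⟩
    exact absurd htI.2 (not_lt.2 this)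

namespace IsStar

variable {c : M} {η : ℝ} {ι : Type u} {A : ι → Set M}

theorem eq_of_dist_eq (hA : IsStar c η A) {i : ι} {y y' : M} (hy : y ∈ A i) (hy' : y' ∈ A i)
    (h : dist c y = dist c y') : y = y' := by
  rw [← dist_eq_zero, hA.dist_eq i y hy y' hy', h, sub_self, abs_zero]

/-- The image of the interval is connected and the legs are disjoint and open. -/
theorem exists_leg (hA : IsStar c η A) {f : ℝ → M} (hf : Continuous f) {c₁ c₂ : ℝ} (hc : c₁ < c₂)
    (h : ∀ t ∈ Ioo c₁ c₂, 0 < dist c (f t) ∧ dist c (f t) < η) :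
    ∃ i, ∀ t ∈ Ioo c₁ c₂, f t ∈ A i := by
  have hcov : ∀ t ∈ Ioo c₁ c₂, ∃ i, f t ∈ A i := fun t ht => mem_iUnion.1 <| hA.cover
    ⟨by rw [Metric.mem_ball, dist_comm]; exact (h t ht).2, fun heq => by
      have := (h t ht).1
      rw [mem_singleton_iff.1 heq, dist_self] at this
      exact lt_irrefl _ this⟩
  obtain ⟨t₀, ht₀⟩ := nonempty_Ioo.2 hc
  obtain ⟨i, hi⟩ := hcov t₀ ht₀
  have hpre : IsPreconnected (f '' Ioo c₁ c₂) := isPreconnected_Ioo.image f hf.continuousOn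
  have hsub := hpre.subset_left_of_subset_union (hA.isOpen i)
    (isOpen_iUnion fun j => isOpen_iUnion fun _ : j ≠ i => hA.isOpen j)
    (by
      simp only [disjoint_iUnion_right]
      exact fun j hj => hA.disjoint i j hj.symm)
    (by
      rintro _ ⟨t, ht, rfl⟩
      obtain ⟨j, hj⟩ := hcov t ht
      by_cases hji : j = i
      · exact Or.inl (hji ▸ hj)
      · exact Or.inr (mem_iUnion₂.2 ⟨j, hji, hj⟩))
    ⟨f t₀, mem_image_of_mem f ht₀, hi⟩
  exact ⟨i, fun t ht => hsub (mem_image_of_mem f ht)⟩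

variable {f : ℝ → M} {r₁ r₂ a b : ℝ}

/-- A path cannot cross the spherical shell `r₁ ≤ d(c, ·) ≤ r₂`, in either direction, if each leg
contains a path that stays inside the shell and coalesces with it. -/
theorem not_cross (hA : IsStar c η A) (hf : Continuous f) (hr₁ : 0 < r₁) (hr : r₁ < r₂)
    (hr₂ : r₂ < η)
    (hbar : ∀ i, ∃ g : ℝ → M, Continuous g ∧
      (∀ t ∈ Icc a b, g t ∈ A i ∧ r₁ < dist c (g t) ∧ dist c (g t) < r₂) ∧
      ∀ t ∈ Icc a b, f t = g t → ∀ t' ∈ Icc t b, f t' = g t')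
    {t₁ t₂ : ℝ} (ha : a ≤ t₁) (ht : t₁ ≤ t₂) (hb : t₂ ≤ b) :
    (dist c (f t₁) ≤ r₁ → dist c (f t₂) < r₂) ∧ (r₂ ≤ dist c (f t₁) → r₁ < dist c (f t₂)) := by
  have hh : Continuous fun t => dist c (f t) := continuous_const.dist hf
  have meet : ∀ c₁ c₂, t₁ ≤ c₁ → c₁ < c₂ → c₂ ≤ t₂ →
      (∀ t ∈ Ioo c₁ c₂, r₁ < dist c (f t) ∧ dist c (f t) < r₂) →
      (dist c (f c₁) ≤ r₁ ∧ r₂ ≤ dist c (f c₂) ∨ r₂ ≤ dist c (f c₁) ∧ dist c (f c₂) ≤ r₁) →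
      False := by
    intro c₁ c₂ h1 h12 h2 hI hends
    obtain ⟨i, hi⟩ := hA.exists_leg hf h12 fun t ht =>
      ⟨hr₁.trans (hI t ht).1, (hI t ht).2.trans hr₂⟩
    obtain ⟨g, hg, hgI, hco⟩ := hbar i
    have hk : Continuous fun t => dist c (f t) - dist c (g t) := hh.sub (continuous_const.dist hg)
    have hg1 := hgI c₁ ⟨ha.trans h1, (h12.le.trans h2).trans hb⟩
    have hg2 := hgI c₂ ⟨(ha.trans h1).trans h12.le, h2.trans hb⟩
    -- The barrier stays strictly inside the shell while `f` passes from one boundary to the other,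
    -- so their radii agree at some time. Within one leg equal radii mean equal points.
    obtain ⟨t, ht, hzero⟩ : ∃ t ∈ Ioo c₁ c₂, dist c (f t) - dist c (g t) = 0 := by
      rcases hends with ⟨e1, e2⟩ | ⟨e1, e2⟩
      · exact intermediate_value_Ioo h12.le hk.continuousOn
          ⟨by linarith [hg1.2.1], by linarith [hg2.2.2]⟩
      · exact intermediate_value_Ioo' h12.le hk.continuousOn
          ⟨by linarith [hg2.2.1], by linarith [hg1.2.2]⟩
    have htI : t ∈ Icc a b := ⟨(ha.trans h1).trans ht.1.le, (ht.2.le.trans h2).trans hb⟩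
    have heq := hA.eq_of_dist_eq (hi t ht) (hgI t htI).1 (sub_eq_zero.1 hzero)
    have := hco t htI heq c₂ ⟨ht.2.le, h2.trans hb⟩
    rcases hends with ⟨e1, e2⟩ | ⟨e1, e2⟩
    · rw [this] at e2
      linarith [hg2.2.2]
    · rw [this] at e2
      linarith [hg2.2.1]
  constructor
  · intro e1
    by_contra! e2
    obtain ⟨c₁, c₂, h1, h12, h2, hc1, hc2, hI⟩ := exists_crossing_interval hh hr ht e1 e2
    exact meet c₁ c₂ h1 h12 h2 hI (Or.inl ⟨hc1, hc2⟩)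
  · intro e1
    by_contra! e2
    -- An inward crossing is an outward crossing for the negated radius.
    obtain ⟨c₁, c₂, h1, h12, h2, hc1, hc2, hI⟩ := exists_crossing_interval hh.neg
      (neg_lt_neg hr) ht (neg_le_neg e1) (neg_le_neg e2)
    refine meet c₁ c₂ h1 h12 h2 (fun t ht => ?_) (Or.inr ⟨neg_le_neg_iff.1 hc1,
      neg_le_neg_iff.1 hc2⟩)
    exact ⟨neg_lt_neg_iff.1 (hI t ht).2, neg_lt_neg_iff.1 (hI t ht).1⟩

/-- Each point is joined to the centre by the radial segment of its leg, parametrised isometrically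
by the distance to `c`. -/
theorem isPreconnected_ball (hA : IsStar c η A) {r : ℝ} (hr : r < η) :
    IsPreconnected (Metric.ball c r) := by
  classical
  refine isPreconnected_of_forall c fun y hy => ?_
  rcases eq_or_ne y c with rfl | hyc
  · exact ⟨{y}, singleton_subset_iff.2 hy, rfl, rfl, isPreconnected_singleton⟩
  have hyr : dist c y < r := by rwa [Metric.mem_ball, dist_comm] at hy
  obtain ⟨i, hi⟩ := mem_iUnion.1 (hA.cover ⟨by rw [Metric.mem_ball, dist_comm]; linarith, hyc⟩)
  have hex : ∀ u : ℝ, ∃ z : M, (0 < u → u < η → z ∈ A i ∧ dist c z = u) ∧ (u ≤ 0 → z = c) := by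
    intro u
    by_cases hu : 0 < u ∧ u < η
    · obtain ⟨z, hz⟩ := hA.exists_dist i u hu.1 hu.2
      exact ⟨z, fun _ _ => hz, fun h => absurd hu.1 (not_lt.2 h)⟩
    · exact ⟨c, fun h1 h2 => absurd ⟨h1, h2⟩ hu, fun _ => rfl⟩
  choose g hg hg0 using hex
  have hdist : ∀ u ∈ Icc 0 (dist c y), dist c (g u) = u := by
    intro u hu
    rcases hu.1.eq_or_lt with rfl | h
    · rw [hg0 0 le_rfl, dist_self]
    · exact (hg u h (by linarith [hu.2])).2
  have hiso : ∀ u ∈ Icc 0 (dist c y), ∀ v ∈ Icc 0 (dist c y), dist (g u) (g v) = |u - v| := by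
    intro u hu v hv
    rcases hu.1.eq_or_lt with rfl | h
    · rw [hg0 0 le_rfl, hdist v hv, zero_sub, abs_neg, abs_of_nonneg hv.1]
    · rcases hv.1.eq_or_lt with rfl | h'
      · rw [hg0 0 le_rfl, dist_comm, hdist u hu, sub_zero, abs_of_nonneg hu.1]
      · rw [hA.dist_eq i _ (hg u h (by linarith [hu.2])).1 _ (hg v h' (by linarith [hv.2])).1,
          hdist u hu, hdist v hv]
  have hcont : ContinuousOn g (Icc 0 (dist c y)) := by
    have : LipschitzOnWith 1 g (Icc 0 (dist c y)) := LipschitzOnWith.of_dist_le_mul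
      fun u hu v hv => by rw [hiso u hu v hv, Real.dist_eq, NNReal.coe_one, one_mul]
    exact this.continuousOn
  refine ⟨g '' Icc 0 (dist c y), ?_, ⟨0, ⟨le_rfl, dist_nonneg⟩, hg0 0 le_rfl⟩,
    ⟨dist c y, ⟨dist_nonneg, le_rfl⟩, ?_⟩, isPreconnected_Icc.image g hcont⟩
  · rintro _ ⟨u, hu, rfl⟩
    rw [Metric.mem_ball, dist_comm, hdist u hu]
    linarith [hu.2]
  · have hpos : 0 < dist c y := dist_pos.2 hyc.symm
    have := hg (dist c y) hpos (by linarith)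
    exact hA.eq_of_dist_eq this.1 hi this.2

/-- Closures of balls about the centre of a star without further vertices are simple compact
sets. -/
theorem isSimpleCompact_closure_ball (hA : IsStar c η A) (G : MetricGraph M)
    (hV : Metric.ball c η ∩ G.V ⊆ {c}) {r : ℝ} (hr0 : 0 < r) (hr : r < η) :
    G.IsSimpleCompact (closure (Metric.ball c r)) := by
  refine ⟨hA.compact.of_isClosed_subset isClosed_closure ?_, Metric.ball c r, ?_, rfl⟩
  · exact Metric.closure_ball_subset_closedBall.trans (Metric.closedBall_subset_closedBall hr.le)
  · refine ⟨Metric.isBounded_ball, ⟨⟨c, Metric.mem_ball_self hr0⟩, hA.isPreconnected_ball hr⟩,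
      Metric.isOpen_ball, ?_, ?_⟩
    · exact subsingleton_singleton.anti
        ((inter_subset_inter_left _ (Metric.ball_subset_ball hr.le)).trans hV)
    · rw [← subset_empty_iff]
      rintro y ⟨hy, hyV⟩
      have h1 : dist y c = r := Metric.frontier_ball_subset_sphere hy
      have h2 := hV ⟨by rw [Metric.mem_ball, h1]; exact hr, hyV⟩
      rw [mem_singleton_iff.1 h2, dist_self] at h1
      exact absurd h1 hr0.ne

/-- Closed balls of a star are covered by at most `C / ε` measurable sets of diameter at
most `ε`. -/
theorem exists_labelling [MeasurableSpace M] [BorelSpace M] [Finite ι] (hA : IsStar c η A) {r : ℝ}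
    (hr0 : 0 < r) (hr : r < η) :
    ∃ C > 0, ∀ ε : ℝ, 0 < ε → ε ≤ 1 → ∃ (N : ℕ) (lab : M → Fin N), Measurable lab ∧
      (N : ℝ) ≤ C / ε ∧ ∀ y ∈ Metric.closedBall c r, ∀ y' ∈ Metric.closedBall c r,
        lab y = lab y' → dist y y' ≤ ε := by
  classical
  have := Fintype.ofFinite ι
  -- There are `Fintype.card ι * (K + 1) + 1` labels, and `K * ε ≤ r`, `ε ≤ 1` bound their number
  -- times `ε` by this constant.
  refine ⟨Fintype.card ι * (r + 1) + 1, by positivity, fun ε hε hε1 => ?_⟩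
  set K := ⌊r / ε⌋₊ with hK
  set S : ι × Fin (K + 1) → Set M := fun p =>
    A p.1 ∩ {y | p.2 * ε ≤ dist c y ∧ dist c y < (p.2 + 1) * ε} with hS
  have hdc : Continuous fun y : M => dist c y := by fun_prop
  have hSm : ∀ p, MeasurableSet (S p) := fun p => (hA.isOpen _).measurableSet.inter
    ((isClosed_le continuous_const hdc).measurableSet.inter
      (isOpen_lt hdc continuous_const).measurableSet)
  have hSfloor : ∀ p, ∀ y ∈ S p, ⌊dist c y / ε⌋₊ = p.2 := by
    intro p y hy
    rw [Nat.floor_eq_iff (by positivity), le_div_iff₀ hε, div_lt_iff₀ hε]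
    exact hy.2
  have huniq : ∀ p q, ∀ y, y ∈ S p → y ∈ S q → p = q := by
    intro p q y hp hq
    have h1 : p.1 = q.1 := by
      by_contra hne
      exact (hA.disjoint _ _ hne).le_bot ⟨hp.1, hq.1⟩
    have h2 : p.2 = q.2 := Fin.ext ((hSfloor p y hp).symm.trans (hSfloor q y hq))
    exact Prod.ext h1 h2
  -- Each leg is cut into radial pieces of width `ε`; within the ball only the centre receives the
  -- extra label `none`.
  set lab : M → Option (ι × Fin (K + 1)) := fun y =>
    if h : ∃ p, y ∈ S p then some h.choose else none with hlab
  have hlab_iff : ∀ y p, lab y = some p ↔ y ∈ S p := by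
    intro y p
    simp only [hlab]
    split_ifs with h
    · constructor
      · intro e
        rw [← Option.some.inj e]
        exact h.choose_spec
      · intro hp
        rw [huniq _ _ y h.choose_spec hp]
    · exact ⟨fun e => by simp at e, fun hp => absurd ⟨p, hp⟩ h⟩
  have hnone : ∀ y ∈ Metric.closedBall c r, lab y = none → y = c := by
    intro y hy hn
    by_contra hyc
    rw [Metric.mem_closedBall, dist_comm] at hy
    obtain ⟨i, hi⟩ := mem_iUnion.1 (hA.cover ⟨by rw [Metric.mem_ball, dist_comm]; linarith, hyc⟩)
    have hfl : ⌊dist c y / ε⌋₊ < K + 1 :=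
      Nat.lt_succ_of_le (Nat.floor_le_floor (by gcongr))
    have hmem : y ∈ S (i, ⟨_, hfl⟩) := by
      refine ⟨hi, ?_, ?_⟩
      · rw [← le_div_iff₀ hε]; exact Nat.floor_le (by positivity)
      · rw [← div_lt_iff₀ hε]; exact Nat.lt_floor_add_one _
    rw [(hlab_iff y _).2 hmem] at hn
    simp at hn
  let e := Fintype.equivFin (Option (ι × Fin (K + 1)))
  refine ⟨_, fun y => e (lab y), ?_, ?_, ?_⟩
  · refine measurable_to_countable' fun k => ?_
    obtain ⟨o, rfl⟩ := e.surjective k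
    have : (fun y => e (lab y)) ⁻¹' {e o} = lab ⁻¹' {o} := by
      ext y; simp
    rw [this]
    cases o with
    | some p =>
      have : lab ⁻¹' {some p} = S p := by
        ext y; simp [hlab_iff]
      rw [this]
      exact hSm p
    | none =>
      have : lab ⁻¹' {none} = (⋃ p, S p)ᶜ := by
        ext y
        simp only [mem_preimage, mem_singleton_iff, mem_compl_iff, mem_iUnion, ← hlab_iff]
        rw [← Option.ne_none_iff_exists', ne_eq, not_not]
      rw [this]
      exact (MeasurableSet.iUnion hSm).compl
  · have hcard : Fintype.card (Option (ι × Fin (K + 1))) = Fintype.card ι * (K + 1) + 1 := by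
      simp
    rw [hcard, le_div_iff₀ hε]
    push_cast
    have hK1 : (K : ℝ) * ε ≤ r := by
      rw [← le_div_iff₀ hε]; exact Nat.floor_le (by positivity)
    have hι : (0 : ℝ) ≤ Fintype.card ι := by positivity
    nlinarith [mul_le_mul_of_nonneg_left (add_le_add hK1 hε1) hι]
  · intro y hy y' hy' hll
    have hll : lab y = lab y' := e.injective hll
    cases h : lab y with
    | none =>
      rw [hnone y hy h, hnone y' hy' (hll ▸ h), dist_self]
      exact hε.le
    | some p =>
      have h1 := (hlab_iff y p).1 h
      have h2 := (hlab_iff y' p).1 (hll ▸ h)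
      rw [hA.dist_eq p.1 y h1.1 y' h2.1, abs_le]
      constructor <;> nlinarith [h1.2.1, h1.2.2, h2.2.1, h2.2.2]

end IsStar

end Star

/-! ### Small stars in metric graphs. -/

namespace MetricGraph

variable {M : Type u} [MetricSpace M] (G : MetricGraph M)

theorem dist_edge (j : G.J) (t t' : {t : ℝ // 0 < t ∧ ENNReal.ofReal t < G.L j}) :
    dist (G.e j t : M) (G.e j t') = |(t : ℝ) - t'| := by
  rw [← Subtype.dist_eq, (G.e j).dist_eq, Subtype.dist_eq, Real.dist_eq]

theorem exists_edge_eq {j : G.J} {y : M} (hy : y ∈ G.E j) : ∃ t, (G.e j t : M) = y :=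
  ⟨(G.e j).symm ⟨y, hy⟩, by simp⟩

theorem isOpen_parameters (j : G.J) : IsOpen {t : ℝ | 0 < t ∧ ENNReal.ofReal t < G.L j} :=
  (isOpen_lt continuous_const continuous_id).inter
    (isOpen_lt ENNReal.continuous_ofReal continuous_const)

/-- A boundary point of an edge sits at one end of it. -/
theorem exists_endpoint {j : G.J} {v : M} (hv : v ∈ closure (G.E j)) (hv' : v ∉ G.E j) :
    ∃ t₀ : ℝ, (∀ t, dist v (G.e j t) = |t₀ - t|) ∧
      (t₀ = 0 ∨ 0 < t₀ ∧ ENNReal.ofReal t₀ = G.L j) := by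
  obtain ⟨y, hyE, hy⟩ := mem_closure_iff_seq_limit.1 hv
  choose t ht using fun k => G.exists_edge_eq (hyE k)
  have hcs : CauchySeq fun k => ((t k : ℝ)) := by
    have h := hy.cauchySeq
    rw [Metric.cauchySeq_iff] at h ⊢
    intro ε hε
    obtain ⟨N, hN⟩ := h ε hε
    refine ⟨N, fun m hm n hn => ?_⟩
    have := hN m hm n hn
    rwa [← ht m, ← ht n, G.dist_edge, ← Real.dist_eq] at this
  obtain ⟨t₀, ht₀⟩ := cauchySeq_tendsto_of_complete hcs
  refine ⟨t₀, fun r => ?_, ?_⟩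
  · have h1 : Tendsto (fun k => dist (y k) (G.e j r)) atTop (𝓝 (dist v (G.e j r))) :=
      hy.dist tendsto_const_nhds
    have h2 : Tendsto (fun k => |(t k : ℝ) - r|) atTop (𝓝 |t₀ - r|) :=
      (ht₀.sub_const _).abs
    refine tendsto_nhds_unique h1 (h2.congr fun k => ?_)
    rw [← ht k, G.dist_edge]
  · have h0 : 0 ≤ t₀ := ge_of_tendsto' ht₀ fun k => (t k).2.1.le
    have hL : ENNReal.ofReal t₀ ≤ G.L j :=
      le_of_tendsto' ((ENNReal.continuous_ofReal.tendsto t₀).comp ht₀) fun k => (t k).2.2.le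
    rcases h0.eq_or_lt with h | h
    · exact Or.inl h.symm
    -- A limit of the parameters interior to the parameter interval would place `v` on the edge
    -- itself.
    refine Or.inr ⟨h, hL.eq_or_lt.resolve_right fun hlt => hv' ?_⟩
    have h1 : Tendsto t atTop (𝓝 ⟨t₀, h, hlt⟩) := tendsto_subtype_rng.2 ht₀
    have h2 : Tendsto y atTop (𝓝 (G.e j ⟨t₀, h, hlt⟩ : M)) := by
      have h3 := (continuous_subtype_val.tendsto _).comp (((G.e j).continuous.tendsto _).comp h1)
      exact h3.congr fun k => ht k
    rw [tendsto_nhds_unique hy h2]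
    exact (G.e j ⟨t₀, h, hlt⟩).2

theorem exists_parameter (j : G.J) : ∃ r : ℝ, 0 < r ∧ ENNReal.ofReal r < G.L j := by
  obtain ⟨r, hr0, hr⟩ := ENNReal.lt_iff_exists_nnreal_btwn.1 (G.L_pos j)
  exact ⟨r, by exact_mod_cast hr0, by rwa [ENNReal.ofReal_coe_nnreal]⟩

/-- Every point of a metric graph is the centre of arbitrarily small stars without further
vertices. -/
theorem exists_isStar [LocallyCompactSpace M] (c : M) {ε : ℝ} (hε : 0 < ε) :
    ∃ η ≤ ε, ∃ (ι : Type u) (_ : Finite ι) (A : ι → Set M), IsStar c η A ∧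
      Metric.ball c η ∩ G.V ⊆ {c} := by
  have hpos : ∀ᶠ η : ℝ in 𝓝[>] 0, 0 < η := self_mem_nhdsWithin
  have hle : ∀ {δ : ℝ}, 0 < δ → ∀ᶠ η : ℝ in 𝓝[>] 0, η ≤ δ := fun hδ =>
    nhdsWithin_le_nhds (eventually_le_nhds hδ)
  have hcomp : ∀ᶠ η : ℝ in 𝓝[>] 0, IsCompact (Metric.closedBall c η) := by
    obtain ⟨K, hKc, hK⟩ := exists_compact_mem_nhds c
    obtain ⟨r, hr, hrK⟩ := Metric.nhds_basis_closedBall.mem_iff.1 hK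
    filter_upwards [hle hr] with η hη
    exact hKc.of_isClosed_subset Metric.isClosed_closedBall
      ((Metric.closedBall_subset_closedBall hη).trans hrK)
  have hball : ∀ {U : Set M}, U ∈ 𝓝 c → ∀ᶠ η : ℝ in 𝓝[>] 0, Metric.ball c η ⊆ U := by
    intro U hU
    obtain ⟨r, hr, hrU⟩ := Metric.mem_nhds_iff.1 hU
    filter_upwards [hle hr] with η hη using (Metric.ball_subset_ball hη).trans hrU
  by_cases hcV : c ∈ G.V
  · have hfin := G.adjacent_finite c hcV
    have hfin' : Finite {j | c ∈ frontier (G.E j)} := hfin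
    have hcE : ∀ j, c ∉ G.E j := fun j hj => by
      have : c ∈ ⋃ j, G.E j := mem_iUnion.2 ⟨j, hj⟩
      rw [G.iUnion_E] at this
      exact this hcV
    -- `R j` is a length available on the edge `j`; radii below all these `R j` occur on every
    -- adjacent edge, whichever end of it lies at `c`.
    choose R hR0 hR using G.exists_parameter
    have hRev : ∀ᶠ η : ℝ in 𝓝[>] 0, ∀ j : {j | c ∈ frontier (G.E j)}, η ≤ R j :=
      eventually_all.2 fun j => hle (hR0 j)
    obtain ⟨η, hη0, hηε, hηc, hηb, hηR⟩ := (hpos.and ((hle hε).and (hcomp.and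
      ((hball (G.star_mem_nhds c hcV)).and hRev)))).exists
    refine ⟨η, hηε, {j | c ∈ frontier (G.E j)}, hfin', fun j => G.E j,
      ⟨hη0, fun j => G.isOpen_E j, fun i j hij => G.disjoint_E _ _ fun h => hij (Subtype.ext h),
        ?_, ?_, ?_, hηc⟩, ?_⟩
    · rintro y ⟨hy, hyc⟩
      rcases hηb hy with h | h
      · exact absurd h hyc
      · obtain ⟨j, hj, hyj⟩ := mem_iUnion₂.1 h
        exact mem_iUnion.2 ⟨⟨j, hj⟩, hyj⟩
    · rintro ⟨j, hj⟩ y hy y' hy'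
      obtain ⟨t₀, ht₀, hend⟩ := G.exists_endpoint (frontier_subset_closure hj) (hcE j)
      obtain ⟨t, rfl⟩ := G.exists_edge_eq hy
      obtain ⟨t', rfl⟩ := G.exists_edge_eq hy'
      rw [G.dist_edge, ht₀, ht₀]
      rcases hend with rfl | ⟨h0, hL⟩
      · rw [zero_sub, zero_sub, abs_neg, abs_neg, abs_of_pos t.2.1, abs_of_pos t'.2.1]
      · have h1 : (t : ℝ) < t₀ := (ENNReal.ofReal_lt_ofReal_iff h0).1 (t.2.2.trans_eq hL.symm)
        have h2 : (t' : ℝ) < t₀ := (ENNReal.ofReal_lt_ofReal_iff h0).1 (t'.2.2.trans_eq hL.symm)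
        rw [abs_of_pos (sub_pos.2 h1), abs_of_pos (sub_pos.2 h2), abs_sub_comm]
        congr 1
        ring
    · rintro ⟨j, hj⟩ r hr0 hr
      obtain ⟨t₀, ht₀, hend⟩ := G.exists_endpoint (frontier_subset_closure hj) (hcE j)
      have hrR : r < R j := hr.trans_le (hηR ⟨j, hj⟩)
      rcases hend with rfl | ⟨h0, hL⟩
      · have hrL : ENNReal.ofReal r < G.L j := (ENNReal.ofReal_le_ofReal hrR.le).trans_lt (hR j)
        refine ⟨G.e j ⟨r, hr0, hrL⟩, (G.e j _).2, ?_⟩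
        rw [ht₀, zero_sub, abs_neg, abs_of_pos hr0]
      · have hlt := hR j
        rw [← hL, ENNReal.ofReal_lt_ofReal_iff h0] at hlt
        have hrL : ENNReal.ofReal (t₀ - r) < G.L j := by
          rw [← hL, ENNReal.ofReal_lt_ofReal_iff h0]
          linarith
        refine ⟨G.e j ⟨t₀ - r, by linarith, hrL⟩, (G.e j _).2, ?_⟩
        rw [ht₀, sub_sub_cancel, abs_of_pos hr0]
    · rintro y ⟨hy, hyV⟩
      rcases hηb hy with h | h
      · exact h
      · obtain ⟨j, hj, hyj⟩ := mem_iUnion₂.1 h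
        have : y ∈ ⋃ j, G.E j := mem_iUnion.2 ⟨j, hyj⟩
        rw [G.iUnion_E] at this
        exact absurd hyV this
  · have hc : c ∈ ⋃ j, G.E j := by rw [G.iUnion_E]; exact hcV
    obtain ⟨j, hj⟩ := mem_iUnion.1 hc
    obtain ⟨t₀, ht₀⟩ := G.exists_edge_eq hj
    obtain ⟨ρ, hρ, hρI⟩ := Metric.isOpen_iff.1 (G.isOpen_parameters j) t₀ t₀.2
    obtain ⟨η, hη0, hηε, hηc, hηb, hηρ⟩ := (hpos.and ((hle hε).and (hcomp.and
      ((hball ((G.isOpen_E j).mem_nhds hj)).and (hle hρ))))).exists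
    have hopen : ∀ I : Set {t : ℝ // 0 < t ∧ ENNReal.ofReal t < G.L j}, IsOpen I →
        IsOpen ((fun t => (G.e j t : M)) '' I) := by
      intro I hI
      have := (G.isOpen_E j).isOpenMap_subtype_val _ ((G.e j).toHomeomorph.isOpenMap _ hI)
      rwa [image_image] at this
    have hinj : ∀ t t', (G.e j t : M) = G.e j t' → t = t' := fun t t' h =>
      (G.e j).injective (Subtype.ext h)
    -- Away from the vertices the star has two legs, the parts of the edge on either side of `t₀`;
    -- `ULift` only adjusts the universe.
    refine ⟨η, hηε, ULift Bool, inferInstance, fun b => (fun t => (G.e j t : M)) ''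
      (if b.down then {t | (t₀ : ℝ) < t} else {t | (t : ℝ) < t₀}),
      ⟨hη0, ?_, ?_, ?_, ?_, ?_, hηc⟩, ?_⟩
    · rintro ⟨_ | _⟩
      · exact hopen _ (isOpen_lt continuous_subtype_val continuous_const)
      · exact hopen _ (isOpen_lt continuous_const continuous_subtype_val)
    · rintro ⟨_ | _⟩ ⟨_ | _⟩ hne
      · exact absurd rfl hne
      · rw [Set.disjoint_left]
        rintro _ ⟨t, ht, rfl⟩ ⟨t', ht', heq⟩
        rw [hinj _ _ heq] at ht'
        have h1 : (t : ℝ) < t₀ := ht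
        have h2 : (t₀ : ℝ) < t := ht'
        exact lt_asymm h1 h2
      · rw [Set.disjoint_left]
        rintro _ ⟨t, ht, rfl⟩ ⟨t', ht', heq⟩
        rw [hinj _ _ heq] at ht'
        have h1 : (t₀ : ℝ) < t := ht
        have h2 : (t : ℝ) < t₀ := ht'
        exact lt_asymm h1 h2
      · exact absurd rfl hne
    · rintro y ⟨hy, hyc⟩
      obtain ⟨t, rfl⟩ := G.exists_edge_eq (hηb hy)
      rcases lt_trichotomy (t : ℝ) t₀ with h | h | h
      · exact mem_iUnion.2 ⟨⟨false⟩, t, h, rfl⟩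
      · refine absurd ?_ hyc
        rw [mem_singleton_iff, ← ht₀, Subtype.ext h]
      · exact mem_iUnion.2 ⟨⟨true⟩, t, h, rfl⟩
    · rintro ⟨_ | _⟩ _ ⟨t, ht, rfl⟩ _ ⟨t', ht', rfl⟩
      · have h1 : (t : ℝ) < t₀ := ht
        have h2 : (t' : ℝ) < t₀ := ht'
        rw [← ht₀]
        simp only [G.dist_edge]
        rw [abs_of_pos (sub_pos.2 h1), abs_of_pos (sub_pos.2 h2), abs_sub_comm]
        congr 1
        ring
      · have h1 : (t₀ : ℝ) < t := ht
        have h2 : (t₀ : ℝ) < t' := ht'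
        rw [← ht₀]
        simp only [G.dist_edge]
        rw [abs_of_neg (sub_neg.2 h1), abs_of_neg (sub_neg.2 h2)]
        congr 1
        ring
    · rintro ⟨_ | _⟩ r hr0 hr
      · have hI := hρI (show (t₀ : ℝ) - r ∈ Metric.ball (t₀ : ℝ) ρ by
          rw [Metric.mem_ball, Real.dist_eq, abs_lt]; constructor <;> linarith)
        refine ⟨_, ⟨⟨t₀ - r, hI⟩, show (t₀ : ℝ) - r < t₀ by linarith, rfl⟩, ?_⟩
        rw [← ht₀]
        simp only [G.dist_edge]
        rw [sub_sub_cancel, abs_of_pos hr0]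
      · have hI := hρI (show (t₀ : ℝ) + r ∈ Metric.ball (t₀ : ℝ) ρ by
          rw [Metric.mem_ball, Real.dist_eq, abs_lt]; constructor <;> linarith)
        refine ⟨_, ⟨⟨t₀ + r, hI⟩, show (t₀ : ℝ) < t₀ + r by linarith, rfl⟩, ?_⟩
        rw [← ht₀]
        simp only [G.dist_edge]
        rw [sub_add_cancel_left, abs_neg, abs_of_pos hr0]
    · rintro y ⟨hy, hyV⟩
      have : y ∈ ⋃ j, G.E j := mem_iUnion.2 ⟨j, hηb hy⟩
      rw [G.iUnion_E] at this
      exact absurd hyV this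

end MetricGraph


/-! ### Compactness in the path space. -/

namespace PathSpace

variable {M : Type u}

theorem isInducing_start_ext [TopologicalSpace M] :
    IsInducing fun f : PathSpace M => (f.start, f.ext) := ⟨rfl⟩

/-- A pair comes from a path exactly when its function is constant before the starting time. With
the inducing property this lets compactness be pulled back from `ℝ × C(ℝ, M)`. -/
theorem isClosed_range_start_ext [TopologicalSpace M] [T2Space M] :
    IsClosed (range fun f : PathSpace M => (f.start, f.ext)) := by
  have : (range fun f : PathSpace M => (f.start, f.ext))
      = ⋂ t : ℝ, {p : ℝ × C(ℝ, M) | p.2 (max p.1 t) = p.2 t} := by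
    ext p
    simp only [mem_range, mem_iInter, mem_ofPred_eq]
    constructor
    · rintro ⟨f, rfl⟩ t
      rcases le_total t f.start with h | h
      · rw [max_eq_left h, ext_of_le_start f h]
      · rw [max_eq_right h]
    · intro h
      refine ⟨⟨p.1, p.2.restrict (Ici p.1)⟩, Prod.ext rfl ?_⟩
      ext t
      exact h t
  rw [this]
  exact isClosed_iInter fun t => isClosed_eq (by fun_prop) (by fun_prop)

/-- Arzelà–Ascoli for paths. -/
theorem isCompact_closure [MetricSpace M] {S : Set (PathSpace M)} {T : ℝ}
    (hT : ∀ f ∈ S, f.start ∈ Icc (-T) T)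
    (heq : ∀ t₀, ∀ ε > 0, ∃ δ > 0, ∀ t, dist t t₀ < δ → ∀ f ∈ S, dist (f.ext t₀) (f.ext t) < ε)
    (hcpt : ∀ t, ∃ C, IsCompact C ∧ ∀ f ∈ S, f.ext t ∈ C) : IsCompact (closure S) := by
  set S' : Set C(ℝ, M) := ext '' S with hS'
  have hemb : IsClosedEmbedding (UniformOnFun.ofFun {K : Set ℝ | IsCompact K} ∘
      fun f : C(ℝ, M) => (f : ℝ → M)) := by
    refine ⟨(ContinuousMap.isUniformEmbedding_toUniformOnFunIsCompact
      (α := ℝ) (β := M)).isEmbedding, ?_⟩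
    have h1 := ContinuousMap.range_toUniformOnFunIsCompact (α := ℝ) (β := M)
    have h2 : IsClosed {f : UniformOnFun ℝ M {K | IsCompact K} | Continuous f} :=
      UniformOnFun.isClosed_setOfPred_continuous CompactlyCoherentSpace.isCoherentWith
    rw [← h1] at h2
    exact h2
  have hc : IsCompact (closure S') := by
    refine ArzelaAscoli.isCompact_closure_of_isClosedEmbedding (fun K hK => hK) hemb
      (fun K _ => ?_) (fun K _ t _ => ?_)
    · refine Equicontinuous.equicontinuousOn (fun t₀ => ?_) K
      rw [Metric.equicontinuousAt_iff]
      intro ε hε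
      obtain ⟨δ, hδ, h⟩ := heq t₀ ε hε
      refine ⟨δ, hδ, fun t ht f => ?_⟩
      obtain ⟨g, hg, hgf⟩ := f.2
      change dist (f.1 t₀) (f.1 t) < ε
      rw [← hgf]
      exact h t ht g hg
    · obtain ⟨C, hC, h⟩ := hcpt t
      refine ⟨C, hC, ?_⟩
      rintro _ ⟨g, hg, rfl⟩
      exact h g hg
  have hpre := isInducing_start_ext.isCompact_preimage isClosed_range_start_ext
    ((isCompact_Icc (a := -T) (b := T)).prod hc)
  refine hpre.of_isClosed_subset isClosed_closure (closure_minimal ?_ ?_)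
  · exact fun f hf => ⟨hT f hf, subset_closure (mem_image_of_mem _ hf)⟩
  · exact ((isClosed_Icc.prod isClosed_closure).preimage isInducing_start_ext.continuous)

end PathSpace

/-! ### Deterministic passage from cell statements to the skeleton property. -/

section Deterministic

variable {M : Type u} [MetricSpace M]

/-- No path of the family crosses the shell `r₁ ≤ d(c, ·) ≤ r₂` within a short time, as long as
the initial time is in `[-T, T]`. -/
def NoCrossing (φ : ℕ → PathSpace M) (c : M) (r₁ r₂ T : ℝ) : Prop :=
  ∃ δ > 0, ∀ (n : ℕ) (t₁ t₂ : ℝ), (φ n).start ≤ t₁ → t₁ ∈ Icc (-T) T → t₁ ≤ t₂ → t₂ ≤ t₁ + δ →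
    (dist c ((φ n).ext t₁) ≤ r₁ → dist c ((φ n).ext t₂) < r₂) ∧
    (r₂ ≤ dist c ((φ n).ext t₁) → r₁ < dist c ((φ n).ext t₂))

/-- Countably many pairs of concentric balls, of any small size; the inner ones cover the space and
the outer ones are relatively compact. -/
structure IsCellCover (D : ℕ → Set M) (R₁ R₂ : ℕ → M → ℝ) : Prop where
  countable : ∀ m, (D m).Countable
  pos : ∀ m c, 0 < R₁ m c
  lt : ∀ m c, R₁ m c < R₂ m c
  small : ∀ m c, R₂ m c ≤ 1 / ((m : ℝ) + 1)
  compact : ∀ m c, IsCompact (Metric.closedBall c (R₂ m c))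
  cover : ∀ m, ⋃ c ∈ D m, Metric.ball c (R₁ m c) = univ

variable {D : ℕ → Set M} {R₁ R₂ : ℕ → M → ℝ} {φ : ℕ → PathSpace M}

theorem IsCellCover.exists_mem (hD : IsCellCover D R₁ R₂) (m : ℕ) (y : M) :
    ∃ c ∈ D m, dist c y < R₁ m c := by
  have : y ∈ ⋃ c ∈ D m, Metric.ball c (R₁ m c) := by rw [hD.cover]; trivial
  obtain ⟨c, hc, hy⟩ := mem_iUnion₂.1 this
  exact ⟨c, hc, by rwa [dist_comm]⟩

theorem IsCellCover.exists_finset (hD : IsCellCover D R₁ R₂) (m : ℕ) {K : Set M}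
    (hK : IsCompact K) :
    ∃ F : Finset M, (∀ c ∈ F, c ∈ D m) ∧ ∀ y ∈ K, ∃ c ∈ F, dist c y < R₁ m c := by
  obtain ⟨b, hbD, hbf, hKb⟩ := hK.elim_finite_subcover_image (b := D m)
    (c := fun c => Metric.ball c (R₁ m c)) (fun _ _ => Metric.isOpen_ball)
    (by rw [hD.cover]; exact subset_univ _)
  refine ⟨hbf.toFinset, fun c hc => hbD (hbf.mem_toFinset.1 hc), fun y hy => ?_⟩
  obtain ⟨c, hc, hyc⟩ := mem_iUnion₂.1 (hKb hy)
  exact ⟨c, hbf.mem_toFinset.2 hc, by rwa [dist_comm]⟩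

/-- Paths started in a compact set move by little within a short time, uniformly. -/
theorem exists_uniform_of_noCrossing
    (hNC : ∀ m, ∀ c ∈ D m, ∀ T : ℕ, NoCrossing φ c (R₁ m c) (R₂ m c) T) (m : ℕ) {F : Finset M}
    (hF : ∀ c ∈ F, c ∈ D m) {K : Set M} (hFK : ∀ y ∈ K, ∃ c ∈ F, dist c y < R₁ m c) (T : ℝ) :
    ∃ δ > 0, ∀ (n : ℕ) (t₁ t₂ : ℝ), (φ n).start ≤ t₁ → t₁ ∈ Icc (-T) T → t₁ ≤ t₂ → t₂ ≤ t₁ + δ →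
      (φ n).ext t₁ ∈ K →
        ∃ c ∈ F, dist c ((φ n).ext t₁) < R₁ m c ∧ dist c ((φ n).ext t₂) < R₂ m c := by
  obtain ⟨N, hN⟩ := exists_nat_ge T
  have hev : ∀ᶠ δ : ℝ in 𝓝[>] 0, ∀ c ∈ F, ∀ (n : ℕ) (t₁ t₂ : ℝ), (φ n).start ≤ t₁ →
      t₁ ∈ Icc (-T) T → t₁ ≤ t₂ → t₂ ≤ t₁ + δ →
      dist c ((φ n).ext t₁) ≤ R₁ m c → dist c ((φ n).ext t₂) < R₂ m c := by
    refine (Finset.eventually_all F).2 fun c hc => ?_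
    obtain ⟨δ, hδ, h⟩ := hNC m c (hF c hc) N
    filter_upwards [nhdsWithin_le_nhds (eventually_le_nhds hδ)] with δ' hδ' n t₁ t₂ h1 h2 h3 h4
    exact (h n t₁ t₂ h1 ⟨by linarith [h2.1], h2.2.trans hN⟩ h3 (by linarith)).1
  have hpos : ∀ᶠ δ : ℝ in 𝓝[>] 0, 0 < δ := self_mem_nhdsWithin
  obtain ⟨δ, hδ, h⟩ := (hpos.and hev).exists
  refine ⟨δ, hδ, fun n t₁ t₂ h1 h2 h3 h4 hK => ?_⟩
  obtain ⟨c, hc, hcd⟩ := hFK _ hK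
  exact ⟨c, hc, hcd, h c hc n t₁ t₂ h1 h2 h3 h4 hcd.le⟩

/-- The set of positions at time `t` of the paths started before time `s`. -/
def positions (φ : ℕ → PathSpace M) (s t : ℝ) : Set M :=
  {y | ∃ n, (φ n).start ≤ s ∧ y = (φ n).ext t}

theorem LocallyFiniteSubset.finite_inter {S : Set M} (hS : LocallyFiniteSubset S) {K : Set M}
    (hK : IsCompact K) : (S ∩ K).Finite := by
  refine hK.induction_on (p := fun K => (S ∩ K).Finite) (by simp)
    (fun A B hAB hB => hB.subset (inter_subset_inter_right S hAB))
    (fun A B hA hB => by rw [inter_union_distrib_left]; exact hA.union hB) fun y _ => ?_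
  obtain ⟨U, hU, hf⟩ := hS y
  exact ⟨U, mem_nhdsWithin_of_mem_nhds hU, hf⟩

/-- By coalescence the position at `t₂` is a function of the position at `t₁`, so finiteness
propagates forward in time. -/
theorem finite_positions_of_finite {s₁ s₂ t₁ t₂ : ℝ}
    (hcoal : ∀ (s : ℝ) (m n : ℕ), (φ m).start ≤ s → (φ n).start ≤ s →
      (φ m).ext s = (φ n).ext s → ∀ t, s ≤ t → (φ m).ext t = (φ n).ext t)
    (hs : s₁ ≤ s₂) (hst : s₂ ≤ t₁) (ht : t₁ ≤ t₂) {K B : Set M}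
    (hfin : (positions φ s₂ t₁ ∩ K).Finite)
    (hKB : ∀ n, (φ n).start ≤ s₁ → (φ n).ext t₂ ∈ B → (φ n).ext t₁ ∈ K) :
    (positions φ s₁ t₂ ∩ B).Finite := by
  classical
  have hex : ∀ y : M, ∃ k : ℕ, y ∈ positions φ s₂ t₁ → (φ k).start ≤ s₂ ∧ y = (φ k).ext t₁ := by
    intro y
    by_cases hy : y ∈ positions φ s₂ t₁
    · obtain ⟨k, hk⟩ := hy
      exact ⟨k, fun _ => hk⟩
    · exact ⟨0, fun h => absurd h hy⟩
  choose k hk using hex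
  refine (hfin.image fun y => (φ (k y)).ext t₂).subset ?_
  rintro _ ⟨⟨n, hn, rfl⟩, hB⟩
  have hmem : (φ n).ext t₁ ∈ positions φ s₂ t₁ := ⟨n, hn.trans hs, rfl⟩
  refine ⟨(φ n).ext t₁, ⟨hmem, hKB n hn hB⟩, ?_⟩
  have := hk _ hmem
  exact (hcoal t₁ n _ ((hn.trans hs).trans hst) (this.1.trans hst) this.2 t₂ ht).symm

/-- Instantaneous coalescence follows from the finiteness of the number of particles in cells at
rational times. -/
theorem hasICP_of_cells (hD : IsCellCover D R₁ R₂)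
    (hcoal : ∀ (s : ℝ) (m n : ℕ), (φ m).start ≤ s → (φ n).start ≤ s →
      (φ m).ext s = (φ n).ext s → ∀ t, s ≤ t → (φ m).ext t = (φ n).ext t)
    (hNC : ∀ m, ∀ c ∈ D m, ∀ T : ℕ, NoCrossing φ c (R₁ m c) (R₂ m c) T)
    (hfin : ∀ m, ∀ c ∈ D m, ∀ p q : ℚ, p < q →
      (positions φ p q ∩ Metric.closedBall c (R₁ m c)).Finite) : HasICP φ := by
  have hfinK : ∀ K : Set M, IsCompact K → ∀ p q : ℚ, p < q → (positions φ p q ∩ K).Finite := by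
    intro K hK p q hpq
    obtain ⟨F, hF, hFK⟩ := hD.exists_finset 0 hK
    refine (F.finite_toSet.biUnion fun c hc => hfin 0 c (hF c hc) p q hpq).subset ?_
    rintro y ⟨hy, hyK⟩
    obtain ⟨c, hc, hcd⟩ := hFK y hyK
    exact mem_biUnion (x := c) hc ⟨hy, by rw [Metric.mem_closedBall, dist_comm]; exact hcd.le⟩
  intro s t hst y
  obtain ⟨c, hc, hcy⟩ := hD.exists_mem 0 y
  refine ⟨Metric.ball c (R₁ 0 c), Metric.isOpen_ball.mem_nhds (by
    rwa [Metric.mem_ball, dist_comm]), ?_⟩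
  obtain ⟨N, hN⟩ := exists_nat_ge (max |s| |t|)
  obtain ⟨δ, hδ, hcross⟩ := hNC 0 c hc N
  -- A path in the inner ball at time `t` was in the outer ball at `q`, since it cannot cross the
  -- shell inwards within time `δ`. The positions at `q` in that compact ball are finite in number.
  obtain ⟨q, hq1, hq2⟩ := exists_rat_btwn (show max s (t - δ) < t from max_lt hst (by linarith))
  obtain ⟨p, hp1, hp2⟩ := exists_rat_btwn ((le_max_left s (t - δ)).trans_lt hq1)
  have hsN := abs_le.1 ((le_max_left _ _).trans hN)
  have htN := abs_le.1 ((le_max_right _ _).trans hN)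
  refine finite_positions_of_finite hcoal hp1.le hp2.le hq2.le
    (hfinK _ (hD.compact 0 c) p q (by exact_mod_cast hp2)) fun n hn hB => ?_
  by_contra hout
  rw [Metric.mem_closedBall, dist_comm, not_le] at hout
  have := (hcross n q t (hn.trans (hp1.trans hp2).le) ⟨by linarith, by linarith⟩ hq2.le
    (by linarith [(le_max_right s (t - δ)).trans_lt hq1])).2 hout.le
  rw [Metric.mem_ball, dist_comm] at hB
  exact lt_asymm this hB

/-- Compact containment: up to any time, the paths that pass through a compact set `L` stay in a
compact set. -/
theorem exists_compact_containment (hD : IsCellCover D R₁ R₂)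
    (hcoal : ∀ (s : ℝ) (m n : ℕ), (φ m).start ≤ s → (φ n).start ≤ s →
      (φ m).ext s = (φ n).ext s → ∀ t, s ≤ t → (φ m).ext t = (φ n).ext t)
    (hNC : ∀ m, ∀ c ∈ D m, ∀ T : ℕ, NoCrossing φ c (R₁ m c) (R₂ m c) T)
    (hICP : HasICP φ) {K : Set M} (hK : IsCompact K) (T T' : ℝ) :
    ∃ C, IsCompact C ∧ ∀ (n : ℕ) (s t : ℝ), (φ n).start ≤ s → s ∈ Icc (-T) T →
      (φ n).ext s ∈ K → s ≤ t → t ≤ T' → (φ n).ext t ∈ C := by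
  classical
  obtain ⟨F, hF, hFK⟩ := hD.exists_finset 0 hK
  obtain ⟨δ, hδ, hunif⟩ := exists_uniform_of_noCrossing hNC 0 hF hFK T
  set K' : Set M := ⋃ c ∈ F, Metric.closedBall c (R₂ 0 c) with hK'
  have hK'c : IsCompact K' := F.isCompact_biUnion fun c _ => hD.compact 0 c
  have hin : ∀ (n : ℕ) (s t : ℝ), (φ n).start ≤ s → s ∈ Icc (-T) T →
      (φ n).ext s ∈ K → s ≤ t → t ≤ s + δ → (φ n).ext t ∈ K' := by
    intro n s t h1 h2 h3 h4 h5
    obtain ⟨c, hc, -, hcd⟩ := hunif n s t h1 h2 h4 h5 h3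
    exact mem_biUnion (x := c) hc (by rw [Metric.mem_closedBall, dist_comm]; exact hcd.le)
  -- The first grid point `k * η` at or after `s` satisfies `k * η + η < s + δ`. At that moment the
  -- path is still in `K'` and has coalesced into one of finitely many.
  set η := δ / 2 with hη
  have hη0 : 0 < η := by positivity
  have hW : ∀ k : ℤ, (positions φ (k * η) (k * η + η) ∩ K').Finite := fun k =>
    (hICP (k * η) (k * η + η) (by linarith)).finite_inter hK'c
  have hex : ∀ (k : ℤ) (y : M), ∃ j : ℕ, y ∈ positions φ (k * η) (k * η + η) →
      (φ j).start ≤ k * η ∧ y = (φ j).ext (k * η + η) := by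
    intro k y
    by_cases hy : y ∈ positions φ (k * η) (k * η + η)
    · obtain ⟨j, hj⟩ := hy
      exact ⟨j, fun _ => hj⟩
    · exact ⟨0, fun h => absurd h hy⟩
  choose j hj using hex
  -- `K'` contains the path up to time `s + δ`; afterwards it follows one of finitely many
  -- representatives, whose images of a bounded time interval are compact.
  refine ⟨K' ∪ ⋃ k ∈ Finset.Icc ⌈-T / η⌉ ⌈T / η⌉, ⋃ y ∈ (hW k).toFinset,
    (φ (j k y)).ext '' Icc (k * η + η) T', ?_, ?_⟩
  · refine hK'c.union (Finset.isCompact_biUnion _ fun k _ => Finset.isCompact_biUnion _ fun y _ => ?_)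
    exact isCompact_Icc.image (φ _).ext.continuous
  · intro n s t h1 h2 h3 h4 h5
    rcases le_total t (s + δ) with h | h
    · exact Or.inl (hin n s t h1 h2 h3 h4 h)
    right
    set k := ⌈s / η⌉ with hk
    have hk1 : s ≤ k * η := by
      rw [← div_le_iff₀ hη0]; exact Int.le_ceil _
    have hk2 : k * η < s + η := by
      have := Int.ceil_lt_add_one (s / η)
      rw [← hk] at this
      calc (k : ℝ) * η < (s / η + 1) * η := by gcongr
        _ = s + η := by field_simp
    have hkI : k ∈ Finset.Icc ⌈-T / η⌉ ⌈T / η⌉ := by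
      rw [Finset.mem_Icc]
      exact ⟨Int.ceil_le_ceil (by gcongr; exact h2.1), Int.ceil_le_ceil (by gcongr; exact h2.2)⟩
    have hmem : (φ n).ext (k * η + η) ∈ positions φ (k * η) (k * η + η) := ⟨n, h1.trans hk1, rfl⟩
    have hK'm : (φ n).ext (k * η + η) ∈ K' :=
      hin n s _ h1 h2 h3 (by linarith) (by linarith)
    have hjk := hj k _ hmem
    refine mem_iUnion₂.2 ⟨k, hkI, mem_iUnion₂.2 ⟨_, (hW k).mem_toFinset.2 ⟨hmem, hK'm⟩,
      t, ⟨by linarith, h5⟩, ?_⟩⟩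
    exact (hcoal (k * η + η) n _ (by linarith) (by linarith [hjk.1]) hjk.2 t (by linarith)).symm

/-- Compact containment supplies the pointwise compactness for Arzelà–Ascoli. Covering the
containing compact set by cells of radius less than `ε / 2` supplies the equicontinuity. -/
theorem isSkeleton_of_cells (hD : IsCellCover D R₁ R₂)
    (hcoal : ∀ (s : ℝ) (m n : ℕ), (φ m).start ≤ s → (φ n).start ≤ s →
      (φ m).ext s = (φ n).ext s → ∀ t, s ≤ t → (φ m).ext t = (φ n).ext t)
    (hdense : DenseRange fun n => ((φ n).start, (φ n).ext (φ n).start))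
    (hNC : ∀ m, ∀ c ∈ D m, ∀ T : ℕ, NoCrossing φ c (R₁ m c) (R₂ m c) T)
    (hICP : HasICP φ) : IsSkeleton φ := by
  refine ⟨hcoal, hdense, fun L hL => ?_⟩
  have hK : IsCompact (Prod.snd '' L) := hL.image continuous_snd
  obtain ⟨T, hT⟩ : ∃ T : ℝ, ∀ p ∈ L, p.1 ∈ Icc (-T) T := by
    obtain ⟨T, hT⟩ := (hL.image continuous_fst).isBounded.exists_norm_le
    exact ⟨T, fun p hp => abs_le.1 (hT p.1 (mem_image_of_mem _ hp))⟩
  refine PathSpace.isCompact_closure (T := T) ?_ ?_ ?_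
  · rintro _ ⟨n, s, -, hsL, rfl⟩
    exact hT _ hsL
  · intro t₀ ε hε
    obtain ⟨m, hm⟩ := exists_nat_one_div_lt (half_pos hε)
    set T' := max T (t₀ + 1) with hT'
    obtain ⟨C, hC, hCin⟩ := exists_compact_containment hD hcoal hNC hICP hK T T'
    obtain ⟨F, hF, hFC⟩ := hD.exists_finset m hC
    obtain ⟨δ, hδ, hunif⟩ := exists_uniform_of_noCrossing hNC m hF hFC T'
    have hclose : ∀ (n : ℕ) (s a b : ℝ), (φ n).start ≤ s → (s, (φ n).ext s) ∈ L → s ≤ a → a ≤ T' →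
        a ≤ b → b ≤ a + δ → dist ((φ n).ext a) ((φ n).ext b) < ε := by
      intro n s a b h1 hL' h2 h3 h4 h5
      have hsT := hT _ hL'
      have haC := hCin n s a h1 hsT ⟨_, hL', rfl⟩ h2 h3
      have h6 : -T' ≤ a := by linarith [hsT.1, le_max_left T (t₀ + 1)]
      obtain ⟨c, -, hc1, hc2⟩ := hunif n a b (h1.trans h2) ⟨h6, h3⟩ h4 h5 haC
      have := dist_triangle_left ((φ n).ext a) ((φ n).ext b) c
      linarith [hD.lt m c, hD.small m c]
    refine ⟨min δ 1, lt_min hδ one_pos, ?_⟩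
    rintro t ht _ ⟨n, s, hns, hsL, rfl⟩
    rw [PathSpace.restrictIci_ext, PathSpace.restrictIci_ext]
    have htδ : |t - t₀| < δ := by
      rw [← Real.dist_eq]; exact ht.trans_le (min_le_left _ _)
    have ht1 : |t - t₀| < 1 := by
      rw [← Real.dist_eq]; exact ht.trans_le (min_le_right _ _)
    have hsT : s ≤ T' := (hT _ hsL).2.trans (le_max_left _ _)
    have hdiff : |max s t - max s t₀| ≤ |t - t₀| := by
      have := abs_max_sub_max_le_abs t t₀ s
      rwa [max_comm t s, max_comm t₀ s] at this
    have hd := abs_le.1 (hdiff.trans htδ.le)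
    have ht1' := abs_lt.1 ht1
    rcases le_total (max s t₀) (max s t) with h | h
    · refine hclose n s _ _ hns hsL (le_max_left _ _) (max_le hsT ?_) h (by linarith [hd.2])
      exact le_trans (by linarith) (le_max_right T (t₀ + 1))
    · rw [dist_comm]
      refine hclose n s _ _ hns hsL (le_max_left _ _) (max_le hsT ?_) h (by linarith [hd.1])
      exact le_trans (by linarith [ht1'.2]) (le_max_right T (t₀ + 1))
  · intro t
    obtain ⟨C, hC, hCin⟩ := exists_compact_containment hD hcoal hNC hICP hK T (max T t)
    refine ⟨C, hC, ?_⟩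
    rintro _ ⟨n, s, hns, hsL, rfl⟩
    rw [PathSpace.restrictIci_ext]
    exact hCin n s _ hns (hT _ hsL) ⟨_, hsL, rfl⟩ (le_max_left _ _)
      (max_le_max (hT _ hsL).2 le_rfl)

/-- A locally compact metric graph has a cell cover by stars. -/
theorem MetricGraph.exists_isCellCover [LocallyCompactSpace M] [SecondCountableTopology M]
    (G : MetricGraph M) :
    ∃ (D : ℕ → Set M) (R₁ R₂ : ℕ → M → ℝ), IsCellCover D R₁ R₂ ∧ ∀ m c,
      ∃ (η : ℝ) (ι : Type u) (_ : Finite ι) (A : ι → Set M), IsStar c η A ∧ R₂ m c < η ∧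
        Metric.ball c η ∩ G.V ⊆ {c} := by
  have hpos : ∀ m : ℕ, 0 < 1 / ((m : ℝ) + 1) := fun m => by positivity
  choose η hη ι hι A hA hV using fun (m : ℕ) (c : M) => G.exists_isStar c (hpos m)
  have hη0 : ∀ m c, 0 < η m c := fun m c => (hA m c).pos
  choose D hDc hD using fun m : ℕ => TopologicalSpace.countable_cover_nhds
    (f := fun c : M => Metric.ball c (η m c / 4))
    fun c => Metric.ball_mem_nhds c (by linarith [hη0 m c])
  refine ⟨D, fun m c => η m c / 4, fun m c => η m c / 2, ⟨hDc, fun m c => ?_, fun m c => ?_,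
    fun m c => ?_, fun m c => ?_, hD⟩, fun m c => ⟨η m c, ι m c, hι m c, A m c, hA m c, ?_, hV m c⟩⟩
  · linarith [hη0 m c]
  · linarith [hη0 m c]
  · linarith [hη0 m c, hη m c]
  · exact (hA m c).compact.of_isClosed_subset Metric.isClosed_closedBall
      (Metric.closedBall_subset_closedBall (by linarith [hη0 m c]))
  · linarith [hη0 m c]

end Deterministic

/-! ### Almost surely, shells are not crossed quickly. -/

section AlmostSure

variable {M : Type u} [MetricSpace M] [LocallyCompactSpace M] [SecondCountableTopology M]
  [MeasurableSpace M] [BorelSpace M]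
  {P : ∀ n : ℕ, ℝ≥0 → Kernel (Fin n → M) (Fin n → M)}
  {Ω : Type v} [mΩ : MeasurableSpace Ω] {μ : Measure Ω} [IsProbabilityMeasure μ]
  {ψ : ℝ → ℝ → Ω → MeasurableMap M} {s : ℕ → ℝ} {x : ℕ → M} {Φ : ℕ → Ω → PathSpace M}

/-- Barriers are placed around the midpoint of the shell in each leg; as there are finitely many
legs, their minimal lifetimes have a common positive lower bound. -/
theorem ae_noCrossing (hP : IsConsistentCoalescing P) (hcont : HasSmallJumps (P 1))
    (hψ : IsStochasticFlow μ P ψ) (hD : DenseRange fun n => (s n, x n))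
    (hΦ : ∀ n, IsContinuousModification μ ψ (s n) (x n) (Φ n)) {c : M} {η : ℝ} {ι : Type u}
    [Finite ι] {A : ι → Set M} (hA : IsStar c η A) {r₁ r₂ : ℝ} (hr₁ : 0 < r₁) (hr : r₁ < r₂)
    (hr₂ : r₂ < η) (T : ℕ) : ∀ᵐ ω ∂μ, NoCrossing (fun n => Φ n ω) c r₁ r₂ T := by
  choose b hbA hb using fun i => hA.exists_dist i ((r₁ + r₂) / 2) (by linarith) (by linarith)
  have hdc : Continuous fun y : M => dist c y := by fun_prop
  -- The horizon is enlarged to `T + 1` because barriers require a positive horizon and `T` may be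
  -- `0`.
  have hbar : ∀ᵐ ω ∂μ, ∀ i, ∃ δ > 0, ∀ t ∈ Icc (-((T : ℝ) + 1)) (T + 1), ∃ n, s n ≤ t ∧
      ∀ t' ∈ Icc t (t + δ), (Φ n ω).ext t' ∈ A i ∩ {y | r₁ < dist c y ∧ dist c y < r₂} := by
    refine ae_all_iff.2 fun i => ae_exists_barrier hP hcont hψ hD hΦ (b := b i) ?_ (by positivity)
    refine ((hA.isOpen i).inter ((isOpen_lt continuous_const hdc).inter
      (isOpen_lt hdc continuous_const))).mem_nhds ⟨hbA i, ?_, ?_⟩ <;>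
    · simp only [mem_ofPred_eq, hb]
      linarith
  filter_upwards [hbar, ae_coalescence hP hψ hΦ] with ω hω hco
  choose δ hδ hδb using hω
  obtain ⟨δ₀, hδ₀, hle⟩ : ∃ δ₀ > 0, ∀ i, δ₀ ≤ δ i := by
    have hev : ∀ᶠ δ₀ : ℝ in 𝓝[>] 0, ∀ i, δ₀ ≤ δ i :=
      eventually_all.2 fun i => nhdsWithin_le_nhds (eventually_le_nhds (hδ i))
    have hpos : ∀ᶠ δ : ℝ in 𝓝[>] 0, 0 < δ := self_mem_nhdsWithin
    exact (hpos.and hev).exists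
  refine ⟨δ₀, hδ₀, fun n t₁ t₂ h1 h2 h3 h4 => ?_⟩
  rw [(hΦ n).start_eq] at h1
  refine hA.not_cross (Φ n ω).ext.continuous hr₁ hr hr₂ (a := t₁) (b := t₁ + δ₀) (fun i => ?_)
    le_rfl h3 h4
  obtain ⟨k, hk, hkI⟩ := hδb i t₁ ⟨by linarith [h2.1], by linarith [h2.2]⟩
  refine ⟨(Φ k ω).ext, (Φ k ω).ext.continuous, fun t ht => ?_, fun t ht heq t' ht' => ?_⟩
  · exact hkI t ⟨ht.1, ht.2.trans (by linarith [hle i])⟩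
  · exact hco t n k (h1.trans ht.1) (hk.trans ht.1) heq t' ht'.1

end AlmostSure


/-! ### Path spaces as standard Borel spaces. -/

section PolishPaths

/-- A locally compact separable metric space is Polish. -/
theorem polishSpace_of_locallyCompact {E : Type u} [MetricSpace E] [LocallyCompactSpace E]
    [SecondCountableTopology E] : PolishSpace E := by
  set i : E → UniformSpace.Completion E := fun y => (y : UniformSpace.Completion E) with hi
  have hiso : Isometry i := UniformSpace.Completion.coe_isometry
  have hopen : IsOpen (range i) := by
    rw [Metric.isOpen_iff]
    rintro _ ⟨c, rfl⟩
    obtain ⟨K, hKc, hK⟩ := exists_compact_mem_nhds c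
    obtain ⟨r, hr, hrK⟩ := Metric.mem_nhds_iff.1 hK
    refine ⟨r, hr, fun z hz => ?_⟩
    -- Near `i c`, points of the completion are limits of points of the compact set `i '' K`, hence
    -- lie in it. So the space is open in its completion.
    have hcl : z ∈ closure (i '' K) := by
      rw [mem_closure_iff_nhds]
      intro U hU
      obtain ⟨y, hy⟩ := UniformSpace.Completion.denseRange_coe.exists_mem_open
        (isOpen_interior.inter Metric.isOpen_ball)
        ⟨z, mem_interior_iff_mem_nhds.2 hU, hz⟩
      refine ⟨i y, interior_subset hy.1, mem_image_of_mem _ (hrK ?_)⟩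
      have h2 := hy.2
      rwa [Metric.mem_ball, ← hiso.dist_eq]
    rw [(hKc.image hiso.continuous).isClosed.closure_eq] at hcl
    exact image_subset_range _ _ hcl
  have : SecondCountableTopology (UniformSpace.Completion E) :=
    UniformSpace.secondCountable_of_separable _
  have : PolishSpace (range i) := hopen.polishSpace
  exact hiso.isEmbedding.toHomeomorph.isClosedEmbedding.polishSpace

theorem polishSpace_continuousMap (E : Type u) [TopologicalSpace E] [PolishSpace E] :
    PolishSpace C(ℝ≥0, E) := by
  let := TopologicalSpace.upgradeIsCompletelyMetrizable E
  infer_instance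

theorem measurable_eval_path {E : Type u} [TopologicalSpace E] [MeasurableSpace E] (r : ℝ≥0) :
    Measurable fun w : C(ℝ≥0, E) => w r := by
  have h : Measurable fun (w : C(ℝ≥0, E)) (t : ℝ≥0) => w t := comap_measurable _
  exact (measurable_pi_apply r).comp h

theorem comap_pi_le_borel {X Y ι : Type*} [TopologicalSpace X] [TopologicalSpace Y]
    [MeasurableSpace Y] [BorelSpace Y] {f : X → ι → Y} (hf : ∀ i, Continuous fun x => f x i) :
    MeasurableSpace.comap f MeasurableSpace.pi ≤ borel X := by
  borelize X
  exact (measurable_pi_lambda f fun i => (hf i).measurable).comap_le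

/-- This is the Lusin–Souslin theorem. -/
theorem measurableSet_image_of_borel {X Y : Type*} [TopologicalSpace X] [PolishSpace X]
    [TopologicalSpace Y] [T2Space Y] [MeasurableSpace Y] [BorelSpace Y] {f : X → Y}
    (hf : Continuous f) (hinj : Function.Injective f) {A : Set X} (hA : MeasurableSet[borel X] A) :
    MeasurableSet (f '' A) := by
  borelize X
  exact (hf.measurableEmbedding hinj).measurableSet_image' hA

/-- The coordinate `σ`-field on the path space is the Borel `σ`-field of a Polish topology. -/
theorem borelSpace_continuousMap (E : Type u) [TopologicalSpace E] [PolishSpace E]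
    [MeasurableSpace E] [BorelSpace E] : BorelSpace C(ℝ≥0, E) := by
  have := polishSpace_continuousMap E
  refine ⟨le_antisymm ?_ ?_⟩
  · exact comap_pi_le_borel fun t => continuous_eval_const t
  -- Evaluation along a dense sequence of times is continuous and injective, so a Borel set of paths
  -- is the preimage of its Borel image under a map measurable for the coordinate `σ`-field.
  · set Ψ : C(ℝ≥0, E) → ℕ → E := fun w n => w (TopologicalSpace.denseSeq ℝ≥0 n) with hΨ
    have hc : Continuous Ψ := continuous_pi fun n => continuous_eval_const _
    have hinj : Function.Injective Ψ := by
      intro w w' h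
      refine DFunLike.coe_injective ((TopologicalSpace.denseRange_denseSeq ℝ≥0).equalizer
        w.continuous w'.continuous ?_)
      exact h
    have hΨm : Measurable Ψ := measurable_pi_lambda _ fun n => measurable_eval_path _
    intro A hA
    have h1 : MeasurableSet (Ψ '' A) := measurableSet_image_of_borel hc hinj hA
    have h2 := hΨm h1
    rwa [preimage_image_eq _ hinj] at h2

theorem standardBorelSpace_continuousMap (E : Type u) [TopologicalSpace E] [PolishSpace E]
    [MeasurableSpace E] [BorelSpace E] : StandardBorelSpace C(ℝ≥0, E) := by
  have := polishSpace_continuousMap E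
  have := borelSpace_continuousMap E
  infer_instance

end PolishPaths

/-! ### Disintegration of Markov laws over the starting point. -/

/-- A countably generated `σ`-field has a countable generating `π`-system containing the whole
space. -/
theorem exists_countable_piSystem (α : Type u) [m : MeasurableSpace α]
    [MeasurableSpace.CountablyGenerated α] :
    ∃ C : Set (Set α), C.Countable ∧ IsPiSystem C ∧ m = MeasurableSpace.generateFrom C ∧
      univ ∈ C := by
  obtain ⟨b, hb, rfl⟩ := MeasurableSpace.CountablyGenerated.isCountablyGenerated (α := α)
  refine ⟨(fun F => ⋂₀ F) '' {F | F.Finite ∧ F ⊆ b}, (countable_ofPred_finite_subset hb).image _,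
    ?_, ?_, ∅, ⟨finite_empty, empty_subset _⟩, sInter_empty⟩
  · rintro _ ⟨F, hF, rfl⟩ _ ⟨F', hF', rfl⟩ -
    exact ⟨F ∪ F', ⟨hF.1.union hF'.1, union_subset hF.2 hF'.2⟩, sInter_union F F'⟩
  · apply le_antisymm
    · refine MeasurableSpace.generateFrom_le fun A hA => MeasurableSpace.measurableSet_generateFrom ?_
      exact ⟨{A}, ⟨finite_singleton A, singleton_subset_iff.2 hA⟩, sInter_singleton A⟩
    · refine MeasurableSpace.generateFrom_le ?_
      rintro _ ⟨F, hF, rfl⟩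
      refine @MeasurableSet.sInter _ (MeasurableSpace.generateFrom b) _ hF.1.countable
        fun A hA => ?_
      exact MeasurableSpace.measurableSet_generateFrom (hF.2 hA)

section Disintegration

variable {E : Type u} [MetricSpace E] [LocallyCompactSpace E] [SecondCountableTopology E]
  [MeasurableSpace E] [BorelSpace E] {P : ℝ≥0 → Kernel E E}

/-- The `σ`-field generated by the coordinates at rational times up to `s`. -/
@[reducible]
def rationalPast (E : Type u) [TopologicalSpace E] [MeasurableSpace E] (s : ℝ≥0) :
    MeasurableSpace C(ℝ≥0, E) :=
  MeasurableSpace.comap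
    (fun (w : C(ℝ≥0, E)) (p : {p : ℚ // Real.toNNReal p ≤ s}) => w (Real.toNNReal p.1))
    MeasurableSpace.pi

theorem canonicalPast_le (E : Type u) [TopologicalSpace E] [MeasurableSpace E] (s : ℝ≥0) :
    canonicalPast (E := E) s ≤ inferInstanceAs (MeasurableSpace C(ℝ≥0, E)) :=
  iSup_le fun r => (measurable_eval_path (E := E) r.1).comap_le

theorem measurable_canonicalPast {E : Type u} [TopologicalSpace E] [MeasurableSpace E]
    {r s : ℝ≥0} (h : r ≤ s) : Measurable[canonicalPast s] fun w : C(ℝ≥0, E) => w r :=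
  Measurable.of_comap_le (le_iSup (fun r : Set.Iic s =>
    MeasurableSpace.comap (fun w : C(ℝ≥0, E) => w r) inferInstance) ⟨r, h⟩)

theorem rationalPast_le_canonicalPast (s : ℝ≥0) : rationalPast E s ≤ canonicalPast s :=
  Measurable.comap_le (@measurable_pi_lambda _ _ _ (_) _ _ fun p => measurable_canonicalPast p.2)

theorem rationalPast_le (s : ℝ≥0) :
    rationalPast E s ≤ inferInstanceAs (MeasurableSpace C(ℝ≥0, E)) :=
  (rationalPast_le_canonicalPast s).trans (canonicalPast_le E s)

/-- Nonnegative reals are limits of rationals from above. -/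
theorem exists_rat_seq (r : ℝ≥0) :
    ∃ p : ℕ → ℚ, (∀ n, r < Real.toNNReal (p n)) ∧
      Tendsto (fun n => Real.toNNReal (p n)) atTop (𝓝 r) := by
  have h : ∀ n : ℕ, ∃ p : ℚ, (r : ℝ) < p ∧ (p : ℝ) < r + 1 / ((n : ℝ) + 1) := fun n =>
    exists_rat_btwn (by linarith [Nat.one_div_pos_of_nat (α := ℝ) (n := n)])
  choose p hp hp' using h
  refine ⟨p, fun n => Real.lt_toNNReal_iff_coe_lt.2 (hp n), ?_⟩
  have h1 : Tendsto (fun n : ℕ => (r : ℝ) + 1 / ((n : ℝ) + 1)) atTop (𝓝 r) := by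
    simpa using (tendsto_const_nhds (x := (r : ℝ))).add tendsto_one_div_add_atTop_nhds_zero_nat
  have h2 : Tendsto (fun n => (p n : ℝ)) atTop (𝓝 r) :=
    tendsto_of_tendsto_of_tendsto_of_le_of_le tendsto_const_nhds h1 (fun n => (hp n).le)
      fun n => (hp' n).le
  have h3 := (continuous_real_toNNReal.tendsto (r : ℝ)).comp h2
  rwa [Real.toNNReal_coe] at h3

/-- Coordinates are limits along rational times from the right, which explains the strict
inequality. The rational past is countably generated, so the Markov property can be tested on
countably many events. -/
theorem canonicalPast_le_rationalPast {s s' : ℝ≥0} (h : s < s') :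
    canonicalPast s ≤ rationalPast E s' := by
  refine iSup_le fun r => Measurable.comap_le ?_
  obtain ⟨p, hp, hpt⟩ := exists_rat_seq r.1
  have hev : ∀ᶠ n in atTop, Real.toNNReal (p n) ≤ s' :=
    hpt.eventually (eventually_le_nhds (lt_of_le_of_lt r.2 h))
  obtain ⟨N, hN⟩ := eventually_atTop.1 hev
  refine @measurable_of_tendsto_metrizable _ _ (rationalPast E s') _ _ _ _
    (fun (n : ℕ) (w : C(ℝ≥0, E)) => w (Real.toNNReal (p (n + N)))) _ (fun n => ?_) ?_
  · have h1 : Measurable[rationalPast E s'] (fun (w : C(ℝ≥0, E))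
        (p : {p : ℚ // Real.toNNReal p ≤ s'}) => w (Real.toNNReal p.1)) := comap_measurable _
    exact (measurable_pi_apply (⟨p (n + N), hN _ (Nat.le_add_left _ _)⟩ :
      {p : ℚ // Real.toNNReal p ≤ s'})).comp h1
  · rw [tendsto_pi_nhds]
    intro w
    exact (w.continuous.tendsto _).comp ((tendsto_add_atTop_iff_nat N).2 hpt)

/-- The Markov property at times `s`, `s + t`, on the event `A`, for test functions. -/
theorem setIntegral_eq_of_markov (hP : ∀ t, IsMarkovKernel (P t)) {Q : Measure C(ℝ≥0, E)}
    [IsFiniteMeasure Q] {s t : ℝ≥0} {A : Set C(ℝ≥0, E)}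
    (h : ∀ B, MeasurableSet B → Q (A ∩ {w | w (s + t) ∈ B}) = ∫⁻ w in A, P t (w s) B ∂Q)
    (f : ZeroAtInftyContinuousMap E ℝ) :
    ∫ w in A, f (w (s + t)) ∂Q = ∫ w in A, ∫ y, f y ∂(P t (w s)) ∂Q := by
  have hm1 := measurable_eval_path (E := E) (s + t)
  have hm2 := measurable_eval_path (E := E) s
  have := hP t
  have hf : StronglyMeasurable f := f.continuous.stronglyMeasurable
  have key : (Q.restrict A).map (fun w => w (s + t))
      = (P t ∘ₖ Kernel.const Unit ((Q.restrict A).map fun w => w s)) () := by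
    ext B hB
    rw [Measure.map_apply hm1 hB, Measure.restrict_apply (hm1 hB), inter_comm, Kernel.comp_apply,
      Measure.bind_apply hB (P t).measurable.aemeasurable, Kernel.const_apply,
      lintegral_map ((P t).measurable_coe hB) hm2]
    exact h B hB
  have h1 : ∫ y, f y ∂((Q.restrict A).map fun w => w (s + t)) = ∫ w in A, f (w (s + t)) ∂Q :=
    integral_map hm1.aemeasurable hf.aestronglyMeasurable
  rw [← h1, key, Kernel.integral_comp, Kernel.const_apply]
  · exact integral_map hm2.aemeasurable hf.integral_kernel.aestronglyMeasurable
  · exact zeroAtInfty_integrable f _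

/-- Integrals of functions vanishing at infinity determine finite measures; in this form the Markov
property is stable under limits in time. -/
theorem markov_of_setIntegral_eq (hP : ∀ t, IsMarkovKernel (P t)) {Q : Measure C(ℝ≥0, E)}
    [IsFiniteMeasure Q] {s t : ℝ≥0} {A : Set C(ℝ≥0, E)}
    (h : ∀ f : ZeroAtInftyContinuousMap E ℝ,
      ∫ w in A, f (w (s + t)) ∂Q = ∫ w in A, ∫ y, f y ∂(P t (w s)) ∂Q)
    {B : Set E} (hB : MeasurableSet B) :
    Q (A ∩ {w | w (s + t) ∈ B}) = ∫⁻ w in A, P t (w s) B ∂Q := by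
  have hm1 := measurable_eval_path (E := E) (s + t)
  have hm2 := measurable_eval_path (E := E) s
  have := hP t
  have key : (Q.restrict A).map (fun w => w (s + t))
      = (P t ∘ₖ Kernel.const Unit ((Q.restrict A).map fun w => w s)) () := by
    refine measure_ext_of_zeroAtInfty fun f => ?_
    have hf : StronglyMeasurable f := f.continuous.stronglyMeasurable
    rw [Kernel.integral_comp, Kernel.const_apply]
    · have h1 : ∫ y, f y ∂((Q.restrict A).map fun w => w (s + t)) = ∫ w in A, f (w (s + t)) ∂Q :=
        integral_map hm1.aemeasurable hf.aestronglyMeasurable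
      have h2 : ∫ z, ∫ y, f y ∂(P t z) ∂((Q.restrict A).map fun w => w s)
          = ∫ w in A, ∫ y, f y ∂(P t (w s)) ∂Q :=
        integral_map hm2.aemeasurable hf.integral_kernel.aestronglyMeasurable
      rw [h1, h2, h f]
    · exact zeroAtInfty_integrable f _
  have h3 := congrArg (fun m => m B) key
  rw [Measure.map_apply hm1 hB, Measure.restrict_apply (hm1 hB), inter_comm, Kernel.comp_apply,
    Measure.bind_apply hB (P t).measurable.aemeasurable, Kernel.const_apply,
    lintegral_map ((P t).measurable_coe hB) hm2] at h3
  exact h3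

/-- The Markov property extends from rational to all times, by the Feller property. -/
theorem markov_of_rational (hP : IsFellerTransition P) {Q : Measure C(ℝ≥0, E)}
    [IsFiniteMeasure Q]
    (h : ∀ p q : ℚ, ∀ A, MeasurableSet[rationalPast E (Real.toNNReal p)] A →
      ∀ B, MeasurableSet B → Q (A ∩ {w | w (Real.toNNReal p + Real.toNNReal q) ∈ B})
        = ∫⁻ w in A, P (Real.toNNReal q) (w (Real.toNNReal p)) B ∂Q)
    (s t : ℝ≥0) {A : Set C(ℝ≥0, E)} (hA : MeasurableSet[canonicalPast s] A) {B : Set E}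
    (hB : MeasurableSet B) : Q (A ∩ {w | w (s + t) ∈ B}) = ∫⁻ w in A, P t (w s) B ∂Q := by
  refine markov_of_setIntegral_eq hP.markov (fun f => ?_) hB
  -- Since `s < p n`, the event `A` belongs to the rational past at `p n`. Joint continuity of the
  -- semigroup and dominated convergence then allow the limit.
  obtain ⟨p, hp, hpt⟩ := exists_rat_seq s
  obtain ⟨q, -, hqt⟩ := exists_rat_seq t
  have heq : ∀ n, ∫ w in A, f (w (Real.toNNReal (p n) + Real.toNNReal (q n))) ∂Q
      = ∫ w in A, ∫ y, f y ∂(P (Real.toNNReal (q n)) (w (Real.toNNReal (p n)))) ∂Q := fun n =>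
    setIntegral_eq_of_markov hP.markov
      (h (p n) (q n) A (canonicalPast_le_rationalPast (hp n) A hA)) f
  have hb : ∀ y, ‖f y‖ ≤ ‖f.toBCF‖ := fun y => f.toBCF.norm_coe_le_norm y
  have h1 : Tendsto (fun n => ∫ w in A, f (w (Real.toNNReal (p n) + Real.toNNReal (q n))) ∂Q) atTop
      (𝓝 (∫ w in A, f (w (s + t)) ∂Q)) := by
    refine tendsto_integral_of_dominated_convergence (fun _ => ‖f.toBCF‖) (fun n => ?_)
      (integrable_const _) (fun n => Eventually.of_forall fun w => hb _)
      (Eventually.of_forall fun w => ?_)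
    · exact (f.continuous.measurable.comp (measurable_eval_path _)).aestronglyMeasurable
    · exact ((f.continuous.comp w.continuous).tendsto _).comp (hpt.add hqt)
  have h2 : Tendsto (fun n => ∫ w in A, ∫ y, f y ∂(P (Real.toNNReal (q n))
      (w (Real.toNNReal (p n)))) ∂Q) atTop (𝓝 (∫ w in A, ∫ y, f y ∂(P t (w s)) ∂Q)) := by
    refine tendsto_integral_of_dominated_convergence (fun _ => ‖f.toBCF‖) (fun n => ?_)
      (integrable_const _) (fun n => Eventually.of_forall fun w => ?_)
      (Eventually.of_forall fun w => ?_)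
    · have hf : StronglyMeasurable f := f.continuous.stronglyMeasurable
      have := hP.markov (Real.toNNReal (q n))
      exact ((hf.integral_kernel (κ := P (Real.toNNReal (q n)))).measurable.comp
        (measurable_eval_path (Real.toNNReal (p n)))).aestronglyMeasurable
    · have := hP.markov (Real.toNNReal (q n))
      have := norm_integral_le_of_norm_le_const (μ := P (Real.toNNReal (q n))
        (w (Real.toNNReal (p n)))) (f := fun y => f y) (Eventually.of_forall hb)
      simpa using this
    · have hc := (hP.continuous_integral f).tendsto (t, w s)
      exact hc.comp (hqt.prodMk_nhds ((w.continuous.tendsto s).comp hpt))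
  exact tendsto_nhds_unique h1 (h2.congr fun n => (heq n).symm)

/-- Two monotone class arguments: first in `B` for fixed `A ∈ 𝒜`, then in `A` for fixed `B`,
comparing measures trimmed to the rational past. -/
theorem rational_of_piSystem (hP : ∀ t, IsMarkovKernel (P t)) {Q : Measure C(ℝ≥0, E)}
    [IsProbabilityMeasure Q] {s t : ℝ≥0} {𝒜 : Set (Set C(ℝ≥0, E))} {ℬ : Set (Set E)}
    (h𝒜 : IsPiSystem 𝒜) (h𝒜g : rationalPast E s = MeasurableSpace.generateFrom 𝒜)
    (h𝒜u : univ ∈ 𝒜) (hℬ : IsPiSystem ℬ)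
    (hℬg : ‹MeasurableSpace E› = MeasurableSpace.generateFrom ℬ) (hℬu : univ ∈ ℬ)
    (h : ∀ A ∈ 𝒜, ∀ B ∈ ℬ, Q (A ∩ {w | w (s + t) ∈ B}) = ∫⁻ w in A, P t (w s) B ∂Q)
    {A : Set C(ℝ≥0, E)} (hA : MeasurableSet[rationalPast E s] A) {B : Set E}
    (hB : MeasurableSet B) : Q (A ∩ {w | w (s + t) ∈ B}) = ∫⁻ w in A, P t (w s) B ∂Q := by
  have hm1 := measurable_eval_path (E := E) (s + t)
  have hm2 := measurable_eval_path (E := E) s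
  have := hP t
  have h𝒜m : ∀ A ∈ 𝒜, MeasurableSet[rationalPast E s] A := fun A hA => by
    rw [h𝒜g]; exact MeasurableSpace.measurableSet_generateFrom hA
  have hgen : ∀ A ∈ 𝒜, Q (A ∩ {w | w (s + t) ∈ B}) = ∫⁻ w in A, P t (w s) B ∂Q := by
    intro A hA
    have key : (Q.restrict A).map (fun w => w (s + t))
        = ((Q.restrict A).map fun w => w s).bind (P t) := by
      have hB' : ∀ B ∈ ℬ, (Q.restrict A).map (fun w => w (s + t)) B
          = ((Q.restrict A).map fun w => w s).bind (P t) B := by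
        intro B hB
        have hBm : MeasurableSet B := by
          rw [hℬg]; exact MeasurableSpace.measurableSet_generateFrom hB
        rw [Measure.map_apply hm1 hBm, Measure.restrict_apply (hm1 hBm), inter_comm,
          Measure.bind_apply hBm (P t).measurable.aemeasurable,
          lintegral_map ((P t).measurable_coe hBm) hm2]
        exact h A hA B hB
      exact ext_of_generate_finite ℬ hℬg hℬ hB' (hB' univ hℬu)
    have h3 := congrArg (fun m => m B) key
    rw [Measure.map_apply hm1 hB, Measure.restrict_apply (hm1 hB), inter_comm,
      Measure.bind_apply hB (P t).measurable.aemeasurable,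
      lintegral_map ((P t).measurable_coe hB) hm2] at h3
    exact h3
  have hle := rationalPast_le (E := E) s
  have hPm : Measurable fun w : C(ℝ≥0, E) => P t (w s) B := ((P t).measurable_coe hB).comp hm2
  have hfin : IsFiniteMeasure (Q.withDensity fun w => P t (w s) B) := by
    refine isFiniteMeasure_withDensity (ne_of_lt ?_)
    calc ∫⁻ w, P t (w s) B ∂Q ≤ ∫⁻ w, 1 ∂Q := lintegral_mono fun w => prob_le_one
      _ < ∞ := by simp
  have hval1 : ∀ A, MeasurableSet[rationalPast E s] A →
      (Q.restrict {w | w (s + t) ∈ B}).trim hle A = Q (A ∩ {w | w (s + t) ∈ B}) := by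
    intro A hA
    rw [trim_measurableSet_eq hle hA, Measure.restrict_apply (hle A hA)]
  have hval2 : ∀ A, MeasurableSet[rationalPast E s] A →
      (Q.withDensity fun w => P t (w s) B).trim hle A = ∫⁻ w in A, P t (w s) B ∂Q := by
    intro A hA
    rw [trim_measurableSet_eq hle hA, withDensity_apply _ (hle A hA)]
  have key : (Q.restrict {w | w (s + t) ∈ B}).trim hle
      = (Q.withDensity fun w => P t (w s) B).trim hle := by
    have : ∀ A ∈ 𝒜, (Q.restrict {w | w (s + t) ∈ B}).trim hle A
        = (Q.withDensity fun w => P t (w s) B).trim hle A := fun A hA => by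
      rw [hval1 A (h𝒜m A hA), hval2 A (h𝒜m A hA), hgen A hA]
    exact @ext_of_generate_finite _ (rationalPast E s) _ _ (𝒜) h𝒜g h𝒜 _ this (this univ h𝒜u)
  rw [← hval1 A hA, key, hval2 A hA]

/-- Disintegration of the law of a Markov process with continuous paths with respect to its
starting point: almost all conditional laws are Markov laws. -/
theorem exists_kernel_isMarkovLaw [Nonempty E] (hP : IsFellerTransition P)
    (ρ : Measure C(ℝ≥0, E)) [IsFiniteMeasure ρ]
    (hρ : ∀ (s t : ℝ≥0) (A : Set C(ℝ≥0, E)) (B : Set E), MeasurableSet[canonicalPast s] A →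
      MeasurableSet B → ρ (A ∩ {w | w (s + t) ∈ B}) = ∫⁻ w in A, P t (w s) B ∂ρ) :
    ∃ κ : Kernel E C(ℝ≥0, E), IsMarkovKernel κ ∧
      (∀ S, MeasurableSet S → ρ S = ∫⁻ w, κ (w 0) S ∂ρ) ∧
      ∀ᵐ w ∂ρ, IsMarkovLaw P (w 0) (κ (w 0)) := by
  have : PolishSpace E := polishSpace_of_locallyCompact
  have := standardBorelSpace_continuousMap E
  have : Nonempty C(ℝ≥0, E) := ⟨ContinuousMap.const _ (Classical.arbitrary E)⟩
  have hm0 := measurable_eval_path (E := E) 0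
  have hpair : Measurable fun w : C(ℝ≥0, E) => (w 0, w) := hm0.prodMk measurable_id
  set ρ' : Measure (E × C(ℝ≥0, E)) := ρ.map fun w => (w 0, w) with hρ'
  set κ := ρ'.condKernel with hκ
  set ν := ρ.map fun w => w 0 with hν
  have hfst : ρ'.fst = ν := by
    exact Measure.fst_map_prodMk (X := fun w : C(ℝ≥0, E) => w 0) (Y := fun w => w) measurable_id
  have hdis : ν ⊗ₘ κ = ρ' := by rw [← hfst]; exact ρ'.disintegrate κ
  have hprod : ∀ (C : Set E) (S : Set C(ℝ≥0, E)), MeasurableSet C → MeasurableSet S →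
      ∫⁻ z in C, κ z S ∂ν = ρ ((fun w => w 0) ⁻¹' C ∩ S) := by
    intro C S hC hS
    rw [← Measure.compProd_apply_prod hC hS, hdis, hρ', Measure.map_apply hpair (hC.prod hS)]
    rfl
  have hint : ∀ (C : Set E) (S : Set C(ℝ≥0, E)) (g : C(ℝ≥0, E) → ℝ≥0∞), MeasurableSet C →
      MeasurableSet S → Measurable g →
      ∫⁻ z in C, ∫⁻ w in S, g w ∂(κ z) ∂ν = ∫⁻ w in (fun w => w 0) ⁻¹' C ∩ S, g w ∂ρ := by
    intro C S g hC hS hg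
    have h1 := Measure.setLIntegral_compProd (μ := ν) (κ := κ) (f := fun p => g p.2)
      (hg.comp measurable_snd) hC hS
    rw [← h1, hdis, hρ', setLIntegral_map (f := fun p : E × C(ℝ≥0, E) => g p.2) (hC.prod hS)
      (hg.comp measurable_snd) hpair]
    rfl
  -- With countable generating systems, a single null set of starting points suffices for all Markov
  -- identities at rational times.
  obtain ⟨ℬ, hℬc, hℬ, hℬg, hℬu⟩ := exists_countable_piSystem E
  have h𝒜ex : ∀ s : ℝ≥0, ∃ 𝒜 : Set (Set C(ℝ≥0, E)), 𝒜.Countable ∧ IsPiSystem 𝒜 ∧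
      rationalPast E s = MeasurableSpace.generateFrom 𝒜 ∧ univ ∈ 𝒜 := fun s =>
    @exists_countable_piSystem _ (rationalPast E s) (MeasurableSpace.CountablyGenerated.comap _)
  choose 𝒜 h𝒜c h𝒜 h𝒜g h𝒜u using h𝒜ex
  have hstart : ∀ᵐ z ∂ν, ∀ᵐ w ∂(κ z), w 0 = z := by
    have h0 : ∀ᵐ p ∂(ν ⊗ₘ κ), p.2 0 = p.1 := by
      rw [hdis, hρ']
      have hmeas : MeasurableSet {p : E × C(ℝ≥0, E) | p.2 0 = p.1} :=
        measurableSet_eq_fun (hm0.comp measurable_snd) measurable_fst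
      rw [ae_map_iff hpair.aemeasurable hmeas]
      exact Eventually.of_forall fun w => rfl
    exact Measure.ae_ae_of_ae_compProd h0
  have hmarkov : ∀ᵐ z ∂ν, ∀ p q : ℚ, ∀ A ∈ 𝒜 (Real.toNNReal p), ∀ B ∈ ℬ,
      κ z (A ∩ {w | w (Real.toNNReal p + Real.toNNReal q) ∈ B})
        = ∫⁻ w in A, P (Real.toNNReal q) (w (Real.toNNReal p)) B ∂(κ z) := by
    refine ae_all_iff.2 fun p => ae_all_iff.2 fun q => (ae_ball_iff (h𝒜c _)).2 fun A hA =>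
      (ae_ball_iff hℬc).2 fun B hB => ?_
    set s := Real.toNNReal p
    set t := Real.toNNReal q
    have hAr : MeasurableSet[rationalPast E s] A := by
      rw [h𝒜g]; exact MeasurableSpace.measurableSet_generateFrom hA
    have hAc : MeasurableSet[canonicalPast s] A := rationalPast_le_canonicalPast s A hAr
    have hAm : MeasurableSet A := canonicalPast_le E s A hAc
    have hBm : MeasurableSet B := by
      rw [hℬg]; exact MeasurableSpace.measurableSet_generateFrom hB
    have hSm : MeasurableSet (A ∩ {w : C(ℝ≥0, E) | w (s + t) ∈ B}) :=
      hAm.inter (measurable_eval_path (s + t) hBm)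
    have hg : Measurable fun w : C(ℝ≥0, E) => P t (w s) B :=
      ((P t).measurable_coe hBm).comp (measurable_eval_path s)
    refine ae_eq_of_forall_setLIntegral_eq_of_sigmaFinite (κ.measurable_coe hSm) ?_ ?_
    · have h1 : (fun z => ∫⁻ w in A, P t (w s) B ∂(κ z))
          = fun z => ∫⁻ w, A.indicator (fun w => P t (w s) B) w ∂(κ z) := by
        funext z
        rw [lintegral_indicator hAm]
      rw [h1]
      exact (hg.indicator hAm).lintegral_kernel
    · intro C hC _
      rw [hprod C _ hC hSm, hint C A _ hC hAm hg, ← inter_assoc]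
      refine hρ s t _ B ?_ hBm
      -- Restricting the starting point to `C` leaves the event in the past of `s`, so the Markov
      -- property of `ρ` itself applies.
      exact MeasurableSet.inter (measurable_canonicalPast zero_le hC) hAc
  refine ⟨κ, inferInstance, fun S hS => ?_, ?_⟩
  · have := hprod univ S MeasurableSet.univ hS
    rw [preimage_univ, univ_inter, setLIntegral_univ, hν, lintegral_map (κ.measurable_coe hS) hm0]
      at this
    exact this.symm
  · have hall : ∀ᵐ z ∂ν, IsMarkovLaw P z (κ z) := by
      filter_upwards [hstart, hmarkov] with z h1 h2
      refine ⟨inferInstance, h1, fun s t A B hA hB => ?_⟩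
      refine markov_of_rational hP (fun p q A' hA' B' hB' => ?_) s t hA hB
      exact rational_of_piSystem hP.markov (h𝒜 _) (h𝒜g _) (h𝒜u _) hℬ hℬg hℬu
        (fun A hA B hB => h2 p q A hA B hB) hA' hB'
    exact ae_of_ae_map hm0.aemeasurable hall

end Disintegration

/-! ### Coalescence of pairs of paths -/

/-- Rational times are dense in a nondegenerate interval. The endpoint `b` is listed separately to
cover `a = b`. -/
theorem forall_Icc_mem_iff {X : Type*} [TopologicalSpace X] {f : ℝ → X} (hf : Continuous f)
    {K : Set X} (hK : IsClosed K) {a b : ℝ} (hab : a ≤ b) :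
    (∀ t ∈ Icc a b, f t ∈ K) ↔ f b ∈ K ∧ ∀ q : ℚ, (q : ℝ) ∈ Icc a b → f q ∈ K := by
  refine ⟨fun h => ⟨h b ⟨hab, le_rfl⟩, fun q hq => h q hq⟩, fun ⟨hb, hq⟩ t ht => ?_⟩
  rcases hab.eq_or_lt with rfl | hab
  · obtain rfl : t = a := by simpa using ht
    exact hb
  have h1 : Ioo a b ⊆ closure (Ioo a b ∩ range ((↑) : ℚ → ℝ)) :=
    Rat.isDenseEmbedding_coe_real.dense.open_subset_closure_inter isOpen_Ioo
  have h2 : Icc a b ⊆ closure (Ioo a b ∩ range ((↑) : ℚ → ℝ)) := by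
    rw [← closure_Ioo hab.ne]
    exact closure_minimal h1 isClosed_closure
  have h3 : closure (Ioo a b ∩ range ((↑) : ℚ → ℝ)) ⊆ f ⁻¹' K := by
    refine closure_minimal ?_ (hK.preimage hf)
    rintro _ ⟨ht, q, rfl⟩
    exact hq q (Ioo_subset_Icc_self ht)
  exact h3 (h2 ht)

theorem measurableSet_forall_Icc_mem {Ω X : Type*} {mΩ : MeasurableSpace Ω} [TopologicalSpace X]
    [MeasurableSpace X] [OpensMeasurableSpace X] {f : ℝ → Ω → X}
    (hf : ∀ ω, Continuous fun t => f t ω) {K : Set X} (hK : IsClosed K) {a b : ℝ}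
    (hm : ∀ t ∈ Icc a b, Measurable (f t)) :
    MeasurableSet {ω | ∀ t ∈ Icc a b, f t ω ∈ K} := by
  by_cases hab : a ≤ b
  · simp_rw [forall_Icc_mem_iff (hf _) hK hab]
    refine MeasurableSet.inter (hm b ⟨hab, le_rfl⟩ hK.measurableSet)
      (?_ : MeasurableSet {ω | ∀ q : ℚ, (q : ℝ) ∈ Icc a b → f q ω ∈ K})
    simp only [ofPred_forall]
    exact MeasurableSet.iInter fun q => MeasurableSet.iInter fun hq => hm q hq hK.measurableSet
  · simp [Icc_eq_empty hab]

section Pairs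

variable {M : Type u} [MetricSpace M] [LocallyCompactSpace M] [SecondCountableTopology M]
  [MeasurableSpace M] [BorelSpace M]
  {P : ∀ n : ℕ, ℝ≥0 → Kernel (Fin n → M) (Fin n → M)}
  {Ω : Type v} [mΩ : MeasurableSpace Ω] {μ : Measure Ω} [IsProbabilityMeasure μ]
  {ψ : ℝ → ℝ → Ω → MeasurableMap M} {s : ℕ → ℝ} {x : ℕ → M} {Φ : ℕ → Ω → PathSpace M}

/-- The joint path of the `i`-th and the `j`-th path after time `u`. -/
def jointPath (Φ : ℕ → Ω → PathSpace M) (i j : ℕ) (u : ℝ) (ω : Ω) : C(ℝ≥0, Fin 2 → M) where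
  toFun r k := (Φ (![i, j] k) ω).ext (u + r)
  continuous_toFun := continuous_pi fun k =>
    (Φ (![i, j] k) ω).ext.continuous.comp (continuous_const.add NNReal.continuous_coe)

theorem measurable_jointPath_eval (Φ : ℕ → Ω → PathSpace M) (i j : ℕ) (u : ℝ) {r s : ℝ≥0}
    (h : r ≤ s) : Measurable[pathFiltration Φ (u + s)] fun ω => jointPath Φ i j u ω r :=
  @measurable_pi_lambda _ _ _ (_) _ _ fun k =>
    measurable_pathFiltration Φ (![i, j] k) (by simpa using h)

theorem measurable_jointPath_past (Φ : ℕ → Ω → PathSpace M) (i j : ℕ) (u : ℝ) (s : ℝ≥0) :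
    Measurable[pathFiltration Φ (u + s), canonicalPast s] (jointPath Φ i j u) := by
  rw [measurable_iff_comap_le, MeasurableSpace.comap_iSup]
  refine iSup_le fun r => ?_
  rw [MeasurableSpace.comap_comp]
  exact (measurable_jointPath_eval Φ i j u r.2).comap_le

theorem measurable_jointPath (hΦ : ∀ n, IsContinuousModification μ ψ (s n) (x n) (Φ n)) (i j : ℕ)
    (u : ℝ) : Measurable (jointPath Φ i j u) := by
  refine measurable_comap_iff.2 (measurable_pi_lambda _ fun r => ?_)
  exact (measurable_jointPath_eval Φ i j u (le_refl r)).mono (pathFiltration_le hΦ _) le_rfl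

/-- Two paths that are close to each other leave `K` or meet within a short time, with
probability bounded from below, conditionally on the past. -/
theorem measure_not_coalesce_le (hP : IsConsistentCoalescing P) (hψ : IsStochasticFlow μ P ψ)
    (hΦ : ∀ n, IsContinuousModification μ ψ (s n) (x n) (Φ n)) {K : Set M} (hK : IsClosed K)
    {β p ε : ℝ}
    (hfast : ∀ x ∈ K, ∀ y ∈ K, dist x y ≤ ε → ∀ Q : Measure C(ℝ≥0, Fin 2 → M),
      IsMarkovLaw (P 2) ![x, y] Q →
        Q.real {w | ENNReal.ofReal (β * ε ^ 2) < min (exitTime K w) (meetingTime w)} ≤ 1 - p)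
    {i j : ℕ} {u u' : ℝ} (hi : s i ≤ u) (hj : s j ≤ u) (hu : u ≤ u') (hu' : β * ε ^ 2 < u' - u)
    (hβ : 0 ≤ β) {G : Set Ω} (hG : MeasurableSet[pathFiltration Φ u] G)
    (hGK : ∀ ω ∈ G, (Φ i ω).ext u ∈ K ∧ (Φ j ω).ext u ∈ K ∧
      dist ((Φ i ω).ext u) ((Φ j ω).ext u) ≤ ε) :
    μ (G ∩ {ω | ∀ t ∈ Icc u u', (Φ i ω).ext t ∈ K ∧ (Φ j ω).ext t ∈ K ∧
      (Φ i ω).ext t ≠ (Φ j ω).ext t}) ≤ ENNReal.ofReal (1 - p) * μ G := by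
  set Γ := jointPath Φ i j u with hΓ
  have hΓm : Measurable Γ := measurable_jointPath hΦ i j u
  have hG' : MeasurableSet G := pathFiltration_le hΦ u G hG
  -- Restriction to an event of the past preserves the Markov property after `u`, though the
  -- starting point stays random and `ρ` need not have mass `1`.
  set ρ := (μ.restrict G).map Γ with hρ
  have : Nonempty (Fin 2 → M) := ⟨fun _ => x 0⟩
  have hZ := isMarkovFrom_paths hP hψ hΦ ![i, j] (u := u) (by
    intro k; fin_cases k <;> simpa)
  have hmarkov : ∀ (r t : ℝ≥0) (A : Set C(ℝ≥0, Fin 2 → M)) (B : Set (Fin 2 → M)),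
      MeasurableSet[canonicalPast r] A → MeasurableSet B →
      ρ (A ∩ {w | w (r + t) ∈ B}) = ∫⁻ w in A, P 2 t (w r) B ∂ρ := by
    intro r t A B hA hB
    have hA' : MeasurableSet A := canonicalPast_le _ r A hA
    have hAB : MeasurableSet (A ∩ {w : C(ℝ≥0, Fin 2 → M) | w (r + t) ∈ B}) :=
      hA'.inter (measurable_eval_path (r + t) hB)
    have hmeas : MeasurableSet[pathFiltration Φ (u + r)] (Γ ⁻¹' A ∩ G) :=
      MeasurableSet.inter (measurable_jointPath_past Φ i j u r hA)
        (pathFiltration_mono Φ (by simp) G hG)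
    have h1 := hZ.markov (u + r) (by simp) t _ B hmeas hB
    rw [hρ, Measure.map_apply hΓm hAB, Measure.restrict_apply (hΓm hAB),
      setLIntegral_map (f := fun w : C(ℝ≥0, Fin 2 → M) => P 2 t (w r) B) hA'
        (((P 2 t).measurable_coe hB).comp (measurable_eval_path r)) hΓm,
      Measure.restrict_restrict (hΓm hA')]
    refine Eq.trans (congrArg μ ?_) h1
    ext ω
    simp only [hΓ, jointPath, mem_inter_iff, mem_preimage, mem_ofPred_eq, ContinuousMap.coe_mk,
      NNReal.coe_add, add_assoc]
    tauto
  obtain ⟨κ, hκ, hκρ, hκP⟩ := exists_kernel_isMarkovLaw (hP.feller 2) ρ hmarkov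
  -- Staying apart during a compact interval means keeping a distance at least `1 / (n + 1)` for
  -- some `n`. This makes the bad event a countable union of measurable sets, so measurability of
  -- the exit and meeting times is not needed.
  set K' : ℕ → Set (Fin 2 → M) := fun n => {z | z 0 ∈ K ∧ z 1 ∈ K ∧ 1 / ((n : ℝ) + 1) ≤
    dist (z 0) (z 1)} with hK'
  have hK'c : ∀ n, IsClosed (K' n) := fun n =>
    (hK.preimage (continuous_apply 0)).inter ((hK.preimage (continuous_apply 1)).inter
      (isClosed_le continuous_const ((continuous_apply 0).dist (continuous_apply 1))))
  set bad : Set C(ℝ≥0, Fin 2 → M) := ⋃ n : ℕ,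
    {w | ∀ t ∈ Icc 0 (u' - u), w (Real.toNNReal t) ∈ K' n} with hbad
  have hbadm : MeasurableSet bad := MeasurableSet.iUnion fun n =>
    measurableSet_forall_Icc_mem (f := fun t (w : C(ℝ≥0, Fin 2 → M)) => w (Real.toNNReal t))
      (fun w => w.continuous.comp continuous_real_toNNReal) (hK'c n)
      fun t _ => measurable_eval_path _
  have hsub : bad ⊆ {w | ENNReal.ofReal (β * ε ^ 2) < min (exitTime K w) (meetingTime w)} := by
    intro w hw
    obtain ⟨n, hn⟩ := mem_iUnion.1 hw
    have hn' : ∀ t : ℝ≥0, (t : ℝ) ≤ u' - u → w t ∈ K' n := fun t ht => by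
      have := hn t ⟨t.2, ht⟩
      rwa [Real.toNNReal_coe] at this
    have hlt : ENNReal.ofReal (β * ε ^ 2) < ENNReal.ofReal (u' - u) :=
      (ENNReal.ofReal_lt_ofReal_iff_of_nonneg (by positivity)).2 hu'
    have hle : ∀ t : ℝ≥0, ¬ (t : ℝ) ≤ u' - u → ENNReal.ofReal (u' - u) ≤ t := fun t ht => by
      rw [← ENNReal.ofReal_coe_nnreal]
      exact ENNReal.ofReal_le_ofReal (not_le.1 ht).le
    refine hlt.trans_le (le_min (le_iInf₂ fun t ht => hle t fun h => ?_)
      (le_iInf₂ fun t ht => hle t fun h => ?_))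
    · exact ht ⟨(hn' t h).1, (hn' t h).2.1⟩
    · have := (hn' t h).2.2
      rw [ht, dist_self] at this
      exact absurd this (not_le.2 Nat.one_div_pos_of_nat)
  have hfail : G ∩ {ω | ∀ t ∈ Icc u u', (Φ i ω).ext t ∈ K ∧ (Φ j ω).ext t ∈ K ∧
      (Φ i ω).ext t ≠ (Φ j ω).ext t} ⊆ Γ ⁻¹' bad ∩ G := by
    rintro ω ⟨hωG, hω⟩
    refine ⟨?_, hωG⟩
    obtain ⟨t₀, ht₀, hmin⟩ := isCompact_Icc.exists_isMinOn (nonempty_Icc.2 hu)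
      (((Φ i ω).ext.continuous.dist (Φ j ω).ext.continuous).continuousOn (s := Icc u u'))
    obtain ⟨n, hn⟩ := exists_nat_one_div_lt (dist_pos.2 (hω t₀ ht₀).2.2)
    refine mem_iUnion.2 ⟨n, fun t ht => ?_⟩
    have hmem : u + (Real.toNNReal t : ℝ) ∈ Icc u u' := by
      rw [Real.coe_toNNReal t ht.1]
      exact ⟨by linarith [ht.1], by linarith [ht.2]⟩
    exact ⟨(hω _ hmem).1, (hω _ hmem).2.1, hn.le.trans (hmin hmem)⟩
  have hstart : ∀ᵐ w ∂ρ, w 0 0 ∈ K ∧ w 0 1 ∈ K ∧ dist (w 0 0) (w 0 1) ≤ ε := by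
    have hcl : IsClosed {z : Fin 2 → M | z 0 ∈ K ∧ z 1 ∈ K ∧ dist (z 0) (z 1) ≤ ε} :=
      (hK.preimage (continuous_apply 0)).inter ((hK.preimage (continuous_apply 1)).inter
        (isClosed_le ((continuous_apply 0).dist (continuous_apply 1)) continuous_const))
    refine (ae_map_iff hΓm.aemeasurable (measurable_eval_path 0 hcl.measurableSet)).2 ?_
    refine (ae_restrict_iff' hG').2 (Eventually.of_forall fun ω hω => ?_)
    have := hGK ω hω
    simpa [hΓ, jointPath] using this
  calc μ (G ∩ _) ≤ μ (Γ ⁻¹' bad ∩ G) := measure_mono hfail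
    _ = ρ bad := by rw [hρ, Measure.map_apply hΓm hbadm, Measure.restrict_apply (hΓm hbadm)]
    _ = ∫⁻ w, κ (w 0) bad ∂ρ := hκρ bad hbadm
    _ ≤ ∫⁻ _, ENNReal.ofReal (1 - p) ∂ρ := by
      refine lintegral_mono_ae ?_
      filter_upwards [hκP, hstart] with w hw hw'
      have h0 : w 0 = ![w 0 0, w 0 1] := by
        funext k; fin_cases k <;> rfl
      have h1 := hfast _ hw'.1 _ hw'.2.1 hw'.2.2 (κ (w 0)) (by rwa [← h0])
      calc κ (w 0) bad ≤ κ (w 0) _ := measure_mono hsub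
        _ = ENNReal.ofReal ((κ (w 0)).real _) := (ofReal_measureReal).symm
        _ ≤ _ := ENNReal.ofReal_le_ofReal h1
    _ = ENNReal.ofReal (1 - p) * μ G := by
      rw [lintegral_const, hρ, Measure.map_apply hΓm MeasurableSet.univ, preimage_univ,
        Measure.restrict_apply_univ]

end Pairs

/-! ### Counting surviving paths -/

/-- Elements with the same label can be paired so that fewer than the number of labels remain. -/
theorem exists_pairing {C : ℕ} (lab : ℕ → Fin C) (R : Finset ℕ) :
    ∃ (D : Finset ℕ) (g : ℕ → ℕ), D ⊆ R ∧ (∀ m ∈ D, g m ∈ R) ∧ InjOn g D ∧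
      (∀ m ∈ D, ∀ m' ∈ D, g m ≠ m') ∧ (∀ m ∈ D, lab (g m) = lab m) ∧ R.card ≤ 2 * D.card + C := by
  induction h : R.card using Nat.strong_induction_on generalizing R with
  | _ k ih =>
    subst h
    by_cases hR : R.card ≤ C
    · exact ⟨∅, id, by simp, by simp, by simp, by simp, by simp, by simpa using hR⟩
    -- Pigeonhole: as long as more than `C` elements are unpaired, two of them share a label and are
    -- removed as a pair.
    obtain ⟨a, ha, b, hb, hab, hlab⟩ := Finset.exists_ne_map_eq_of_card_lt_of_maps_to
      (s := R) (t := (Finset.univ : Finset (Fin C))) (f := lab) (by simpa using hR)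
      fun _ _ => Finset.mem_univ _
    have hba : b ∈ R.erase a := Finset.mem_erase.2 ⟨hab.symm, hb⟩
    have hcard : ((R.erase a).erase b).card + 2 = R.card := by
      have h1 := Finset.card_erase_add_one hba
      have h2 := Finset.card_erase_add_one ha
      omega
    obtain ⟨D, g, hDR, hgR, hinj, hne, hl, hc⟩ := ih _ (by omega) ((R.erase a).erase b) rfl
    have haD : a ∉ D := fun h => by simpa using hDR h
    have hR' : (R.erase a).erase b ⊆ R :=
      (Finset.erase_subset _ _).trans (Finset.erase_subset _ _)
    have hg' : ∀ m ∈ D, Function.update g a b m = g m := fun m hm =>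
      Function.update_of_ne (fun h : m = a => haD (h ▸ hm)) _ _
    have hgb : ∀ m ∈ D, g m ≠ b ∧ g m ≠ a := fun m hm => by
      have := hgR m hm
      simp only [Finset.mem_erase] at this
      exact ⟨this.1, this.2.1⟩
    refine ⟨insert a D, Function.update g a b, ?_, ?_, ?_, ?_, ?_, ?_⟩
    · exact Finset.insert_subset ha (hDR.trans hR')
    · refine Finset.forall_mem_insert _ _ _ |>.2 ⟨by simpa using hb, fun m hm => ?_⟩
      rw [hg' m hm]
      exact hR' (hgR m hm)
    · rw [Finset.coe_insert, injOn_insert (by simpa using haD)]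
      refine ⟨fun m hm m' hm' h => hinj hm hm' ?_, ?_⟩
      · rwa [hg' m hm, hg' m' hm'] at h
      · rintro ⟨m, hm, h⟩
        rw [hg' m hm, Function.update_self] at h
        exact (hgb m hm).1 h
    · refine Finset.forall_mem_insert _ _ _ |>.2 ⟨?_, fun m hm => ?_⟩ <;>
        refine Finset.forall_mem_insert _ _ _ |>.2 ⟨?_, fun m' hm' => ?_⟩
      · simpa using hab.symm
      · rw [Function.update_self]
        rintro rfl
        simpa using hDR hm'
      · rw [hg' m hm]
        exact (hgb m hm).2
      · rw [hg' m hm]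
        exact hne m hm m' hm'
    · refine Finset.forall_mem_insert _ _ _ |>.2 ⟨by simpa using hlab.symm, fun m hm => ?_⟩
      rw [hg' m hm]
      exact hl m hm
    · rw [Finset.card_insert_of_notMem haD]
      omega

section Survivors

variable {M : Type u} [TopologicalSpace M]

/-- The positions at time `u` of those paths with index in `S` that stay in `K` during
`[u₀, u]`. -/
def survivors (φ : ℕ → PathSpace M) (S : Finset ℕ) (K : Set M) (u₀ u : ℝ) : Set M :=
  (fun n => (φ n).ext u) '' {n | n ∈ S ∧ ∀ t ∈ Icc u₀ u, (φ n).ext t ∈ K}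

variable {φ : ℕ → PathSpace M} {S : Finset ℕ} {K : Set M} {u₀ u u' : ℝ}

theorem finite_survivingIndices :
    {n | n ∈ S ∧ ∀ t ∈ Icc u₀ u, (φ n).ext t ∈ K}.Finite :=
  S.finite_toSet.subset fun _ h => h.1

theorem finite_survivors : (survivors φ S K u₀ u).Finite :=
  finite_survivingIndices.image _

theorem ncard_survivors_le : (survivors φ S K u₀ u).ncard ≤ S.card := by
  refine (ncard_image_le finite_survivingIndices).trans ?_
  rw [← ncard_coe_finset]
  exact ncard_le_ncard (fun _ h => h.1) S.finite_toSet

theorem exists_representatives (φ : ℕ → PathSpace M) (S : Finset ℕ) (K : Set M) (u₀ u : ℝ) :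
    ∃ R : Finset ℕ, (∀ n ∈ R, n ∈ S ∧ ∀ t ∈ Icc u₀ u, (φ n).ext t ∈ K) ∧
      InjOn (fun n => (φ n).ext u) R ∧
      survivors φ S K u₀ u ⊆ (fun n => (φ n).ext u) '' R := by
  obtain ⟨R, hR, hbij⟩ := SurjOn.exists_bijOn_subset
    (surjOn_image (fun n => (φ n).ext u) {n | n ∈ S ∧ ∀ t ∈ Icc u₀ u, (φ n).ext t ∈ K})
  have hfin := (finite_survivingIndices (φ := φ)).subset hR
  refine ⟨hfin.toFinset, fun n hn => hR (hfin.mem_toFinset.1 hn), ?_, ?_⟩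
  · rw [hfin.coe_toFinset]
    exact hbij.injOn
  · rw [hfin.coe_toFinset]
    exact hbij.image_eq.symm.subset

open Classical in
/-- Each pair of representatives that does not stay apart in `K` reduces the number of
survivors. -/
theorem ncard_survivors_add_card_le (hu₀ : u₀ ≤ u) (hu : u ≤ u')
    (hco : ∀ t, u ≤ t → ∀ m ∈ S, ∀ n ∈ S, (φ m).ext t = (φ n).ext t →
      ∀ t', t ≤ t' → (φ m).ext t' = (φ n).ext t')
    {R : Finset ℕ} (hR : ∀ n ∈ R, n ∈ S ∧ ∀ t ∈ Icc u₀ u, (φ n).ext t ∈ K)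
    (hcover : survivors φ S K u₀ u ⊆ (fun n => (φ n).ext u) '' R)
    {D : Finset ℕ} {g : ℕ → ℕ} (hDR : D ⊆ R) (hgR : ∀ m ∈ D, g m ∈ R) (hinj : InjOn g D)
    (hne : ∀ m ∈ D, ∀ m' ∈ D, g m ≠ m') :
    (survivors φ S K u₀ u').ncard + D.card ≤ R.card + (D.filter fun m => ∀ t ∈ Icc u u',
      (φ m).ext t ∈ K ∧ (φ (g m)).ext t ∈ K ∧ (φ m).ext t ≠ (φ (g m)).ext t).card := by
  set fail : ℕ → Prop := fun m => ∀ t ∈ Icc u u',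
      (φ m).ext t ∈ K ∧ (φ (g m)).ext t ∈ K ∧ (φ m).ext t ≠ (φ (g m)).ext t with hfail
  set alive : ℕ → Prop := fun n => ∀ t ∈ Icc u u', (φ n).ext t ∈ K with halive
  set D' := D.filter fun m => ¬ fail m with hD'
  -- `e m` is the superfluous member of a pair that does not fail. If `g m` stays in `K`, then `m`
  -- has either left `K` or met `g m`, and is dropped; otherwise `g m` is dropped.
  set e : ℕ → ℕ := fun m => if alive (g m) then m else g m with he
  have hD'D : D' ⊆ D := Finset.filter_subset _ _
  have heR : D'.image e ⊆ R := by
    intro n hn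
    obtain ⟨m, hm, rfl⟩ := Finset.mem_image.1 hn
    simp only [he]
    split_ifs
    · exact hDR (hD'D hm)
    · exact hgR m (hD'D hm)
  have heinj : InjOn e D' := by
    intro m hm m' hm' h
    have hm := hD'D hm
    have hm' := hD'D hm'
    simp only [he] at h
    split_ifs at h with h1 h2 h2
    · exact h
    · exact absurd h.symm (hne m' hm' m hm)
    · exact absurd h (hne m hm m' hm')
    · exact hinj hm hm' h
  have hsub : survivors φ S K u₀ u' ⊆ (fun n => (φ n).ext u') '' (R \ D'.image e : Finset ℕ) := by
    rintro _ ⟨n, ⟨hnS, hn⟩, rfl⟩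
    obtain ⟨m, hmR, hm⟩ := hcover (mem_image_of_mem _
      ⟨hnS, fun t ht => hn t ⟨ht.1, ht.2.trans hu⟩⟩)
    have hmn : ∀ t, u ≤ t → (φ m).ext t = (φ n).ext t :=
      hco u le_rfl m (hR m hmR).1 n hnS hm
    have hma : alive m := fun t ht => by
      rw [hmn t ht.1]
      exact hn t ⟨hu₀.trans ht.1, ht.2⟩
    by_cases hmD : m ∈ D'.image e
    · obtain ⟨k, hk, rfl⟩ := Finset.mem_image.1 hmD
      have hkD := hD'D hk
      have hk' : ¬ fail k := (Finset.mem_filter.1 hk).2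
      by_cases hg : alive (g k)
      · have hek : e k = k := if_pos hg
        rw [hek] at hma hmn hm
        have heq : (φ k).ext u' = (φ (g k)).ext u' := by
          simp only [hfail, not_forall] at hk'
          obtain ⟨t, ht, hk'⟩ := hk'
          have : (φ k).ext t = (φ (g k)).ext t := by
            by_contra h
            exact hk' ⟨hma t ht, hg t ht, h⟩
          exact hco t ht.1 k (hR k (hDR hkD)).1 (g k) (hR _ (hgR k hkD)).1 this u' ht.2
        refine ⟨g k, ?_, heq.symm.trans (hmn u' hu)⟩
        rw [Finset.mem_coe, Finset.mem_sdiff]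
        refine ⟨hgR k hkD, fun h => ?_⟩
        obtain ⟨l, hl, hle⟩ := Finset.mem_image.1 h
        simp only [he] at hle
        split_ifs at hle with h1
        · exact hne k hkD l (hD'D hl) hle.symm
        · rw [hle] at h1
          exact h1 hg
      · have hek : e k = g k := if_neg hg
        rw [hek] at hma
        exact absurd hma hg
    · exact ⟨m, by simpa [Finset.mem_sdiff] using ⟨hmR, by simpa using hmD⟩, hmn u' hu⟩
  have h1 : (survivors φ S K u₀ u').ncard ≤ (R \ D'.image e).card := by
    refine (ncard_le_ncard hsub ((Finset.finite_toSet _).image _)).trans ?_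
    refine (ncard_image_le (Finset.finite_toSet _)).trans ?_
    rw [ncard_coe_finset]
  have h2 : (R \ D'.image e).card + (D'.image e).card = R.card := Finset.card_sdiff_add_card_eq_card heR
  have h3 : (D'.image e).card = D'.card := Finset.card_image_of_injOn heinj
  have h4 : (D.filter fail).card + D'.card = D.card := by
    simp only [hD']
    convert Finset.card_filter_add_card_filter_not (s := D) fail
  have h5 : (survivors φ S K u₀ u').ncard + D.card ≤ R.card + (D.filter fail).card := by omega
  convert h5

end Survivors

/-- The iteration that bounds the expected number of survivors at time `u₁` uniformly in the
number of paths. -/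
theorem exists_bound_of_recurrence {β p C δ : ℝ} (hβ : 0 < β) (hp : 0 < p) (hp1 : p ≤ 1)
    (hC : 0 < C) (hδ : 0 < δ) :
    ∃ B : ℝ, ∀ (u₀ : ℝ) (e : ℝ → ℝ) (b : ℝ), (∀ u, e u ≤ b) →
      (∀ u u' ε : ℝ, u₀ ≤ u → u ≤ u' → 0 < ε → ε ≤ 1 → β * ε ^ 2 < u' - u →
        e u' ≤ (1 - p / 2) * e u + p / 2 * (C / ε)) → e (u₀ + δ) ≤ B := by
  -- If `e u ≤ n / l` and `ε = 2 * C * l / n`, then `C / ε = n / (2 * l)`, so one step of the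
  -- recurrence gives the bound `(1 - p / 4) * (n / l) = n`.
  set l := 1 - p / 4 with hl
  have hl0 : 0 < l := by linarith
  have hl1 : l < 1 := by linarith
  have hl2 : 0 < 1 - l ^ 2 := by nlinarith
  -- Going from level `n / l` to level `n` is given time `8 * β * C ^ 2 / n ^ 2`, more than `β * ε ^
  -- 2`. Over the levels `n, n / l, n / l ^ 2, …` these times sum to `k / n ^ 2`.
  set k := 8 * β * C ^ 2 / (1 - l ^ 2) with hk
  have hk0 : 0 < k := by positivity
  refine ⟨2 * C + 1 + k / δ, fun u₀ e b hb hrec => ?_⟩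
  have key : ∀ (j : ℕ) (n w : ℝ), 2 * C ≤ n → k / n ^ 2 ≤ w - u₀ → b ≤ n * (l⁻¹) ^ j → e w ≤ n := by
    intro j
    induction j with
    | zero =>
      intro n w _ _ h
      exact (hb w).trans (by simpa using h)
    | succ j ih =>
      intro n w hn hw h
      have hn0 : 0 < n := by linarith
      have hθ : k / n ^ 2 = 8 * β * C ^ 2 / n ^ 2 + k / (n / l) ^ 2 := by
        rw [hk]; field_simp; ring
      have hpos : 0 < 8 * β * C ^ 2 / n ^ 2 := by positivity
      have hpos' : 0 < k / (n / l) ^ 2 := by positivity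
      have h1 : e (w - 8 * β * C ^ 2 / n ^ 2) ≤ n / l := by
        refine ih _ _ (hn.trans ?_) (by linarith) ?_
        · rw [le_div_iff₀ hl0]
          nlinarith
        · refine h.trans (le_of_eq ?_)
          rw [pow_succ, div_eq_mul_inv]; ring
      have h2 := hrec (w - 8 * β * C ^ 2 / n ^ 2) w (2 * C * l / n) (by linarith) (by linarith)
        (by positivity) ?_ ?_
      · have h3 : C / (2 * C * l / n) = n / l / 2 := by field_simp
        rw [h3] at h2
        calc e w ≤ (1 - p / 2) * (n / l) + p / 2 * (n / l / 2) := by nlinarith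
          _ = n / l * l := by rw [hl]; ring
          _ = n := div_mul_cancel₀ _ hl0.ne'
      · rw [div_le_one hn0]
        nlinarith
      · have : β * (2 * C * l / n) ^ 2 = 4 * β * C ^ 2 / n ^ 2 * l ^ 2 := by ring
        rw [this]
        have h4 : 0 < 4 * β * C ^ 2 / n ^ 2 := by positivity
        have h5 : 8 * β * C ^ 2 / n ^ 2 = 2 * (4 * β * C ^ 2 / n ^ 2) := by ring
        nlinarith
  -- `n ≥ 2 * C` keeps `ε ≤ 1`, and `n ≥ 1` together with `n ≥ k / δ` makes the total time `k / n ^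
  -- 2` at most `δ`. The a priori bound `b` affects only the number of steps.
  set n := 2 * C + 1 + k / δ with hn
  have hkδ : 0 < k / δ := by positivity
  have hn1 : 1 ≤ n := by linarith
  obtain ⟨j, hj⟩ := pow_unbounded_of_one_lt b ((one_lt_inv₀ hl0).2 hl1)
  refine key j n (u₀ + δ) (by linarith) ?_ (hj.le.trans ?_)
  · rw [add_sub_cancel_left, div_le_iff₀ (by positivity)]
    have : k / δ ≤ n ^ 2 := by nlinarith
    rwa [div_le_iff₀ hδ, mul_comm] at this
  · have : 0 < (l⁻¹) ^ j := by positivity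
    nlinarith

/-! ### The expected number of survivors and its finiteness. -/

section Counting

variable {M : Type u} [MetricSpace M] [LocallyCompactSpace M] [SecondCountableTopology M]
  [MeasurableSpace M] [BorelSpace M]
  {P : ∀ n : ℕ, ℝ≥0 → Kernel (Fin n → M) (Fin n → M)}
  {Ω : Type v} [mΩ : MeasurableSpace Ω] {μ : Measure Ω} [IsProbabilityMeasure μ]
  {ψ : ℝ → ℝ → Ω → MeasurableMap M} {s : ℕ → ℝ} {x : ℕ → M} {Φ : ℕ → Ω → PathSpace M}

/-- The information at time `u` about the paths with index in `S` that is needed to pair the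
survivors. -/
def pattern {N : ℕ} (Φ : ℕ → Ω → PathSpace M) (S : Finset ℕ) (K : Set M) (u₀ u : ℝ)
    (lab : M → Fin N) (ω : Ω) : (S → Prop) × (S → S → Prop) × (S → Fin N) :=
  (fun n => ∀ t ∈ Icc u₀ u, (Φ n ω).ext t ∈ K, fun m n => (Φ m ω).ext u = (Φ n ω).ext u,
    fun n => lab ((Φ n ω).ext u))

theorem measurable_pattern {N : ℕ} (Φ : ℕ → Ω → PathSpace M) (S : Finset ℕ) {K : Set M}
    (hK : IsClosed K) (u₀ u : ℝ) {lab : M → Fin N} (hlab : Measurable lab) :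
    Measurable[pathFiltration Φ u] (pattern Φ S K u₀ u lab) := by
  have hm : ∀ n, Measurable[pathFiltration Φ u] fun ω => (Φ n ω).ext u := fun n =>
    measurable_pathFiltration Φ n le_rfl
  have h1 : ∀ n, Measurable[pathFiltration Φ u] fun ω => ∀ t ∈ Icc u₀ u, (Φ n ω).ext t ∈ K :=
    fun n => (@measurableSet_setOfPred _ (pathFiltration Φ u) _).1
      (measurableSet_forall_Icc_mem (mΩ := pathFiltration Φ u) (f := fun t ω => (Φ n ω).ext t)
        (fun ω => (Φ n ω).ext.continuous) hK fun t ht => measurable_pathFiltration Φ n ht.2)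
  have h2 : ∀ m n, Measurable[pathFiltration Φ u] fun ω => (Φ m ω).ext u = (Φ n ω).ext u :=
    fun m n => (@measurableSet_setOfPred _ (pathFiltration Φ u) _).1
      (((hm m).prodMk (hm n)) isClosed_diagonal.measurableSet)
  have h1' : Measurable[pathFiltration Φ u] fun ω (n : S) => ∀ t ∈ Icc u₀ u, (Φ n ω).ext t ∈ K :=
    @measurable_pi_lambda _ _ _ (pathFiltration Φ u) _ _ fun n => h1 n
  have h2' : Measurable[pathFiltration Φ u] fun ω (m n : S) => (Φ m ω).ext u = (Φ n ω).ext u :=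
    @measurable_pi_lambda _ _ _ (pathFiltration Φ u) _ _ fun m =>
      @measurable_pi_lambda _ _ _ (pathFiltration Φ u) _ _ fun n => h2 m n
  have h3' : Measurable[pathFiltration Φ u] fun ω (n : S) => lab ((Φ n ω).ext u) :=
    @measurable_pi_lambda _ _ _ (pathFiltration Φ u) _ _ fun n => hlab.comp (hm n)
  exact h1'.prodMk (h2'.prodMk h3')

/-- Representatives chosen for one outcome serve for every outcome with the same pattern. Hence the
pairing can be fixed on each fibre of `pattern`, an event of the past. -/
theorem survivors_of_pattern_eq {N : ℕ} {S : Finset ℕ} {K : Set M} {u₀ u : ℝ} {lab : M → Fin N}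
    {ω ω' : Ω} (h : pattern Φ S K u₀ u lab ω = pattern Φ S K u₀ u lab ω') {R : Finset ℕ}
    (hR : ∀ n ∈ R, n ∈ S ∧ ∀ t ∈ Icc u₀ u, (Φ n ω).ext t ∈ K)
    (hinj : InjOn (fun n => (Φ n ω).ext u) R)
    (hcover : survivors (fun n => Φ n ω) S K u₀ u ⊆ (fun n => (Φ n ω).ext u) '' R) :
    (∀ n ∈ R, n ∈ S ∧ ∀ t ∈ Icc u₀ u, (Φ n ω').ext t ∈ K) ∧
      survivors (fun n => Φ n ω') S K u₀ u ⊆ (fun n => (Φ n ω').ext u) '' R ∧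
      (survivors (fun n => Φ n ω') S K u₀ u).ncard = R.card := by
  have h1 : ∀ n ∈ S, (∀ t ∈ Icc u₀ u, (Φ n ω).ext t ∈ K) ↔ ∀ t ∈ Icc u₀ u, (Φ n ω').ext t ∈ K :=
    fun n hn => (congrFun (congrArg (fun d => d.1) h) ⟨n, hn⟩).to_iff
  have h2 : ∀ m ∈ S, ∀ n ∈ S, (Φ m ω).ext u = (Φ n ω).ext u ↔ (Φ m ω').ext u = (Φ n ω').ext u :=
    fun m hm n hn =>
      (congrFun (congrFun (congrArg (fun d => d.2.1) h) ⟨m, hm⟩) ⟨n, hn⟩).to_iff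
  have hR' : ∀ n ∈ R, n ∈ S ∧ ∀ t ∈ Icc u₀ u, (Φ n ω').ext t ∈ K := fun n hn =>
    ⟨(hR n hn).1, (h1 n (hR n hn).1).1 (hR n hn).2⟩
  have hcover' : survivors (fun n => Φ n ω') S K u₀ u ⊆ (fun n => (Φ n ω').ext u) '' R := by
    rintro _ ⟨n, ⟨hnS, hn⟩, rfl⟩
    obtain ⟨m, hmR, hm⟩ := hcover (mem_image_of_mem _ ⟨hnS, (h1 n hnS).2 hn⟩)
    exact ⟨m, hmR, (h2 m (hR m hmR).1 n hnS).1 hm⟩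
  refine ⟨hR', hcover', ?_⟩
  have heq : survivors (fun n => Φ n ω') S K u₀ u = (fun n => (Φ n ω').ext u) '' R :=
    hcover'.antisymm (image_mono fun n hn => hR' n hn)
  rw [heq, InjOn.ncard_image, ncard_coe_finset]
  intro m hm n hn hmn
  exact hinj hm hn ((h2 m (hR m hm).1 n (hR n hn).1).2 hmn)

theorem ncard_survivors_of_pattern_eq {N : ℕ} {S : Finset ℕ} {K : Set M} {u₀ u : ℝ}
    {lab : M → Fin N} {ω ω' : Ω} (h : pattern Φ S K u₀ u lab ω = pattern Φ S K u₀ u lab ω') :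
    (survivors (fun n => Φ n ω) S K u₀ u).ncard = (survivors (fun n => Φ n ω') S K u₀ u).ncard := by
  obtain ⟨R, hR, hinj, hcover⟩ := exists_representatives (fun n => Φ n ω) S K u₀ u
  rw [(survivors_of_pattern_eq (lab := lab) rfl hR hinj hcover).2.2,
    (survivors_of_pattern_eq h hR hinj hcover).2.2]

/-- The number of survivors factors through the pattern, which has finitely many values; labels are
irrelevant here, so a constant one is used. -/
theorem measurable_ncard_survivors (hΦ : ∀ n, IsContinuousModification μ ψ (s n) (x n) (Φ n))
    (S : Finset ℕ) {K : Set M} (hK : IsClosed K) (u₀ u : ℝ) :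
    Measurable fun ω => (survivors (fun n => Φ n ω) S K u₀ u).ncard := by
  set d := pattern Φ S K u₀ u (fun _ => (0 : Fin 1)) with hd
  have hdm : Measurable d := (measurable_pattern Φ S hK u₀ u measurable_const).mono
    (pathFiltration_le hΦ u) le_rfl
  have hfac : Function.FactorsThrough
      (fun ω => (survivors (fun n => Φ n ω) S K u₀ u).ncard) d :=
    fun ω ω' h => ncard_survivors_of_pattern_eq h
  have : (fun ω => (survivors (fun n => Φ n ω) S K u₀ u).ncard)
      = Function.extend d (fun ω => (survivors (fun n => Φ n ω) S K u₀ u).ncard) 0 ∘ d :=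
    (funext fun ω => hfac.extend_apply 0 ω).symm
  rw [this]
  exact (measurable_of_countable _).comp hdm

theorem integrable_ncard_survivors (hΦ : ∀ n, IsContinuousModification μ ψ (s n) (x n) (Φ n))
    (S : Finset ℕ) {K : Set M} (hK : IsClosed K) (u₀ u : ℝ) :
    Integrable (fun ω => ((survivors (fun n => Φ n ω) S K u₀ u).ncard : ℝ)) μ := by
  refine Integrable.of_bound (C := S.card) ?_ (Eventually.of_forall fun ω => ?_)
  · exact (measurable_from_nat.comp
      (measurable_ncard_survivors hΦ S hK u₀ u)).aestronglyMeasurable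
  · simpa using ncard_survivors_le

/-- Inequalities between integrals can be checked on the fibres of a function with finitely many
values. -/
theorem integral_le_of_fibres {α : Type*} [Finite α] [MeasurableSpace α]
    [MeasurableSingletonClass α] {d : Ω → α} (hd : Measurable d) {f g : Ω → ℝ}
    (hf : Integrable f μ) (hg : Integrable g μ)
    (h : ∀ a, ∫ ω in d ⁻¹' {a}, f ω ∂μ ≤ ∫ ω in d ⁻¹' {a}, g ω ∂μ) : ∫ ω, f ω ∂μ ≤ ∫ ω, g ω ∂μ := by
  have := Fintype.ofFinite α
  have key : ∀ f : Ω → ℝ, Integrable f μ → ∫ ω, f ω ∂μ = ∑ a, ∫ ω in d ⁻¹' {a}, f ω ∂μ := by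
    intro f hf
    rw [← integral_biUnion_finset Finset.univ (fun a _ => hd (measurableSet_singleton a)) ?_
      fun a _ => hf.integrableOn]
    · have : ⋃ a ∈ (Finset.univ : Finset α), d ⁻¹' {a} = univ := by
        ext ω; simp
      rw [this, setIntegral_univ]
    · exact fun a _ b _ hab => Disjoint.preimage _ (disjoint_singleton.2 hab)
  rw [key f hf, key g hg]
  exact Finset.sum_le_sum fun a _ => h a

/-- The expected number of survivors decreases by a factor, up to the number of labels. -/
theorem integral_ncard_survivors_le (hP : IsConsistentCoalescing P) (hψ : IsStochasticFlow μ P ψ)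
    (hΦ : ∀ n, IsContinuousModification μ ψ (s n) (x n) (Φ n)) {K : Set M} (hK : IsClosed K)
    {β p ε : ℝ} (hβ : 0 ≤ β) (hp : 0 ≤ p) (hp1 : p ≤ 1)
    (hfast : ∀ x ∈ K, ∀ y ∈ K, dist x y ≤ ε → ∀ Q : Measure C(ℝ≥0, Fin 2 → M),
      IsMarkovLaw (P 2) ![x, y] Q →
        Q.real {w | ENNReal.ofReal (β * ε ^ 2) < min (exitTime K w) (meetingTime w)} ≤ 1 - p)
    {S : Finset ℕ} {u₀ u u' : ℝ} (hS : ∀ n ∈ S, s n ≤ u₀) (hu₀ : u₀ ≤ u) (hu : u ≤ u')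
    (hu' : β * ε ^ 2 < u' - u) {N : ℕ} {lab : M → Fin N} (hlab : Measurable lab)
    (hlabK : ∀ y ∈ K, ∀ y' ∈ K, lab y = lab y' → dist y y' ≤ ε) :
    ∫ ω, ((survivors (fun n => Φ n ω) S K u₀ u').ncard : ℝ) ∂μ
      ≤ (1 - p / 2) * ∫ ω, ((survivors (fun n => Φ n ω) S K u₀ u).ncard : ℝ) ∂μ + p / 2 * N := by
  classical
  have hi := integrable_ncard_survivors hΦ S hK u₀ u
  have hi' := integrable_ncard_survivors hΦ S hK u₀ u'
  have hdF := measurable_pattern Φ S hK u₀ u hlab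
  have hdm : Measurable (pattern Φ S K u₀ u lab) := hdF.mono (pathFiltration_le hΦ u) le_rfl
  have hrhs : (1 - p / 2) * ∫ ω, ((survivors (fun n => Φ n ω) S K u₀ u).ncard : ℝ) ∂μ + p / 2 * N
      = ∫ ω, ((1 - p / 2) * ((survivors (fun n => Φ n ω) S K u₀ u).ncard : ℝ) + p / 2 * N) ∂μ := by
    rw [integral_add (hi.const_mul _) (integrable_const _), integral_const_mul]
    simp
  rw [hrhs]
  -- On a fibre the number of survivors is the constant `R.card` and the pairs `m`, `g m` are fixed,
  -- so each pair can be treated by the conditional estimate.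
  refine integral_le_of_fibres hdm hi' ((hi.const_mul _).add (integrable_const _)) fun a => ?_
  set G := pattern Φ S K u₀ u lab ⁻¹' {a} with hG
  rcases G.eq_empty_or_nonempty with hempty | ⟨ω₀, hω₀⟩
  · simp [hempty]
  have hGF : MeasurableSet[pathFiltration Φ u] G := hdF (measurableSet_singleton a)
  have hGm : MeasurableSet G := hdm (measurableSet_singleton a)
  have hpat : ∀ ω ∈ G, pattern Φ S K u₀ u lab ω₀ = pattern Φ S K u₀ u lab ω := fun ω hω =>
    hω₀.trans (Eq.symm hω)
  obtain ⟨R, hR, hinj, hcover⟩ := exists_representatives (fun n => Φ n ω₀) S K u₀ u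
  obtain ⟨D, g, hDR, hgR, hginj, hne, hl, hcard⟩ :=
    exists_pairing (fun n => lab ((Φ n ω₀).ext u)) R
  have hfib := fun ω hω => survivors_of_pattern_eq (hpat ω hω) hR hinj hcover
  set fail : ℕ → Set Ω := fun m => {ω | ∀ t ∈ Icc u u', (Φ m ω).ext t ∈ K ∧
    (Φ (g m) ω).ext t ∈ K ∧ (Φ m ω).ext t ≠ (Φ (g m) ω).ext t} with hfail
  have hpair : ∀ m ∈ D, μ.real (G ∩ fail m) ≤ (1 - p) * μ.real G := by
    intro m hm
    have hmS := (hR m (hDR hm)).1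
    have hgS := (hR _ (hgR m hm)).1
    have h1 := measure_not_coalesce_le hP hψ hΦ hK hfast ((hS m hmS).trans hu₀)
      ((hS _ hgS).trans hu₀) hu hu' hβ hGF fun ω hω => by
        have h2 := (hfib ω hω).1 m (hDR hm) |>.2 u ⟨hu₀, le_rfl⟩
        have h3 := (hfib ω hω).1 _ (hgR m hm) |>.2 u ⟨hu₀, le_rfl⟩
        have h4 : ∀ n ∈ S, lab ((Φ n ω₀).ext u) = lab ((Φ n ω).ext u) := fun n hn =>
          congrFun (congrArg (fun d => d.2.2) (hpat ω hω)) ⟨n, hn⟩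
        refine ⟨h2, h3, hlabK _ h2 _ h3 ?_⟩
        rw [← h4 m hmS, ← h4 _ hgS]
        exact (hl m hm).symm
    have h2 := ENNReal.toReal_mono (by finiteness) h1
    rwa [ENNReal.toReal_mul, ENNReal.toReal_ofReal (by linarith)] at h2
  -- Measurable hulls have the same measure, so measurability of the failure events is not needed.
  set F : ℕ → Set Ω := fun m => toMeasurable μ (G ∩ fail m) with hF
  have hFm : ∀ m, MeasurableSet (F m) := fun m => measurableSet_toMeasurable _ _
  have hle : ∀ᵐ ω ∂(μ.restrict G), ((survivors (fun n => Φ n ω) S K u₀ u').ncard : ℝ)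
      ≤ (R.card - D.card : ℝ) + ∑ m ∈ D, (F m).indicator 1 ω := by
    refine (ae_restrict_iff' hGm).2 ?_
    filter_upwards [ae_coalescence hP hψ hΦ] with ω hco hω
    have hsu : ∀ n ∈ S, s n ≤ u := fun n hn => (hS n hn).trans hu₀
    have h1 := ncard_survivors_add_card_le (φ := fun n => Φ n ω) hu₀ hu
      (fun t ht m hm n hn => hco t m n ((hsu m hm).trans ht) ((hsu n hn).trans ht))
      (hfib ω hω).1 (hfib ω hω).2.1 hDR hgR hginj hne
    have h2 : ((D.filter fun m => ω ∈ fail m).card : ℝ) ≤ ∑ m ∈ D, (F m).indicator 1 ω := by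
      rw [Finset.card_filter, Nat.cast_sum]
      refine Finset.sum_le_sum fun m _ => ?_
      split_ifs with h
      · have hωF : ω ∈ F m := subset_toMeasurable μ (G ∩ fail m) ⟨hω, h⟩
        simp [indicator_of_mem hωF]
      · rw [Nat.cast_zero]
        exact indicator_nonneg (fun _ _ => zero_le_one) _
    have h3 : ((survivors (fun n => Φ n ω) S K u₀ u').ncard : ℝ) + D.card
        ≤ R.card + (D.filter fun m => ω ∈ fail m).card := by
      exact_mod_cast h1.trans (le_of_eq (by congr!))
    linarith
  have hFi : ∀ m ∈ D, Integrable ((F m).indicator (1 : Ω → ℝ)) (μ.restrict G) := fun m _ =>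
    (integrable_const (1 : ℝ)).indicator (hFm m)
  have hFle : ∀ m ∈ D, ∫ ω in G, (F m).indicator 1 ω ∂μ ≤ (1 - p) * μ.real G := by
    intro m hm
    rw [integral_indicator_one (hFm m)]
    refine le_trans ?_ (hpair m hm)
    have h1 : μ.restrict G (F m) ≤ μ (G ∩ fail m) :=
      (Measure.restrict_apply_le G (F m)).trans (measure_toMeasurable _).le
    exact ENNReal.toReal_mono (by finiteness) h1
  have hcard' : (R.card : ℝ) ≤ 2 * D.card + N := by exact_mod_cast hcard
  calc ∫ ω in G, ((survivors (fun n => Φ n ω) S K u₀ u').ncard : ℝ) ∂μ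
      ≤ ∫ ω in G, ((R.card - D.card : ℝ) + ∑ m ∈ D, (F m).indicator 1 ω) ∂μ :=
        integral_mono_ae hi'.integrableOn
          ((integrable_const _).add (integrable_finsetSum _ hFi)) hle
    _ = (R.card - D.card : ℝ) * μ.real G + ∑ m ∈ D, ∫ ω in G, (F m).indicator 1 ω ∂μ := by
        rw [integral_add (integrable_const _) (integrable_finsetSum _ hFi),
          integral_finsetSum _ hFi, setIntegral_const, smul_eq_mul, mul_comm]
    _ ≤ (R.card - D.card : ℝ) * μ.real G + ∑ m ∈ D, (1 - p) * μ.real G := by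
        gcongr with m hm
        exact hFle m hm
    _ = (R.card - p * D.card) * μ.real G := by
        rw [Finset.sum_const, nsmul_eq_mul]; ring
    -- This is where `R.card ≤ 2 * D.card + N`, the yield of the pairing, is used.
    _ ≤ ((1 - p / 2) * R.card + p / 2 * N) * μ.real G := by
        gcongr
        nlinarith
    _ = ∫ ω in G, ((1 - p / 2) * (R.card : ℝ) + p / 2 * N) ∂μ := by
        rw [setIntegral_const, smul_eq_mul, mul_comm]
    _ = ∫ ω in G, ((1 - p / 2) * ((survivors (fun n => Φ n ω) S K u₀ u).ncard : ℝ)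
          + p / 2 * N) ∂μ := by
        refine setIntegral_congr_fun hGm fun ω hω => ?_
        simp only [(hfib ω hω).2.2]

/-- The positions at time `u₁` of the paths that stay in `K` during `[u₀, u₁]` form a finite
set. -/
theorem ae_finite_survivors (hP : IsConsistentCoalescing P) (hψ : IsStochasticFlow μ P ψ)
    (hΦ : ∀ n, IsContinuousModification μ ψ (s n) (x n) (Φ n)) {K : Set M} (hK : IsClosed K)
    {β p C : ℝ} (hβ : 0 < β) (hp : 0 < p) (hC : 0 < C)
    (hfast : ∀ x ∈ K, ∀ y ∈ K, ∀ ε : ℝ, 0 < ε → dist x y ≤ ε →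
      ∀ Q : Measure C(ℝ≥0, Fin 2 → M), IsMarkovLaw (P 2) ![x, y] Q →
        Q.real {w | ENNReal.ofReal (β * ε ^ 2) < min (exitTime K w) (meetingTime w)} ≤ 1 - p)
    (hlab : ∀ ε : ℝ, 0 < ε → ε ≤ 1 → ∃ (N : ℕ) (lab : M → Fin N), Measurable lab ∧
      (N : ℝ) ≤ C / ε ∧ ∀ y ∈ K, ∀ y' ∈ K, lab y = lab y' → dist y y' ≤ ε)
    {u₀ u₁ : ℝ} (hu : u₀ < u₁) :
    ∀ᵐ ω ∂μ, {y | ∃ n, s n ≤ u₀ ∧ (∀ t ∈ Icc u₀ u₁, (Φ n ω).ext t ∈ K) ∧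
      y = (Φ n ω).ext u₁}.Finite := by
  classical
  -- Replacing `p` by `min p 1` only weakens the coalescence estimate. The bound `B` does not depend
  -- on the finite set of paths.
  obtain ⟨B, hB⟩ := exists_bound_of_recurrence hβ (p := min p 1) (by positivity) (min_le_right _ _)
    hC (sub_pos.2 hu)
  set S : ℕ → Finset ℕ := fun k => (Finset.range k).filter fun n => s n ≤ u₀ with hS
  set N : ℕ → Ω → ℕ := fun k ω => (survivors (fun n => Φ n ω) (S k) K u₀ u₁).ncard with hN
  have hbound : ∀ k, ∫ ω, (N k ω : ℝ) ∂μ ≤ B := by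
    intro k
    have h1 := hB u₀ (fun u => ∫ ω, ((survivors (fun n => Φ n ω) (S k) K u₀ u).ncard : ℝ) ∂μ)
      (S k).card (fun u => ?_) fun u u' ε hu₀ huu' hε hε1 hβε => ?_
    · rwa [add_sub_cancel] at h1
    · calc _ ≤ ∫ _, ((S k).card : ℝ) ∂μ :=
          integral_mono (integrable_ncard_survivors hΦ (S k) hK u₀ u) (integrable_const _)
            fun ω => by simpa using ncard_survivors_le
        _ = _ := by simp
    · obtain ⟨L, lab, hlabm, hL, hlabK⟩ := hlab ε hε hε1
      refine (integral_ncard_survivors_le hP hψ hΦ hK hβ.le (p := min p 1) (by positivity)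
        (min_le_right _ _) (fun y hy y' hy' hd Q hQ => (hfast y hy y' hy' ε hε hd Q hQ).trans ?_)
        (fun n hn => (Finset.mem_filter.1 hn).2) hu₀ huu' hβε hlabm hlabK).trans ?_
      · linarith [min_le_left p 1]
      · gcongr
  have hlint : ∀ k, ∫⁻ ω, (N k ω : ℝ≥0∞) ∂μ ≤ ENNReal.ofReal B := by
    intro k
    have h1 := ofReal_integral_eq_lintegral_ofReal (integrable_ncard_survivors hΦ (S k) hK u₀ u₁)
      (Eventually.of_forall fun ω => Nat.cast_nonneg _)
    simp only [ENNReal.ofReal_natCast] at h1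
    rw [← h1]
    exact ENNReal.ofReal_le_ofReal (hbound k)
  have hmono : ∀ ω, Monotone fun k => (N k ω : ℝ≥0∞) := by
    intro ω k l hkl
    refine Nat.cast_le.2 (ncard_le_ncard (image_mono fun n hn => ⟨?_, hn.2⟩) finite_survivors)
    exact Finset.filter_subset_filter _ (Finset.range_subset_range.2 hkl) hn.1
  have hmeas : ∀ k, Measurable fun ω => (N k ω : ℝ≥0∞) := fun k =>
    measurable_from_nat.comp (measurable_ncard_survivors hΦ (S k) hK u₀ u₁)
  -- Monotone convergence carries the uniform bound to the whole family of paths, so the limiting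
  -- number is almost surely finite.
  have hsup : ∫⁻ ω, ⨆ k, (N k ω : ℝ≥0∞) ∂μ ≤ ENNReal.ofReal B := by
    rw [lintegral_iSup hmeas fun k l hkl ω => hmono ω hkl]
    exact iSup_le hlint
  filter_upwards [ae_lt_top (Measurable.iSup hmeas) (hsup.trans_lt ENNReal.ofReal_lt_top).ne]
    with ω hω
  by_contra hinf
  obtain ⟨b, hb⟩ := ENNReal.exists_nat_gt hω.ne
  obtain ⟨T, hT, hTb⟩ := Set.Infinite.exists_subset_card_eq hinf b
  choose! n hn using fun y (hy : y ∈ T) => hT hy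
  have hsub : (T : Set M) ⊆ survivors (fun n => Φ n ω) (S (T.sup n + 1)) K u₀ u₁ := by
    intro y hy
    refine ⟨n y, ⟨?_, (hn y hy).2.1⟩, (hn y hy).2.2.symm⟩
    exact Finset.mem_filter.2 ⟨Finset.mem_range.2 (Nat.lt_succ_of_le (Finset.le_sup hy)),
      (hn y hy).1⟩
  have h1 : b ≤ N (T.sup n + 1) ω := by
    rw [← hTb, ← ncard_coe_finset]
    exact ncard_le_ncard hsub finite_survivors
  have h2 : (b : ℝ≥0∞) ≤ ⨆ k, (N k ω : ℝ≥0∞) :=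
    (Nat.cast_le.2 h1).trans (le_iSup (fun k => (N k ω : ℝ≥0∞)) _)
  exact absurd hb (not_lt.2 h2)

end Counting

/-! ### Combination of the estimates. -/

section Assembly

/-- If no path crosses the shell around `c`, then finiteness of the sets of survivors in a ball
implies finiteness of the sets of positions. -/
theorem finite_positions_of_survivors {M : Type u} [MetricSpace M] {φ : ℕ → PathSpace M} {c : M}
    {r₁ r₂ : ℝ} (hNC : ∀ T : ℕ, NoCrossing φ c r₁ r₂ T)
    (hfin : ∀ u q : ℚ, u < q → {y | ∃ n, (φ n).start ≤ u ∧
      (∀ t ∈ Icc (u : ℝ) q, (φ n).ext t ∈ closure (Metric.ball c r₂)) ∧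
        y = (φ n).ext q}.Finite) {p q : ℚ} (hpq : p < q) :
    (positions φ p q ∩ Metric.closedBall c r₁).Finite := by
  obtain ⟨T, hT⟩ := exists_nat_ge (max |(p : ℝ)| |(q : ℝ)|)
  obtain ⟨δ, hδ, hδT⟩ := hNC T
  -- With `q - u < δ`, a path in the inner ball at time `q` cannot have been outside the outer ball
  -- during `[u, q]`, so it is a survivor from `u` on.
  obtain ⟨u, hu, huq⟩ := exists_rat_btwn (show max (p : ℝ) (q - δ) < q from
    max_lt (by exact_mod_cast hpq) (by linarith))
  have hpu : (p : ℝ) < u := (le_max_left _ _).trans_lt hu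
  have hqu : (q : ℝ) - δ < u := (le_max_right _ _).trans_lt hu
  refine (hfin u q (by exact_mod_cast huq)).subset ?_
  rintro y ⟨⟨n, hn, rfl⟩, hy⟩
  refine ⟨n, hn.trans hpu.le, fun t ht => subset_closure ?_, rfl⟩
  have hp := abs_le.1 ((le_max_left _ _).trans hT)
  have hq := abs_le.1 ((le_max_right _ _).trans hT)
  have h := (hδT n t q (hn.trans (hpu.le.trans ht.1))
    ⟨by linarith [ht.1], by linarith [ht.2]⟩ ht.2 (by linarith [ht.1])).2
  rw [Metric.mem_closedBall, dist_comm] at hy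
  rw [Metric.mem_ball, dist_comm]
  by_contra hle
  exact absurd (h (not_lt.1 hle)) (not_lt.2 hy)

variable {M : Type u} [MetricSpace M] [LocallyCompactSpace M] [SecondCountableTopology M]
  [MeasurableSpace M] [BorelSpace M]
  {P : ∀ n : ℕ, ℝ≥0 → Kernel (Fin n → M) (Fin n → M)}
  {Ω : Type v} [mΩ : MeasurableSpace Ω] {μ : Measure Ω} [IsProbabilityMeasure μ]
  {ψ : ℝ → ℝ → Ω → MeasurableMap M} {s : ℕ → ℝ} {x : ℕ → M} {Φ : ℕ → Ω → PathSpace M}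

/-- Only countably many cells and rational times are involved, so all almost sure statements hold
simultaneously, and the rest is deterministic for each outcome. -/
theorem ae_isSkeleton_and_hasICP (G : MetricGraph M) (hP : IsConsistentCoalescing P)
    (hcont : HasSmallJumps (P 1)) (hfast : G.HasFastCoalescence (P 2))
    (hψ : IsStochasticFlow μ P ψ) (hD : DenseRange fun n => (s n, x n))
    (hΦ : ∀ n, IsContinuousModification μ ψ (s n) (x n) (Φ n)) :
    ∀ᵐ ω ∂μ, IsSkeleton (fun n => Φ n ω) ∧ HasICP (fun n => Φ n ω) := by
  obtain ⟨D, R₁, R₂, hcell, hstar⟩ := G.exists_isCellCover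
  have hR₂ : ∀ m c, 0 < R₂ m c := fun m c => (hcell.pos m c).trans (hcell.lt m c)
  have hNC : ∀ᵐ ω ∂μ, ∀ m, ∀ c ∈ D m, ∀ T : ℕ,
      NoCrossing (fun n => Φ n ω) c (R₁ m c) (R₂ m c) T := by
    refine ae_all_iff.2 fun m => (ae_ball_iff (hcell.countable m)).2 fun c _ =>
      ae_all_iff.2 fun T => ?_
    obtain ⟨η, ι, hι, A, hA, hη, -⟩ := hstar m c
    exact ae_noCrossing hP hcont hψ hD hΦ hA (hcell.pos m c) (hcell.lt m c) hη T
  have hfin : ∀ᵐ ω ∂μ, ∀ m, ∀ c ∈ D m, ∀ u q : ℚ, u < q → {y | ∃ n, s n ≤ u ∧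
      (∀ t ∈ Icc (u : ℝ) q, (Φ n ω).ext t ∈ closure (Metric.ball c (R₂ m c))) ∧
        y = (Φ n ω).ext q}.Finite := by
    refine ae_all_iff.2 fun m => (ae_ball_iff (hcell.countable m)).2 fun c _ =>
      ae_all_iff.2 fun u => ae_all_iff.2 fun q => ?_
    by_cases huq : u < q
    · obtain ⟨η, ι, hι, A, hA, hη, hV⟩ := hstar m c
      obtain ⟨β, p, hβ, hp, hQ⟩ :=
        hfast _ (hA.isSimpleCompact_closure_ball G hV (hR₂ m c) hη)
      obtain ⟨C, hC, hlab⟩ := hA.exists_labelling (hR₂ m c) hη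
      have hsub : closure (Metric.ball c (R₂ m c)) ⊆ Metric.closedBall c (R₂ m c) :=
        Metric.closure_ball_subset_closedBall
      have h1 := ae_finite_survivors hP hψ hΦ isClosed_closure hβ hp hC hQ
        (fun ε hε hε1 => by
          obtain ⟨N, lab, hm, hN, hd⟩ := hlab ε hε hε1
          exact ⟨N, lab, hm, hN, fun y hy y' hy' => hd y (hsub hy) y' (hsub hy')⟩)
        (show (u : ℝ) < q by exact_mod_cast huq)
      filter_upwards [h1] with ω hω _
      exact hω
    · exact Eventually.of_forall fun ω h => absurd h huq
  filter_upwards [hNC, hfin, ae_coalescence hP hψ hΦ] with ω hNC hfin hco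
  have hstart : ∀ n, (Φ n ω).start = s n := fun n => (hΦ n).start_eq ω
  have hcoal : ∀ (t : ℝ) (m n : ℕ), (Φ m ω).start ≤ t → (Φ n ω).start ≤ t →
      (Φ m ω).ext t = (Φ n ω).ext t → ∀ t', t ≤ t' → (Φ m ω).ext t' = (Φ n ω).ext t' := by
    intro t m n hm hn
    rw [hstart] at hm hn
    exact hco t m n hm hn
  have hdense : DenseRange fun n => ((Φ n ω).start, (Φ n ω).ext (Φ n ω).start) := by
    simp only [hstart, (hΦ _).start_value ω]
    exact hD
  have hICP : HasICP fun n => Φ n ω := by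
    refine hasICP_of_cells hcell hcoal hNC fun m c hc p q hpq =>
      finite_positions_of_survivors (hNC m c hc) (fun u q huq => ?_) hpq
    simp only [hstart]
    exact hfin m c hc u q huq
  exact ⟨isSkeleton_of_cells hcell hcoal hdense hNC hICP, hICP⟩

end Assembly

end CoalescingFlow

end

theorem mainTheorem6
    {M : Type*} [MetricSpace M] [LocallyCompactSpace M] [TopologicalSpace.SeparableSpace M]
    [MeasurableSpace M] [BorelSpace M]
    (G : CoalescingFlow.MetricGraph M)
    (P : ∀ n : ℕ, ℝ≥0 → Kernel (Fin n → M) (Fin n → M))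
    (hP : CoalescingFlow.IsConsistentCoalescing P)
    (hcont : CoalescingFlow.HasSmallJumps (P 1))
    (hfast : G.HasFastCoalescence (P 2))
    {Ω : Type*} [MeasurableSpace Ω] (μ : Measure Ω) [IsProbabilityMeasure μ]
    (ψ : ℝ → ℝ → Ω → CoalescingFlow.MeasurableMap M)
    (hψ : CoalescingFlow.IsStochasticFlow μ P ψ)
    (s : ℕ → ℝ) (x : ℕ → M) (hD : DenseRange fun n => (s n, x n))
    (Φ : ℕ → Ω → CoalescingFlow.PathSpace M)
    (hΦ : ∀ n, CoalescingFlow.IsContinuousModification μ ψ (s n) (x n) (Φ n)) :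
    ∀ᵐ ω ∂μ, CoalescingFlow.IsSkeleton (fun n => Φ n ω) ∧
      CoalescingFlow.HasICP (fun n => Φ n ω) := by
  have : SecondCountableTopology M := UniformSpace.secondCountable_of_separable M
  exact CoalescingFlow.ae_isSkeleton_and_hasICP G hP hcont hfast hψ hD hΦ
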